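/- Let $q\in\mathbb{C}$ be non-zero and not a root of unity. Let $A=\mathcal{O}_q(\mathrm{SL}_2(\mathbb{C}))$ be the unital algebra generated by $\alpha,\beta,\gamma,\delta$ with relations $\beta\alpha=q\alpha\beta$, $\gamma\alpha=q\alpha\gamma$, $\delta\beta=q\beta\delta$, $\delta\gamma=q\gamma\delta$, $\gamma\beta=\beta\gamma$, $\delta\alpha-\alpha\delta=(q-q^{-1})\beta\gamma$, $\alpha\delta-q^{-1}\beta\gamma=1$. Let $H=\mathcal{O}(U(1))=\mathbb{C}[t,t^{-1}]$ (with $t$ group-like) coact on $A$ from the right by the algebra map $\Delta_A\colon A\to A\otimes H$ with $\Delta_A(f)=f\otimes t^{|f|}$ for $f\in\{\alpha,\beta,\gamma,\delta\}$, where $|\alpha|=|\gamma|=1$, $|\beta|=|\delta|=-1$, and let $B=\{b\in A : \Delta_A(b)=b\otimes 1\}$ (the Podleś sphere). A differential calculus on an algebra is a differential graded algebra $\Omega^\bullet$ with that algebra as $\Omega^0$ and $\Omega^k=\mathrm{span}\{a^0\mathrm{d}a^1\wedge\dots\wedge\mathrm{d}a^k\}$ for all $k$. On $H$ take $\Omega^\bullet(H)=H\oplus\Omega^1(H)$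 with $\Omega^1(H)=H\,\mathrm{d}t$ free as a left $H$-module, $\mathrm{d}t\,t=q^{2}t\,\mathrm{d}t$, and $\Omega^k(H)=0$ for $k\ge2$. On $A$ take the 3D calculus $\Omega^\bullet(A)=A\oplus\Omega^1(A)\oplus\Omega^2(A)\oplus\Omega^3(A)$: these are free left $A$-modules with bases $\{e^+,e^-,e^0\}$, $\{e^+\wedge e^-,\,e^\pm\wedge e^0\}$ and $\{e^+\wedge e^-\wedge e^0\}$ respectively, where $$e^+=q^{-1}\alpha\,\mathrm{d}\gamma-q^{-2}\gamma\,\mathrm{d}\alpha,\qquad e^-=\delta\,\mathrm{d}\beta-q\beta\,\mathrm{d}\delta,\qquad e^0=\delta\,\mathrm{d}\alpha-q\beta\,\mathrm{d}\gamma,$$ with relations, for $f\in\{\alpha,\beta,\gamma,\delta\}$, $e^\pm f=q^{|f|}fe^\pm$, $e^0f=q^{2|f|}fe^0$, $e^+\wedge e^-=-q^{-2}e^-\wedge e^+$, $e^\pm\wedge e^0=-q^{\mp4}e^0\wedge e^\pm$, $e^\pm\wedge e^\pm=e^0\wedge e^0=0$, and $\mathrm{d}e^0=q^3e^+\wedge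 e^-$, $\mathrm{d}e^\pm=\mp q^{\pm2}(1+q^{-2})\,e^\pm\wedge e^0$. Then $\Omega^\bullet(H)$ and $\Omega^\bullet(A)$ are differential calculi, and $\Omega^\bullet(A)$ is complete: $\Delta_A$ extends to a morphism of differential graded algebras $\Delta_A^\bullet\colon\Omega^\bullet(A)\to\Omega^\bullet(A)\otimes\Omega^\bullet(H)$ (graded tensor product). Moreover, for any such extension $\Delta_A^\bullet$: 1. The base forms $\Omega^\bullet(B):=\{\omega\in\Omega^\bullet(A):\Delta_A^\bullet(\omega)=\omega\otimes1\}$ are the pullback calculus generated by $B$: $\Omega^\bullet(B)=\bigoplus_k\Omega^k(B)$ and, for all $k\ge0$, $\Omega^k(B)=\Omega^\bullet(B)\cap\Omega^k(A)=\mathrm{span}_{\mathbb{C}}\{b^0\mathrm{d}b^1\wedge\dots\wedge\mathrm{d}b^k : b^i\in B\}$. 2. Let $\Lambda^\bullet\subseteq\Omega^\bullet(H)$ be the forms that are coinvariant under the left $H$-coaction $h\,\mathrm{d}g\mapsto h_1g_1\otimes h_2\,\mathrm{d}g_2$ (and the comultiplication in degree $0$). Then $\Lambda^\bullet=\mathbb{C}\oplus\Lambda^1$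 with $\Lambda^1=\mathrm{span}_{\mathbb{C}}\{t^{-1}\mathrm{d}t\}\ne0$, so that the vertical forms $\mathrm{ver}^\bullet:=A\otimes\Lambda^\bullet$ are $A\otimes(\mathbb{C}\oplus\Lambda^1)$, free over $A$ on $1\otimes1$ and $1\otimes t^{-1}\mathrm{d}t$. The horizontal forms $\mathrm{hor}^\bullet:=(\Delta_A^\bullet)^{-1}(\Omega^\bullet(A)\otimes H)$ are $\mathrm{hor}^\bullet=A\,\Omega^\bullet(B)\,A$, the $A$-bimodule generated by the base forms. 3. The linear map $s\colon\Lambda^1\to\Omega^1(A)$, $t^{-1}\mathrm{d}t\mapsto e^0$, is a connection $1$-form: it is a morphism of right $H$-comodules, where $\Lambda^1$ carries the adjoint coaction $\varpi(h)\mapsto\varpi(h_2)\otimes S(h_1)h_3$ with $\varpi(h)=S(h_1)\mathrm{d}h_2$, and $\Omega^1(A)$ the coaction given by the component of $\Delta_A^\bullet$ in $\Omega^1(A)\otimes H$; and $\pi_v(s(\theta))=1\otimes\theta$ for all $\theta\in\Lambda^1$, where $\pi_v\colon\Omega^\bullet(A)\to\mathrm{ver}^\bullet$ is the component of $\Delta_A^\bullet$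 in $A\otimes\Omega^\bullet(H)$ followed by $\mathrm{id}\otimes(\theta\mapsto S(\theta_{-1})\theta_0)$. -/

import Mathlib

noncomputable section

namespace QHopf

open scoped TensorProduct LaurentPolynomial

/-! ## Differential graded algebras, differential calculi and completeness -/

section General

variable {Ω Ω' A H : Type} [Ring Ω] [Algebra ℂ Ω] [Ring Ω'] [Algebra ℂ Ω']
  [Ring A] [Algebra ℂ A] [Ring H] [Algebra ℂ H]

/-- `d` is a differential on the graded algebra `Ω = ⨁ₖ 𝒜 k`: it has degree one, squares to zero
and satisfies the graded Leibniz rule. -/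
structure IsDGA (𝒜 : ℕ → Submodule ℂ Ω) (d : Ω →ₗ[ℂ] Ω) : Prop where
  degree : ∀ k, ∀ ω ∈ 𝒜 k, d ω ∈ 𝒜 (k + 1)
  sq_zero : ∀ ω, d (d ω) = 0
  leibniz : ∀ k, ∀ ω ∈ 𝒜 k, ∀ η, d (ω * η) = d ω * η + (-1 : ℂ) ^ k • (ω * d η)

/-- The span of all `a⁰ da¹ ∧ … ∧ daᵏ` with `a⁰, …, aᵏ ∈ X`. -/
def formSpan (d : Ω →ₗ[ℂ] Ω) (X : Set Ω) (k : ℕ) : Submodule ℂ Ω :=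
  Submodule.span ℂ {ω | ∃ a₀ ∈ X, ∃ a : Fin k → Ω, (∀ i, a i ∈ X) ∧
    ω = a₀ * (List.ofFn fun i => d (a i)).prod}

/-- `(Ω, d)` is a differential calculus on the algebra `A`: it is a differential graded algebra,
`ι` identifies `A` with the forms of degree zero, and `Ω` is generated by `A`. -/
structure IsDifferentialCalculus (ι : A →ₐ[ℂ] Ω) (𝒜 : ℕ → Submodule ℂ Ω) (d : Ω →ₗ[ℂ] Ω) :
    Prop where
  isDGA : IsDGA 𝒜 d
  injective : Function.Injective ι
  range_eq : LinearMap.range ι.toLinearMap = 𝒜 0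
  generated : ∀ k, 𝒜 k = formSpan d (Set.range ι) k

/-- The linear map `ω ↦ (-1)^|ω| ω`. -/
def signOp (𝒜 : ℕ → Submodule ℂ Ω) [GradedAlgebra 𝒜] : Ω →ₗ[ℂ] Ω :=
  DirectSum.toModule ℂ ℕ Ω (fun k => (-1 : ℂ) ^ k • (𝒜 k).subtype) ∘ₗ
    (DirectSum.decomposeLinearEquiv 𝒜).toLinearMap

variable (𝒜 : ℕ → Submodule ℂ Ω) [GradedAlgebra 𝒜] (ℬ : ℕ → Submodule ℂ Ω') [GradedAlgebra ℬ]

/-- The degree `n` part `⨁_{i+j=n} 𝒜 i ⊗ ℬ j` of the graded tensor product, whose multiplication is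
`(ω ⊗ ω') ∧ (η ⊗ η') = (-1)^(|ω'||η|) (ω ∧ η) ⊗ (ω' ∧ η')`. -/
def tensorGrade (n : ℕ) : Submodule ℂ (𝒜 ᵍ⊗[ℂ] ℬ) :=
  ⨆ p ∈ Finset.HasAntidiagonal.antidiagonal n,
    (LinearMap.range (TensorProduct.map (𝒜 p.1).subtype (ℬ p.2).subtype)).map
      (GradedTensorProduct.of ℂ 𝒜 ℬ).toLinearMap

/-- The differential `d(ω ⊗ ω') = dω ⊗ ω' + (-1)^|ω| ω ⊗ dω'` of the tensor product. -/
def tensorD (d : Ω →ₗ[ℂ] Ω) (d' : Ω' →ₗ[ℂ] Ω') : (𝒜 ᵍ⊗[ℂ] ℬ) →ₗ[ℂ] (𝒜 ᵍ⊗[ℂ] ℬ) :=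
  (GradedTensorProduct.of ℂ 𝒜 ℬ).toLinearMap ∘ₗ
    (TensorProduct.map d LinearMap.id + TensorProduct.map (signOp 𝒜) d') ∘ₗ
    (GradedTensorProduct.of ℂ 𝒜 ℬ).symm.toLinearMap

/-- `Δ : Ω(A) → Ω(A) ⊗ Ω(H)` is a morphism of differential graded algebras extending the right
coaction `Δ₀ : A → A ⊗ H`. -/
structure IsCoactionExtension (ι : A →ₐ[ℂ] Ω) (ι' : H →ₐ[ℂ] Ω') (d : Ω →ₗ[ℂ] Ω)
    (d' : Ω' →ₗ[ℂ] Ω') (Δ₀ : A →ₐ[ℂ] A ⊗[ℂ] H) (Δ : Ω →ₐ[ℂ] 𝒜 ᵍ⊗[ℂ] ℬ) : Prop where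
  extend : ∀ a, Δ (ι a) =
    GradedTensorProduct.of ℂ 𝒜 ℬ (TensorProduct.map ι.toLinearMap ι'.toLinearMap (Δ₀ a))
  degree : ∀ k, ∀ ω ∈ 𝒜 k, Δ ω ∈ tensorGrade 𝒜 ℬ k
  comm_d : ∀ ω, Δ (d ω) = tensorD 𝒜 ℬ d d' (Δ ω)

/-- The calculus `Ω(A)` is complete with respect to the calculus `Ω(H)`: the right coaction
extends to a morphism of differential graded algebras `Ω(A) → Ω(A) ⊗ Ω(H)`. -/
def IsComplete (ι : A →ₐ[ℂ] Ω) (ι' : H →ₐ[ℂ] Ω') (d : Ω →ₗ[ℂ] Ω)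
    (d' : Ω' →ₗ[ℂ] Ω') (Δ₀ : A →ₐ[ℂ] A ⊗[ℂ] H) : Prop :=
  ∃ Δ : Ω →ₐ[ℂ] 𝒜 ᵍ⊗[ℂ] ℬ, IsCoactionExtension 𝒜 ℬ ι ι' d d' Δ₀ Δ

variable {𝒜 ℬ}

/-- The base forms `{ω | Δ ω = ω ⊗ 1}`. -/
def baseForms (Δ : Ω →ₐ[ℂ] 𝒜 ᵍ⊗[ℂ] ℬ) : Submodule ℂ Ω :=
  LinearMap.eqLocus Δ.toLinearMap (GradedTensorProduct.includeLeft 𝒜 ℬ).toLinearMap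

/-- The horizontal forms: the preimage of `Ω(A) ⊗ H` under `Δ`. -/
def horForms (ι' : H →ₐ[ℂ] Ω') (Δ : Ω →ₐ[ℂ] 𝒜 ᵍ⊗[ℂ] ℬ) : Submodule ℂ Ω :=
  (LinearMap.range (TensorProduct.map (LinearMap.id : Ω →ₗ[ℂ] Ω) ι'.toLinearMap)).comap
    ((GradedTensorProduct.of ℂ 𝒜 ℬ).symm.toLinearMap ∘ₗ Δ.toLinearMap)

/-- The `A`-bimodule `A W A` generated by `W`. -/
def bimoduleSpan (ι : A →ₐ[ℂ] Ω) (W : Submodule ℂ Ω) : Submodule ℂ Ω :=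
  Submodule.span ℂ {η | ∃ a a' : A, ∃ ω ∈ W, η = ι a * ω * ι a'}

end General

/-! ## Skew exterior algebras over an algebra -/

/-- The data of a skew exterior algebra over `R` on generators `e₀, …, eₙ₋₁`, with relations
`eᵢ r = θ^(w i)(r) eᵢ` for `r ∈ R`, `eᵢ ∧ eⱼ = c i j • eⱼ ∧ eᵢ` for `j < i`, and `eᵢ ∧ eᵢ = 0`. -/
structure SkewData (R : Type) [Ring R] [Algebra ℂ R] (n : ℕ) where
  θ : R →ₐ[ℂ] R
  w : Fin n → ℕ
  c : Fin n → Fin n → ℂ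

namespace SkewData
variable {R : Type} [Ring R] [Algebra ℂ R] {n : ℕ} (D : SkewData R n)

/-- The automorphism by which an element of `R` is moved to the left past `e_S`. -/
def tw (S : Finset (Fin n)) : R →ₐ[ℂ] R := D.θ ^ (∑ i ∈ S, D.w i)

/-- The factor in `e_S ∧ e_T = sg S T • e_{S ∪ T}` for disjoint `S`, `T`, where `e_S` is the wedge
product of the `eᵢ`, `i ∈ S`, in increasing order. -/
def sg (S T : Finset (Fin n)) : ℂ := ∏ i ∈ S, ∏ j ∈ T, if j < i then D.c i j else 1

@[simp] theorem tw_empty : D.tw ∅ = AlgHom.id ℂ R := by simp [tw]; rfl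

theorem tw_union {S T : Finset (Fin n)} (h : Disjoint S T) (r : R) :
    D.tw (S ∪ T) r = D.tw S (D.tw T r) := by
  simp [tw, Finset.sum_union h, pow_add]

@[simp] theorem sg_empty_left (S : Finset (Fin n)) : D.sg ∅ S = 1 := by simp [sg]
@[simp] theorem sg_empty_right (S : Finset (Fin n)) : D.sg S ∅ = 1 := by simp [sg]

theorem sg_union_left {S T : Finset (Fin n)} (h : Disjoint S T) (U : Finset (Fin n)) :
    D.sg (S ∪ T) U = D.sg S U * D.sg T U := by simp [sg, Finset.prod_union h]

theorem sg_union_right (S : Finset (Fin n)) {T U : Finset (Fin n)} (h : Disjoint T U) :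
    D.sg S (T ∪ U) = D.sg S T * D.sg S U := by
  simp [sg, Finset.prod_union h, Finset.prod_mul_distrib]

end SkewData

/-- The skew exterior algebra: the free left `R`-module with basis the monomials `e_S`. An element
`∑ r_S e_S` is stored as the family of its coefficients. -/
def SkewExt {R : Type} [Ring R] [Algebra ℂ R] {n : ℕ} (_D : SkewData R n) : Type :=
  Finset (Fin n) → R

namespace SkewExt
variable {R : Type} [Ring R] [Algebra ℂ R] {n : ℕ} (D : SkewData R n)

instance : AddCommGroup (SkewExt D) := inferInstanceAs (AddCommGroup (Finset (Fin n) → R))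
instance : Module ℂ (SkewExt D) := inferInstanceAs (Module ℂ (Finset (Fin n) → R))

/-- The form `r e_S`. -/
def mon (S : Finset (Fin n)) : R →ₗ[ℂ] SkewExt D := LinearMap.single ℂ (fun _ => R) S

/-- The coefficient of `e_S`. -/
def coeff (S : Finset (Fin n)) : SkewExt D →ₗ[ℂ] R := LinearMap.proj S

variable {D}

@[ext] theorem ext' {x y : SkewExt D} (h : ∀ S, coeff D S x = coeff D S y) : x = y := funext h

/-- `(r e_S)(r' e_T) = sg S T • r (tw S r') e_{S ∪ T}` for disjoint `S`, `T`, and zero otherwise. -/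
instance : Mul (SkewExt D) where
  mul x y := fun U => ∑ S ∈ U.powerset,
    D.sg S (U \ S) • (coeff D S x * D.tw S (coeff D (U \ S) y))

theorem coeff_mul (U : Finset (Fin n)) (x y : SkewExt D) :
    coeff D U (x * y) = ∑ S ∈ U.powerset,
      D.sg S (U \ S) • (coeff D S x * D.tw S (coeff D (U \ S) y)) := rfl

theorem coeff_mon (S T : Finset (Fin n)) (r : R) :
    coeff D T (mon D S r) = if T = S then r else 0 := by
  change Pi.single (M := fun _ => R) S r T = _
  rw [Pi.single_apply]

theorem mul_assoc' (x y z : SkewExt D) : x * y * z = x * (y * z) := by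
  ext U
  simp only [coeff_mul, Finset.sum_mul, Finset.mul_sum, Finset.smul_sum, map_sum]
  rw [Finset.sum_sigma', Finset.sum_sigma']
  refine Finset.sum_bij' (fun p _ => ⟨p.2, p.1 \ p.2⟩) (fun p _ => ⟨p.1 ∪ p.2, p.1⟩) ?_ ?_ ?_ ?_ ?_
  · rintro ⟨P, S⟩ h
    simp only [Finset.mem_sigma, Finset.mem_powerset] at h ⊢
    exact ⟨h.2.trans h.1, Finset.sdiff_subset_sdiff h.1 le_rfl⟩
  · rintro ⟨S, T⟩ h
    simp only [Finset.mem_sigma, Finset.mem_powerset] at h ⊢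
    exact ⟨Finset.union_subset h.1 (h.2.trans Finset.sdiff_subset), Finset.subset_union_left⟩
  · rintro ⟨P, S⟩ h
    simp only [Finset.mem_sigma, Finset.mem_powerset] at h
    simp [Finset.union_sdiff_of_subset h.2]
  · rintro ⟨S, T⟩ h
    simp only [Finset.mem_sigma, Finset.mem_powerset] at h
    have : Disjoint T S := Finset.disjoint_of_subset_left h.2 Finset.sdiff_disjoint
    simp [Finset.union_sdiff_left, Finset.sdiff_eq_self_of_disjoint this]
  · rintro ⟨P, S⟩ h
    simp only [Finset.mem_sigma, Finset.mem_powerset] at h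
    obtain ⟨hP, hS⟩ := h
    have e1 : P = S ∪ (P \ S) := (Finset.union_sdiff_of_subset hS).symm
    have d1 : Disjoint S (P \ S) := Finset.disjoint_sdiff
    have e2 : U \ S = (P \ S) ∪ (U \ P) := by
      ext i; simp only [Finset.mem_sdiff, Finset.mem_union]
      have := @hP i; have := @hS i; tauto
    have d2 : Disjoint (P \ S) (U \ P) :=
      Finset.disjoint_of_subset_left Finset.sdiff_subset Finset.disjoint_sdiff
    have e3 : (U \ S) \ (P \ S) = U \ P := by
      ext i; simp only [Finset.mem_sdiff]
      have := @hP i; have := @hS i; tauto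
    have t1 : ∀ r, D.tw P r = D.tw S (D.tw (P \ S) r) := fun r => by
      rw [← D.tw_union d1, ← e1]
    have s1 : D.sg P (U \ P) = D.sg S (U \ P) * D.sg (P \ S) (U \ P) := by
      rw [← D.sg_union_left d1, ← e1]
    have s2 : D.sg S (U \ S) = D.sg S (P \ S) * D.sg S (U \ P) := by
      rw [← D.sg_union_right _ d2, ← e2]
    simp only [e3, t1, s1, s2, map_smul, map_mul, smul_mul_assoc, mul_smul_comm, smul_smul,
      mul_assoc]
    congr 1
    ring

instance : One (SkewExt D) := ⟨mon D ∅ 1⟩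

theorem mon_empty_mul (r : R) (x : SkewExt D) (U : Finset (Fin n)) :
    coeff D U (mon D ∅ r * x) = r * coeff D U x := by
  rw [coeff_mul, Finset.sum_eq_single ∅]
  · simp [coeff_mon]
  · intro S _ hS; simp [coeff_mon, hS]
  · simp

theorem mul_mon_empty (r : R) (x : SkewExt D) (U : Finset (Fin n)) :
    coeff D U (x * mon D ∅ r) = coeff D U x * D.tw U r := by
  rw [coeff_mul, Finset.sum_eq_single U]
  · simp [coeff_mon]
  · intro S hS hS'
    have : U \ S ≠ ∅ := fun h => hS' (Finset.Subset.antisymm (Finset.mem_powerset.1 hS)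
      (Finset.sdiff_eq_empty_iff_subset.1 h))
    simp [coeff_mon, this]
  · simp

instance : Ring (SkewExt D) :=
  { (inferInstance : AddCommGroup (SkewExt D)) with
    mul := (· * ·)
    one := 1
    mul_assoc := mul_assoc'
    one_mul := fun x => by ext U; exact (mon_empty_mul 1 x U).trans (one_mul _)
    mul_one := fun x => by ext U; exact (mul_mon_empty 1 x U).trans (by simp)
    left_distrib := fun x y z => by
      ext U; simp only [coeff_mul, map_add, mul_add, smul_add, Finset.sum_add_distrib]
    right_distrib := fun x y z => by
      ext U; simp only [coeff_mul, map_add, add_mul, smul_add, Finset.sum_add_distrib]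
    zero_mul := fun x => by ext U; simp [coeff_mul]
    mul_zero := fun x => by ext U; simp [coeff_mul] }

instance : Algebra ℂ (SkewExt D) := Algebra.ofModule
  (fun r x y => by
    ext U; simp only [coeff_mul, map_smul, smul_mul_assoc, Finset.smul_sum, smul_comm r])
  (fun r x y => by
    ext U; simp only [coeff_mul, map_smul, mul_smul_comm, Finset.smul_sum, smul_comm r])

variable (D) in
/-- The inclusion of `R` as the forms of degree zero. -/
def incl : R →ₐ[ℂ] SkewExt D := AlgHom.ofLinearMap (mon D ∅) rfl (fun r s => by
  ext U; rw [mon_empty_mul]; simp [coeff_mon])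

variable (D) in
/-- The forms of degree `k`: combinations of the `e_S` with `|S| = k`. -/
def grade (k : ℕ) : Submodule ℂ (SkewExt D) where
  carrier := {x | ∀ S : Finset (Fin n), S.card ≠ k → coeff D S x = 0}
  add_mem' := fun hx hy S hS => by rw [map_add, hx S hS, hy S hS, add_zero]
  zero_mem' := fun S _ => map_zero _
  smul_mem' := fun c x hx S hS => by rw [map_smul, hx S hS, smul_zero]

variable (D) in
/-- The projection onto the forms of degree `k`. -/
def part (k : ℕ) : SkewExt D →ₗ[ℂ] grade D k :=
  LinearMap.codRestrict (grade D k)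
    (LinearMap.pi (φ := fun _ : Finset (Fin n) => R)
      (fun S => if S.card = k then coeff D S else 0) : SkewExt D →ₗ[ℂ] SkewExt D)
    (fun x S hS => by
      change (if S.card = k then coeff D S else 0) x = 0
      rw [if_neg hS]; rfl)

theorem coeff_part (k : ℕ) (x : SkewExt D) (S : Finset (Fin n)) :
    coeff D S (part D k x : SkewExt D) = if S.card = k then coeff D S x else 0 := by
  change (if S.card = k then coeff D S else 0) x = _
  split_ifs <;> rfl

theorem part_same (k : ℕ) (x : grade D k) : part D k (x : SkewExt D) = x := by
  apply Subtype.ext; ext S; rw [coeff_part]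
  split_ifs with h
  · rfl
  · exact (x.2 S h).symm

theorem part_ne {k l : ℕ} (h : l ≠ k) (x : grade D k) : part D l (x : SkewExt D) = 0 := by
  apply Subtype.ext; ext S; rw [coeff_part]
  split_ifs with h'
  · exact x.2 S (h' ▸ h)
  · rfl

instance : GradedAlgebra (grade D) where
  one_mem := fun S hS => by
    have : S ≠ ∅ := by rintro rfl; exact hS rfl
    exact (coeff_mon ∅ S (1 : R)).trans (if_neg this)
  mul_mem := fun i j x y hx hy U hU => by
    rw [coeff_mul]
    refine Finset.sum_eq_zero fun S hS => ?_
    by_cases h : S.card = i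
    · have : (U \ S).card ≠ j := by
        rw [Finset.card_sdiff_of_subset (Finset.mem_powerset.1 hS)]
        have := Finset.card_le_card (Finset.mem_powerset.1 hS)
        omega
      rw [hy _ this]; simp
    · rw [hx _ h]; simp
  toDecomposition := DirectSum.Decomposition.ofLinearMap (grade D)
    (∑ k ∈ Finset.range (n + 1), DirectSum.lof ℂ ℕ (fun k => grade D k) k ∘ₗ part D k)
    (by
      ext x : 1
      simp only [LinearMap.comp_apply, LinearMap.sum_apply, map_sum,
        DirectSum.coeLinearMap_lof, LinearMap.id_apply]
      ext S
      rw [map_sum]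
      simp only [coeff_part]
      rw [Finset.sum_eq_single S.card]
      · simp
      · intro b _ hb; rw [if_neg (Ne.symm hb)]
      · intro h
        exact absurd (Finset.mem_range.2 (Nat.lt_succ_of_le
          ((Finset.card_le_univ S).trans (by simp)))) h)
    (by
      ext k x : 2
      simp only [LinearMap.sum_apply, LinearMap.comp_apply,
        DirectSum.coeLinearMap_lof, LinearMap.id_apply]
      by_cases hk : k ∈ Finset.range (n + 1)
      · rw [Finset.sum_eq_single k]
        · rw [part_same]
        · intro b _ hb; rw [part_ne hb, map_zero]
        · intro h; exact absurd hk h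
      · have hx : x = 0 := by
          apply Subtype.ext; ext S
          refine x.2 S ?_
          rintro rfl
          exact hk (Finset.mem_range.2 (Nat.lt_succ_of_le
            ((Finset.card_le_univ S).trans (by simp))))
        subst hx
        simp)

variable (D)

theorem mon_mul_incl  (S : Finset (Fin n)) (r s : R) :
    mon D S r * incl D s = mon D S (r * D.tw S s) := by
  ext U
  refine (mul_mon_empty s _ U).trans ?_
  rw [coeff_mon, coeff_mon]
  split_ifs with h
  · rw [h]
  · rw [zero_mul]

theorem incl_mul_mon  (S : Finset (Fin n)) (r s : R) :
    incl D s * mon D S r = mon D S (s * r) := by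
  ext U
  refine (mon_empty_mul s _ U).trans ?_
  rw [coeff_mon, coeff_mon]
  split_ifs with h
  · rfl
  · rw [mul_zero]

theorem mon_mul_mon (S T : Finset (Fin n)) (r s : R) :
    mon D S r * mon D T s =
      if Disjoint S T then D.sg S T • mon D (S ∪ T) (r * D.tw S s) else 0 := by
  ext U
  rw [coeff_mul]
  by_cases hS : S ⊆ U
  · rw [Finset.sum_eq_single S (by intro P _ hP; simp [coeff_mon, hP]) (by simp [hS])]
    by_cases h : U \ S = T
    · have hU : U = S ∪ T := by rw [← h, Finset.union_sdiff_of_subset hS]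
      have hd : Disjoint S T := h ▸ Finset.disjoint_sdiff
      rw [if_pos hd, map_smul, coeff_mon, coeff_mon, coeff_mon, if_pos rfl, if_pos h, if_pos hU, h]
    · rw [coeff_mon, coeff_mon, if_neg h, map_zero, mul_zero, smul_zero]
      split_ifs with hd
      · rw [map_smul, coeff_mon, if_neg, smul_zero]
        rintro rfl
        exact h (Finset.union_sdiff_cancel_left hd)
      · rw [map_zero]
  · rw [Finset.sum_eq_zero]
    · split_ifs with hd
      · rw [map_smul, coeff_mon, if_neg, smul_zero]
        rintro rfl
        exact hS Finset.subset_union_left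
      · rw [map_zero]
    · intro P hP
      have : P ≠ S := by rintro rfl; exact hS (Finset.mem_powerset.1 hP)
      simp [coeff_mon, this]

end SkewExt

/-! ## The quantum group `O_q(SL₂)` with its `U(1)`-coaction -/

/-- The generators of `O_q(SL₂)`. -/
inductive Gen | α | β | γ | δ

/-- The Manin relations and the quantum determinant relation. -/
inductive SLRel (q : ℂˣ) : FreeAlgebra ℂ Gen → FreeAlgebra ℂ Gen → Prop
  | ba : SLRel q (.ι ℂ .β * .ι ℂ .α) ((q : ℂ) • (.ι ℂ .α * .ι ℂ .β))
  | ca : SLRel q (.ι ℂ .γ * .ι ℂ .α) ((q : ℂ) • (.ι ℂ .α * .ι ℂ .γ))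
  | db : SLRel q (.ι ℂ .δ * .ι ℂ .β) ((q : ℂ) • (.ι ℂ .β * .ι ℂ .δ))
  | dc : SLRel q (.ι ℂ .δ * .ι ℂ .γ) ((q : ℂ) • (.ι ℂ .γ * .ι ℂ .δ))
  | da : SLRel q (.ι ℂ .δ * .ι ℂ .α - .ι ℂ .α * .ι ℂ .δ)
      ((q - (q : ℂ)⁻¹) • (.ι ℂ .β * .ι ℂ .γ))
  | cb : SLRel q (.ι ℂ .γ * .ι ℂ .β) (.ι ℂ .β * .ι ℂ .γ)
  | det : SLRel q (.ι ℂ .α * .ι ℂ .δ - (q : ℂ)⁻¹ • (.ι ℂ .β * .ι ℂ .γ)) 1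

/-- The algebra `O_q(SL₂(ℂ))`. -/
def OqSL2 (q : ℂˣ) : Type := RingQuot (SLRel q)

namespace OqSL2
variable {q : ℂˣ}

instance : Ring (OqSL2 q) := inferInstanceAs (Ring (RingQuot (SLRel q)))
instance : Algebra ℂ (OqSL2 q) := inferInstanceAs (Algebra ℂ (RingQuot (SLRel q)))

variable (q) in
/-- The projection from the free algebra. -/
def proj : FreeAlgebra ℂ Gen →ₐ[ℂ] OqSL2 q := RingQuot.mkAlgHom ℂ (SLRel q)

theorem proj_rel {x y : FreeAlgebra ℂ Gen} (h : SLRel q x y) : proj q x = proj q y :=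
  RingQuot.mkAlgHom_rel ℂ h

/-- The generators as elements of `O_q(SL₂(ℂ))`. -/
def gen (q : ℂˣ) (x : Gen) : OqSL2 q := proj q (FreeAlgebra.ι ℂ x)

theorem rel_ba : gen q .β * gen q .α = (q : ℂ) • (gen q .α * gen q .β) := by
  simpa [gen] using proj_rel (SLRel.ba (q := q))
theorem rel_ca : gen q .γ * gen q .α = (q : ℂ) • (gen q .α * gen q .γ) := by
  simpa [gen] using proj_rel (SLRel.ca (q := q))
theorem rel_db : gen q .δ * gen q .β = (q : ℂ) • (gen q .β * gen q .δ) := by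
  simpa [gen] using proj_rel (SLRel.db (q := q))
theorem rel_dc : gen q .δ * gen q .γ = (q : ℂ) • (gen q .γ * gen q .δ) := by
  simpa [gen] using proj_rel (SLRel.dc (q := q))
theorem rel_cb : gen q .γ * gen q .β = gen q .β * gen q .γ := by
  simpa [gen] using proj_rel (SLRel.cb (q := q))
theorem rel_det : gen q .α * gen q .δ = 1 + (q : ℂ)⁻¹ • (gen q .β * gen q .γ) := by
  have := proj_rel (SLRel.det (q := q))
  rw [map_sub, map_mul, map_smul, map_mul, map_one] at this
  exact sub_eq_iff_eq_add.1 this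
theorem rel_da : gen q .δ * gen q .α = 1 + (q : ℂ) • (gen q .β * gen q .γ) := by
  have := proj_rel (SLRel.da (q := q))
  rw [map_sub, map_mul, map_smul, map_mul, map_mul] at this
  have h := sub_eq_iff_eq_add.1 this
  change gen q .δ * gen q .α = _ • (gen q .β * gen q .γ) + gen q .α * gen q .δ at h
  rw [h, rel_det]; module

/-- The universal property of `O_q(SL₂(ℂ))`. -/
def lift {S : Type} [Ring S] [Algebra ℂ S] (f : Gen → S)
    (ba : f .β * f .α = (q : ℂ) • (f .α * f .β))
    (ca : f .γ * f .α = (q : ℂ) • (f .α * f .γ))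
    (db : f .δ * f .β = (q : ℂ) • (f .β * f .δ))
    (dc : f .δ * f .γ = (q : ℂ) • (f .γ * f .δ))
    (cb : f .γ * f .β = f .β * f .γ)
    (ad : f .α * f .δ = 1 + (q : ℂ)⁻¹ • (f .β * f .γ))
    (da : f .δ * f .α = 1 + (q : ℂ) • (f .β * f .γ)) : OqSL2 q →ₐ[ℂ] S :=
  show RingQuot (SLRel q) →ₐ[ℂ] S from RingQuot.liftAlgHom ℂ ⟨FreeAlgebra.lift ℂ f, by
    intro x y h
    cases h with
    | ba => simpa using ba
    | ca => simpa using ca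
    | db => simpa using db
    | dc => simpa using dc
    | cb => simpa using cb
    | da => simp [da, ad, sub_smul]
    | det => simp [ad]⟩

@[simp] theorem lift_gen {S : Type} [Ring S] [Algebra ℂ S] (f : Gen → S) (h₁ h₂ h₃ h₄ h₅ h₆ h₇)
    (x : Gen) : lift (q := q) f h₁ h₂ h₃ h₄ h₅ h₆ h₇ (gen q x) = f x := by
  refine (RingQuot.liftAlgHom_mkAlgHom_apply ℂ _ _ _).trans ?_
  simp

/-- The degree of a generator. -/
def deg : Gen → ℤ | .α => 1 | .β => -1 | .γ => 1 | .δ => -1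

theorem tmul_gen_mul (x y : Gen) :
    (gen q x ⊗ₜ[ℂ] LaurentPolynomial.T (deg x)) * (gen q y ⊗ₜ[ℂ] LaurentPolynomial.T (deg y)) =
      (gen q x * gen q y) ⊗ₜ[ℂ] (LaurentPolynomial.T (deg x + deg y) : ℂ[T;T⁻¹]) := by
  rw [Algebra.TensorProduct.tmul_mul_tmul, LaurentPolynomial.T_add]

/-- The right coaction of `O(U(1)) = ℂ[t, t⁻¹]`, given by `x ↦ x ⊗ t^|x|` on generators. -/
def coact (q : ℂˣ) : OqSL2 q →ₐ[ℂ] OqSL2 q ⊗[ℂ] ℂ[T;T⁻¹] :=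
  lift (q := q) (fun x => gen q x ⊗ₜ[ℂ] LaurentPolynomial.T (deg x))
    (by rw [tmul_gen_mul, tmul_gen_mul, rel_ba]; rfl)
    (by rw [tmul_gen_mul, tmul_gen_mul, rel_ca]; rfl)
    (by rw [tmul_gen_mul, tmul_gen_mul, rel_db]; rfl)
    (by rw [tmul_gen_mul, tmul_gen_mul, rel_dc]; rfl)
    (by rw [tmul_gen_mul, tmul_gen_mul, rel_cb]; rfl)
    (by rw [tmul_gen_mul, tmul_gen_mul, rel_det, TensorProduct.add_tmul]; rfl)
    (by rw [tmul_gen_mul, tmul_gen_mul, rel_da, TensorProduct.add_tmul]; rfl)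

@[simp] theorem coact_gen (q : ℂˣ) (x : Gen) :
    coact q (gen q x) = gen q x ⊗ₜ[ℂ] LaurentPolynomial.T (deg x) := by
  simp [coact]

/-- The automorphism `f ↦ q^|f| f`. -/
def scale (q : ℂˣ) : OqSL2 q →ₐ[ℂ] OqSL2 q :=
  lift (q := q) (fun x => ((q ^ deg x : ℂˣ) : ℂ) • gen q x)
    (by simp [deg, rel_ba, smul_smul])
    (by simp [deg, rel_ca, smul_smul])
    (by simp [deg, rel_db, smul_smul])
    (by simp [deg, rel_dc, smul_smul])
    (by simp [deg, rel_cb, smul_smul])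
    (by simp [deg, rel_det, smul_smul])
    (by simp [deg, rel_da, smul_smul])

@[simp] theorem scale_gen (q : ℂˣ) (x : Gen) :
    scale q (gen q x) = ((q ^ deg x : ℂˣ) : ℂ) • gen q x := by
  simp [scale]

/-- The subalgebra `{b | Δ b = b ⊗ 1}` of coinvariants: the Podleś sphere. -/
def podles (q : ℂˣ) : Subalgebra ℂ (OqSL2 q) :=
  AlgHom.equalizer (coact q) Algebra.TensorProduct.includeLeft

end OqSL2

/-! ## The 3D calculus on `O_q(SL₂)` -/

open OqSL2

set_option linter.unusedSimpArgs false
set_option linter.unreachableTactic false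
set_option linter.unusedTactic false
set_option linter.unnecessarySeqFocus false

/-- The generators `e⁺, e⁻, e⁰` (numbered `0, 1, 2`), with `e^± f = q^|f| f e^±`,
`e⁰ f = q^(2|f|) f e⁰`, `e⁻ ∧ e⁺ = -q² e⁺ ∧ e⁻` and `e⁰ ∧ e^± = -q^(±4) e^± ∧ e⁰`. -/
def dataA (q : ℂˣ) : SkewData (OqSL2 q) 3 where
  θ := scale q
  w := ![1, 1, 2]
  c := ![![0, 0, 0], ![-(q : ℂ) ^ 2, 0, 0], ![-(q : ℂ) ^ 4, -((q : ℂ) ^ 4)⁻¹, 0]]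

/-- The forms `A ⊕ Ω¹(A) ⊕ Ω²(A) ⊕ Ω³(A)` on `A = O_q(SL₂(ℂ))`. -/
abbrev FormsA (q : ℂˣ) : Type := SkewExt (dataA q)

abbrev gradeA (q : ℂˣ) : ℕ → Submodule ℂ (FormsA q) := SkewExt.grade (dataA q)

abbrev inclA (q : ℂˣ) : OqSL2 q →ₐ[ℂ] FormsA q := SkewExt.incl (dataA q)

def ePlus (q : ℂˣ) : FormsA q := SkewExt.mon (dataA q) {0} 1
def eMinus (q : ℂˣ) : FormsA q := SkewExt.mon (dataA q) {1} 1
def eZero (q : ℂˣ) : FormsA q := SkewExt.mon (dataA q) {2} 1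

/-- The differentials of the generators. -/
def dGen (q : ℂˣ) : Gen → FormsA q
  | .α => inclA q (gen q .α) * eZero q + (q : ℂ) • (inclA q (gen q .β) * ePlus q)
  | .β => inclA q (gen q .α) * eMinus q - ((q : ℂ) ^ 2)⁻¹ • (inclA q (gen q .β) * eZero q)
  | .γ => inclA q (gen q .γ) * eZero q + (q : ℂ) • (inclA q (gen q .δ) * ePlus q)
  | .δ => inclA q (gen q .γ) * eMinus q - ((q : ℂ) ^ 2)⁻¹ • (inclA q (gen q .δ) * eZero q)

section
variable (q : ℂˣ)
theorem mon_zero_mul (r : OqSL2 q) (x : Gen) : SkewExt.mon (dataA q) {0} r * inclA q (gen q x) =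
    ((q ^ deg x : ℂˣ) : ℂ) • SkewExt.mon (dataA q) {0} (r * gen q x) := by
  rw [SkewExt.mon_mul_incl, ← map_smul, ← mul_smul_comm]
  simp [SkewData.tw, dataA]
theorem mon_one_mul (r : OqSL2 q) (x : Gen) : SkewExt.mon (dataA q) {1} r * inclA q (gen q x) =
    ((q ^ deg x : ℂˣ) : ℂ) • SkewExt.mon (dataA q) {1} (r * gen q x) := by
  rw [SkewExt.mon_mul_incl, ← map_smul, ← mul_smul_comm]
  simp [SkewData.tw, dataA]
theorem mon_two_mul (r : OqSL2 q) (x : Gen) : SkewExt.mon (dataA q) {2} r * inclA q (gen q x) =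
    ((q ^ deg x : ℂˣ) : ℂ) ^ 2 • SkewExt.mon (dataA q) {2} (r * gen q x) := by
  rw [SkewExt.mon_mul_incl, ← map_smul, ← mul_smul_comm]
  simp [SkewData.tw, dataA, pow_two, smul_smul]
theorem dGen_α : dGen q .α = SkewExt.mon (dataA q) {2} (gen q .α) +
    (q : ℂ) • SkewExt.mon (dataA q) {0} (gen q .β) := by
  simp [dGen, ePlus, eZero, SkewExt.incl_mul_mon]
theorem dGen_β : dGen q .β = SkewExt.mon (dataA q) {1} (gen q .α) -
    ((q : ℂ) ^ 2)⁻¹ • SkewExt.mon (dataA q) {2} (gen q .β) := by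
  simp [dGen, eMinus, eZero, SkewExt.incl_mul_mon]
theorem dGen_γ : dGen q .γ = SkewExt.mon (dataA q) {2} (gen q .γ) +
    (q : ℂ) • SkewExt.mon (dataA q) {0} (gen q .δ) := by
  simp [dGen, ePlus, eZero, SkewExt.incl_mul_mon]
theorem dGen_δ : dGen q .δ = SkewExt.mon (dataA q) {1} (gen q .γ) -
    ((q : ℂ) ^ 2)⁻¹ • SkewExt.mon (dataA q) {2} (gen q .δ) := by
  simp [dGen, eMinus, eZero, SkewExt.incl_mul_mon]

/-- The pair `x + ε dx` in the dual numbers. -/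
def jet (x : Gen) : DualNumber (FormsA q) :=
  TrivSqZeroExt.inl (inclA q (gen q x)) + TrivSqZeroExt.inr (dGen q x)

theorem jet_mul (x y : Gen) : jet q x * jet q y =
    TrivSqZeroExt.inl (inclA q (gen q x * gen q y)) +
    TrivSqZeroExt.inr (inclA q (gen q x) * dGen q y + dGen q x * inclA q (gen q y)) := by
  ext <;> simp [jet]

theorem rel_aux (x y z w : Gen) (c k : ℂ)
    (h : gen q x * gen q y = algebraMap ℂ _ k + c • (gen q z * gen q w))
    (h' : inclA q (gen q x) * dGen q y + dGen q x * inclA q (gen q y) =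
      c • (inclA q (gen q z) * dGen q w + dGen q z * inclA q (gen q w))) :
    jet q x * jet q y = algebraMap ℂ _ k + c • (jet q z * jet q w) := by
  rw [jet_mul, jet_mul, h, h']
  ext <;> simp [TrivSqZeroExt.algebraMap_eq_inl', -AlgHom.map_algebraMap]

theorem jet_rel_ba : inclA q (gen q .β) * dGen q .α + dGen q .β * inclA q (gen q .α) =
    (q : ℂ) • (inclA q (gen q .α) * dGen q .β + dGen q .α * inclA q (gen q .β)) := by
  simp only [dGen_α, dGen_β, dGen_γ, dGen_δ, mul_add, add_mul, mul_sub, sub_mul, smul_add, smul_sub,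
    mul_smul_comm, smul_mul_assoc, SkewExt.incl_mul_mon, mon_zero_mul, mon_one_mul, mon_two_mul,
    rel_ba, rel_ca, rel_db, rel_dc, rel_cb, rel_det, rel_da, map_smul, map_add, deg]
  have := q.ne_zero
  push_cast
  match_scalars <;> simp <;> field_simp <;> ring

theorem jet_rel_ca : inclA q (gen q .γ) * dGen q .α + dGen q .γ * inclA q (gen q .α) =
    (q : ℂ) • (inclA q (gen q .α) * dGen q .γ + dGen q .α * inclA q (gen q .γ)) := by
  simp only [dGen_α, dGen_β, dGen_γ, dGen_δ, mul_add, add_mul, mul_sub, sub_mul, smul_add, smul_sub,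
    mul_smul_comm, smul_mul_assoc, SkewExt.incl_mul_mon, mon_zero_mul, mon_one_mul, mon_two_mul,
    rel_ba, rel_ca, rel_db, rel_dc, rel_cb, rel_det, rel_da, map_smul, map_add, deg]
  have := q.ne_zero
  push_cast
  match_scalars <;> simp <;> field_simp <;> ring

theorem jet_rel_db : inclA q (gen q .δ) * dGen q .β + dGen q .δ * inclA q (gen q .β) =
    (q : ℂ) • (inclA q (gen q .β) * dGen q .δ + dGen q .β * inclA q (gen q .δ)) := by
  simp only [dGen_α, dGen_β, dGen_γ, dGen_δ, mul_add, add_mul, mul_sub, sub_mul, smul_add, smul_sub,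
    mul_smul_comm, smul_mul_assoc, SkewExt.incl_mul_mon, mon_zero_mul, mon_one_mul, mon_two_mul,
    rel_ba, rel_ca, rel_db, rel_dc, rel_cb, rel_det, rel_da, map_smul, map_add, deg]
  have := q.ne_zero
  push_cast
  match_scalars <;> simp <;> field_simp <;> ring

theorem jet_rel_dc : inclA q (gen q .δ) * dGen q .γ + dGen q .δ * inclA q (gen q .γ) =
    (q : ℂ) • (inclA q (gen q .γ) * dGen q .δ + dGen q .γ * inclA q (gen q .δ)) := by
  simp only [dGen_α, dGen_β, dGen_γ, dGen_δ, mul_add, add_mul, mul_sub, sub_mul, smul_add, smul_sub,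
    mul_smul_comm, smul_mul_assoc, SkewExt.incl_mul_mon, mon_zero_mul, mon_one_mul, mon_two_mul,
    rel_ba, rel_ca, rel_db, rel_dc, rel_cb, rel_det, rel_da, map_smul, map_add, deg]
  have := q.ne_zero
  push_cast
  match_scalars <;> simp <;> field_simp <;> ring

theorem jet_rel_cb : inclA q (gen q .γ) * dGen q .β + dGen q .γ * inclA q (gen q .β) =
    (1 : ℂ) • (inclA q (gen q .β) * dGen q .γ + dGen q .β * inclA q (gen q .γ)) := by
  simp only [dGen_α, dGen_β, dGen_γ, dGen_δ, mul_add, add_mul, mul_sub, sub_mul, smul_add, smul_sub,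
    mul_smul_comm, smul_mul_assoc, SkewExt.incl_mul_mon, mon_zero_mul, mon_one_mul, mon_two_mul,
    rel_ba, rel_ca, rel_db, rel_dc, rel_cb, rel_det, rel_da, map_smul, map_add, deg]
  have := q.ne_zero
  push_cast
  match_scalars <;> simp <;> field_simp <;> ring

theorem jet_rel_det : inclA q (gen q .α) * dGen q .δ + dGen q .α * inclA q (gen q .δ) =
    ((q : ℂ)⁻¹ : ℂ) • (inclA q (gen q .β) * dGen q .γ + dGen q .β * inclA q (gen q .γ)) := by
  simp only [dGen_α, dGen_β, dGen_γ, dGen_δ, mul_add, add_mul, mul_sub, sub_mul, smul_add, smul_sub,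
    mul_smul_comm, smul_mul_assoc, SkewExt.incl_mul_mon, mon_zero_mul, mon_one_mul, mon_two_mul,
    rel_ba, rel_ca, rel_db, rel_dc, rel_cb, rel_det, rel_da, map_smul, map_add, deg]
  have := q.ne_zero
  push_cast
  match_scalars <;> simp <;> field_simp <;> ring

theorem jet_rel_da : inclA q (gen q .δ) * dGen q .α + dGen q .δ * inclA q (gen q .α) =
    (q : ℂ) • (inclA q (gen q .β) * dGen q .γ + dGen q .β * inclA q (gen q .γ)) := by
  simp only [dGen_α, dGen_β, dGen_γ, dGen_δ, mul_add, add_mul, mul_sub, sub_mul, smul_add, smul_sub,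
    mul_smul_comm, smul_mul_assoc, SkewExt.incl_mul_mon, mon_zero_mul, mon_one_mul, mon_two_mul,
    rel_ba, rel_ca, rel_db, rel_dc, rel_cb, rel_det, rel_da, map_smul, map_add, deg]
  have := q.ne_zero
  push_cast
  match_scalars <;> simp <;> field_simp <;> ring

/-- The algebra morphism `a ↦ a + ε da`; that it is multiplicative is the Leibniz rule for `d`. -/
def jetHom : OqSL2 q →ₐ[ℂ] DualNumber (FormsA q) :=
  lift (q := q) (jet q)
    (by simpa using rel_aux q .β .α .α .β q 0 (by simp [rel_ba]) (jet_rel_ba q))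
    (by simpa using rel_aux q .γ .α .α .γ q 0 (by simp [rel_ca]) (jet_rel_ca q))
    (by simpa using rel_aux q .δ .β .β .δ q 0 (by simp [rel_db]) (jet_rel_db q))
    (by simpa using rel_aux q .δ .γ .γ .δ q 0 (by simp [rel_dc]) (jet_rel_dc q))
    (by simpa using rel_aux q .γ .β .β .γ 1 0 (by simp [rel_cb]) (jet_rel_cb q))
    (by simpa using rel_aux q .α .δ .β .γ (q : ℂ)⁻¹ 1 (by simp [rel_det]) (jet_rel_det q))
    (by simpa using rel_aux q .δ .α .β .γ q 1 (by simp [rel_da]) (jet_rel_da q))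

end

/-- The differential on `A`: the derivation with the values `dGen` on the generators. -/
def dFun (q : ℂˣ) : OqSL2 q →ₗ[ℂ] FormsA q :=
  (TrivSqZeroExt.sndHom (FormsA q) (FormsA q)).restrictScalars ℂ ∘ₗ (jetHom q).toLinearMap

/-- The differentials of the monomials in `e⁺, e⁻, e⁰`: `de^± = ∓q^(±2) (1 + q⁻²) e^± ∧ e⁰` and
`de⁰ = q³ e⁺ ∧ e⁻`; the Leibniz rule forces the value zero on `1` and in degrees two and three. -/
def dE (q : ℂˣ) (S : Finset (Fin 3)) : FormsA q :=
  if S = {0} then (-((q : ℂ) ^ 2 * (1 + ((q : ℂ) ^ 2)⁻¹))) • (ePlus q * eZero q)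
  else if S = {1} then (((q : ℂ) ^ 2)⁻¹ * (1 + ((q : ℂ) ^ 2)⁻¹)) • (eMinus q * eZero q)
  else if S = {2} then (q : ℂ) ^ 3 • (ePlus q * eMinus q)
  else 0

/-- The differential of the calculus, `d(r e_S) = dr ∧ e_S + r d(e_S)`. -/
def dA (q : ℂˣ) : FormsA q →ₗ[ℂ] FormsA q :=
  ∑ S : Finset (Fin 3),
    (LinearMap.mulRight ℂ (SkewExt.mon (dataA q) S 1) ∘ₗ dFun q +
      LinearMap.mulRight ℂ (dE q S) ∘ₗ (inclA q).toLinearMap) ∘ₗ SkewExt.coeff (dataA q) S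

theorem dFun_gen (q : ℂˣ) (x : Gen) : dFun q (gen q x) = dGen q x := by
  simp [dFun, jetHom, jet]

theorem dA_inclA (q : ℂˣ) (a : OqSL2 q) : dA q (inclA q a) = dFun q a := by
  have h : ∀ S, SkewExt.coeff (dataA q) S (inclA q a) = if S = ∅ then a else 0 :=
    fun S => SkewExt.coeff_mon ∅ S a
  have e : SkewExt.mon (dataA q) ∅ 1 = 1 := rfl
  simp only [dA, LinearMap.sum_apply, LinearMap.comp_apply, h]
  rw [Finset.sum_eq_single ∅ (by intro S _ hS; simp [hS]) (by simp)]
  simp [e, dE]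

theorem dA_gen (q : ℂˣ) (x : Gen) : dA q (inclA q (gen q x)) = dGen q x := by
  rw [dA_inclA, dFun_gen]

/-- `e⁺ = q⁻¹ α dγ - q⁻² γ dα`. -/
theorem ePlus_eq (q : ℂˣ) : ePlus q =
    (q : ℂ)⁻¹ • (inclA q (gen q .α) * dA q (inclA q (gen q .γ))) -
      ((q : ℂ) ^ 2)⁻¹ • (inclA q (gen q .γ) * dA q (inclA q (gen q .α))) := by
  have := q.ne_zero
  simp only [dA_gen, dGen_α, dGen_γ, mul_add, mul_smul_comm, SkewExt.incl_mul_mon, rel_ca, rel_det,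
    rel_cb, map_add, map_smul, ePlus]
  match_scalars <;> field_simp <;> ring

/-- `e⁻ = δ dβ - q β dδ`. -/
theorem eMinus_eq (q : ℂˣ) : eMinus q =
    inclA q (gen q .δ) * dA q (inclA q (gen q .β)) -
      (q : ℂ) • (inclA q (gen q .β) * dA q (inclA q (gen q .δ))) := by
  have := q.ne_zero
  simp only [dA_gen, dGen_β, dGen_δ, mul_sub, mul_smul_comm, SkewExt.incl_mul_mon, rel_db, rel_da,
    map_add, map_smul, eMinus]
  match_scalars <;> field_simp <;> ring

/-- `e⁰ = δ dα - q β dγ`. -/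
theorem eZero_eq (q : ℂˣ) : eZero q =
    inclA q (gen q .δ) * dA q (inclA q (gen q .α)) -
      (q : ℂ) • (inclA q (gen q .β) * dA q (inclA q (gen q .γ))) := by
  have := q.ne_zero
  simp only [dA_gen, dGen_α, dGen_γ, mul_add, mul_smul_comm, SkewExt.incl_mul_mon, rel_db, rel_da,
    map_add, map_smul, eZero]
  match_scalars <;> field_simp <;> ring

theorem ePlus_mul_gen (q : ℂˣ) (x : Gen) : ePlus q * inclA q (gen q x) =
    ((q ^ deg x : ℂˣ) : ℂ) • (inclA q (gen q x) * ePlus q) := by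
  simp [ePlus, mon_zero_mul, SkewExt.incl_mul_mon]

theorem eMinus_mul_gen (q : ℂˣ) (x : Gen) : eMinus q * inclA q (gen q x) =
    ((q ^ deg x : ℂˣ) : ℂ) • (inclA q (gen q x) * eMinus q) := by
  simp [eMinus, mon_one_mul, SkewExt.incl_mul_mon]

theorem eZero_mul_gen (q : ℂˣ) (x : Gen) : eZero q * inclA q (gen q x) =
    ((q ^ (2 * deg x) : ℂˣ) : ℂ) • (inclA q (gen q x) * eZero q) := by
  simp [eZero, mon_two_mul, SkewExt.incl_mul_mon, mul_comm 2 (deg x), zpow_mul]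

theorem wedge_mm (q : ℂˣ) : eMinus q * ePlus q = (-(q : ℂ) ^ 2) • (ePlus q * eMinus q) := by
  simp only [eMinus, ePlus, SkewExt.mon_mul_mon]
  simp [SkewData.sg, dataA, Finset.union_comm]
  exact congrArg _ (one_smul ℂ _).symm

theorem wedge_zp (q : ℂˣ) : eZero q * ePlus q = (-(q : ℂ) ^ 4) • (ePlus q * eZero q) := by
  simp only [eZero, ePlus, SkewExt.mon_mul_mon]
  simp [SkewData.sg, dataA, Finset.union_comm]
  exact congrArg _ (one_smul ℂ _).symm

theorem wedge_zm (q : ℂˣ) : eZero q * eMinus q = (-((q : ℂ) ^ 4)⁻¹) • (eMinus q * eZero q) := by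
  simp only [eZero, eMinus, SkewExt.mon_mul_mon]
  simp [SkewData.sg, dataA, Finset.union_comm]
  exact congrArg _ (one_smul ℂ _).symm

theorem wedge_self (q : ℂˣ) :
    ePlus q * ePlus q = 0 ∧ eMinus q * eMinus q = 0 ∧ eZero q * eZero q = 0 := by
  simp [ePlus, eMinus, eZero, SkewExt.mon_mul_mon]

/-! ## The calculus on `O(U(1))` and its left coinvariant forms -/

/-- The automorphism `t ↦ q² t` of `ℂ[t, t⁻¹]`. -/
def scaleH (q : ℂˣ) : ℂ[T;T⁻¹] →ₐ[ℂ] ℂ[T;T⁻¹] :=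
  AddMonoidAlgebra.lift ℂ ℂ[T;T⁻¹] ℤ
    { toFun := fun n => (((q ^ 2) ^ n.toAdd : ℂˣ) : ℂ) • LaurentPolynomial.T n.toAdd
      map_one' := by simp
      map_mul' := fun m n => by
        rw [toAdd_mul, LaurentPolynomial.T_add, zpow_add, Units.val_mul, smul_mul_smul_comm] }

theorem scaleH_T (q : ℂˣ) (n : ℤ) :
    scaleH q (LaurentPolynomial.T n) = (((q ^ 2) ^ n : ℂˣ) : ℂ) • LaurentPolynomial.T n := by
  refine (AddMonoidAlgebra.lift_single _ _ _).trans ?_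
  exact one_smul _ _

/-- The single generator `dt`, with `dt f(t) = f(q² t) dt`. -/
def dataH (q : ℂˣ) : SkewData ℂ[T;T⁻¹] 1 where
  θ := scaleH q
  w := ![1]
  c := 0

/-- The forms `H ⊕ Ω¹(H)` on `H = ℂ[t, t⁻¹]`. -/
abbrev FormsH (q : ℂˣ) : Type := SkewExt (dataH q)

abbrev gradeH (q : ℂˣ) : ℕ → Submodule ℂ (FormsH q) := SkewExt.grade (dataH q)

abbrev inclH (q : ℂˣ) : ℂ[T;T⁻¹] →ₐ[ℂ] FormsH q := SkewExt.incl (dataH q)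

/-- The one-form `dt`. -/
def dt (q : ℂˣ) : FormsH q := SkewExt.mon (dataH q) {0} 1

/-- The `q²`-derivative `f ↦ (f(q² t) - f(t)) / ((q² - 1) t)`. -/
def qDeriv (q : ℂˣ) : ℂ[T;T⁻¹] →ₗ[ℂ] ℂ[T;T⁻¹] :=
  ((q : ℂ) ^ 2 - 1)⁻¹ •
    (LinearMap.mulLeft ℂ (LaurentPolynomial.T (-1)) ∘ₗ ((scaleH q).toLinearMap - LinearMap.id))

/-- The differential on `H`: `df` is the `q²`-derivative of `f` times `dt`; it vanishes on
one-forms. -/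
def dH (q : ℂˣ) : FormsH q →ₗ[ℂ] FormsH q :=
  SkewExt.mon (dataH q) {0} ∘ₗ qDeriv q ∘ₗ SkewExt.coeff (dataH q) ∅

theorem qDeriv_T (q : ℂˣ) (n : ℤ) : qDeriv q (LaurentPolynomial.T n) =
    ((((q : ℂ) ^ 2) ^ n - 1) / ((q : ℂ) ^ 2 - 1)) • LaurentPolynomial.T (n - 1) := by
  have h : (LaurentPolynomial.T (-1) * LaurentPolynomial.T n : ℂ[T;T⁻¹]) =
      LaurentPolynomial.T (n - 1) := by rw [← LaurentPolynomial.T_add]; congr 1; ring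
  simp only [qDeriv, LinearMap.smul_apply, LinearMap.comp_apply, LinearMap.sub_apply,
    AlgHom.toLinearMap_apply, scaleH_T, LinearMap.id_apply, LinearMap.mulLeft_apply, mul_sub,
    mul_smul_comm, h]
  push_cast
  module

theorem dH_inclH (q : ℂˣ) (f : ℂ[T;T⁻¹]) :
    dH q (inclH q f) = SkewExt.mon (dataH q) {0} (qDeriv q f) := by
  have : SkewExt.coeff (dataH q) ∅ (inclH q f) = f := by
    refine (SkewExt.coeff_mon ∅ ∅ f).trans (if_pos rfl)
  simp [dH, this]

theorem dH_T_one (q : ℂˣ) (hq : (q : ℂ) ^ 2 ≠ 1) :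
    dH q (inclH q (LaurentPolynomial.T 1)) = dt q := by
  rw [dH_inclH, qDeriv_T, zpow_one, div_self (sub_ne_zero.2 hq), one_smul, sub_self,
    LaurentPolynomial.T_zero, dt]

theorem dt_mul_t (q : ℂˣ) : dt q * inclH q (LaurentPolynomial.T 1) =
    (q : ℂ) ^ 2 • (inclH q (LaurentPolynomial.T 1) * dt q) := by
  rw [dt, SkewExt.mon_mul_incl, SkewExt.incl_mul_mon]
  have : (dataH q).tw {0} (LaurentPolynomial.T 1) = (q : ℂ) ^ 2 • LaurentPolynomial.T 1 := by
    simp [SkewData.tw, dataH, scaleH_T]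
  rw [this, one_mul, mul_one, map_smul]

/-- The left coaction `h dg ↦ h₁ g₁ ⊗ h₂ dg₂` of `H` on its forms; in particular
`f ↦ f₁ ⊗ f₂` and `f dt ↦ f₁ t ⊗ f₂ dt`. -/
def leftCoact (q : ℂˣ) : FormsH q →ₗ[ℂ] ℂ[T;T⁻¹] ⊗[ℂ] FormsH q :=
  TensorProduct.map LinearMap.id (SkewExt.mon (dataH q) ∅) ∘ₗ Coalgebra.comul ∘ₗ
      SkewExt.coeff (dataH q) ∅ +
    TensorProduct.map (LinearMap.mulRight ℂ (LaurentPolynomial.T 1)) (SkewExt.mon (dataH q) {0}) ∘ₗ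
      Coalgebra.comul ∘ₗ SkewExt.coeff (dataH q) {0}

theorem leftCoact_mon_empty (q : ℂˣ) (n : ℤ) :
    leftCoact q (SkewExt.mon (dataH q) ∅ (LaurentPolynomial.T n)) =
      LaurentPolynomial.T n ⊗ₜ SkewExt.mon (dataH q) ∅ (LaurentPolynomial.T n) := by
  simp [leftCoact, SkewExt.coeff_mon]

theorem leftCoact_mon_zero (q : ℂˣ) (n : ℤ) :
    leftCoact q (SkewExt.mon (dataH q) {0} (LaurentPolynomial.T n)) =
      LaurentPolynomial.T (n + 1) ⊗ₜ SkewExt.mon (dataH q) {0} (LaurentPolynomial.T n) := by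
  have h : (LaurentPolynomial.T n * LaurentPolynomial.T 1 : ℂ[T;T⁻¹]) =
      LaurentPolynomial.T (n + 1) := by rw [LaurentPolynomial.T_add]
  have h' : (∅ : Finset (Fin 1)) ≠ {0} := by decide
  simp only [leftCoact, LinearMap.add_apply, LinearMap.comp_apply, SkewExt.coeff_mon, if_neg h',
    if_true, map_zero, zero_add, LaurentPolynomial.comul_T, TensorProduct.map_tmul,
    LinearMap.mulRight_apply, h]

theorem leftCoact_dH (q : ℂˣ) (m n : ℤ) :
    leftCoact q (inclH q (LaurentPolynomial.T m) * dH q (inclH q (LaurentPolynomial.T n))) =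
      (LaurentPolynomial.T m * LaurentPolynomial.T n) ⊗ₜ
        (inclH q (LaurentPolynomial.T m) * dH q (inclH q (LaurentPolynomial.T n))) := by
  rw [dH_inclH, qDeriv_T, map_smul, mul_smul_comm, SkewExt.incl_mul_mon, map_smul,
    ← LaurentPolynomial.T_add, ← LaurentPolynomial.T_add, leftCoact_mon_zero,
    TensorProduct.tmul_smul]
  congr 3
  ring

/-- The left coinvariant forms `Λ = {θ | leftCoact θ = 1 ⊗ θ}`. -/
def leftCoinv (q : ℂˣ) : Submodule ℂ (FormsH q) :=
  LinearMap.eqLocus (leftCoact q) (TensorProduct.mk ℂ ℂ[T;T⁻¹] (FormsH q) 1)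

/-- The left coinvariant forms `Λᵏ` of degree `k`. -/
def lam (q : ℂˣ) (k : ℕ) : Submodule ℂ (FormsH q) := leftCoinv q ⊓ gradeH q k

/-- The form `t⁻¹ dt`. -/
def tinvdt (q : ℂˣ) : FormsH q := inclH q (LaurentPolynomial.T (-1)) * dt q

theorem tinvdt_eq (q : ℂˣ) :
    tinvdt q = SkewExt.mon (dataH q) {0} (LaurentPolynomial.T (-1)) := by
  rw [tinvdt, dt, SkewExt.incl_mul_mon, mul_one]

theorem tinvdt_mem (q : ℂˣ) : tinvdt q ∈ lam q 1 := by
  rw [tinvdt_eq]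
  refine ⟨?_, fun S hS => ?_⟩
  · refine (leftCoact_mon_zero q (-1)).trans ?_
    simp
  · rw [SkewExt.coeff_mon, if_neg]
    rintro rfl
    exact hS rfl

theorem one_mem (q : ℂˣ) : (1 : FormsH q) ∈ lam q 0 := by
  refine ⟨?_, fun S hS => ?_⟩
  · have := leftCoact_mon_empty q 0
    rw [LaurentPolynomial.T_zero] at this
    exact this
  · refine (SkewExt.coeff_mon ∅ S (1 : ℂ[T;T⁻¹])).trans (if_neg ?_)
    rintro rfl
    exact hS rfl

/-- The map `h ↦ S(h₁) dh₂` with values in all forms. -/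
def maurerCartanAux (q : ℂˣ) : ℂ[T;T⁻¹] →ₗ[ℂ] FormsH q :=
  LinearMap.mul' ℂ (FormsH q) ∘ₗ
    TensorProduct.map ((inclH q).toLinearMap ∘ₗ HopfAlgebra.antipode ℂ)
      (dH q ∘ₗ (inclH q).toLinearMap) ∘ₗ Coalgebra.comul

theorem maurerCartanAux_T (q : ℂˣ) (n : ℤ) :
    maurerCartanAux q (LaurentPolynomial.T n) =
      ((((q : ℂ) ^ 2) ^ n - 1) / ((q : ℂ) ^ 2 - 1)) • tinvdt q := by
  have h : (LaurentPolynomial.T (-n) * LaurentPolynomial.T (n - 1) : ℂ[T;T⁻¹]) =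
      LaurentPolynomial.T (-1) := by rw [← LaurentPolynomial.T_add]; congr 1; ring
  simp only [maurerCartanAux, LinearMap.comp_apply, LaurentPolynomial.comul_T,
    TensorProduct.map_tmul, LaurentPolynomial.antipode_T, AlgHom.toLinearMap_apply, dH_inclH,
    qDeriv_T, LinearMap.mul'_apply, SkewExt.incl_mul_mon, mul_smul_comm, h, map_smul, tinvdt_eq]

/-- The quantum Maurer–Cartan map `ϖ : H → Λ¹`, `h ↦ S(h₁) dh₂`. -/
def maurerCartan (q : ℂˣ) : ℂ[T;T⁻¹] →ₗ[ℂ] lam q 1 :=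
  LinearMap.codRestrict (lam q 1) (maurerCartanAux q) (fun f => by
    induction f using LaurentPolynomial.induction_on' with
    | add f g hf hg => rw [map_add]; exact add_mem hf hg
    | C_mul_T n a =>
      rw [← LaurentPolynomial.smul_eq_C_mul, map_smul, maurerCartanAux_T]
      exact Submodule.smul_mem _ _ (Submodule.smul_mem _ _ (tinvdt_mem q)))

/-- The right adjoint coaction `h ↦ h₂ ⊗ S(h₁) h₃`. -/
def adj : ℂ[T;T⁻¹] →ₗ[ℂ] ℂ[T;T⁻¹] ⊗[ℂ] ℂ[T;T⁻¹] :=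
  TensorProduct.map LinearMap.id (LinearMap.mul' ℂ ℂ[T;T⁻¹]) ∘ₗ
    (TensorProduct.assoc ℂ ℂ[T;T⁻¹] ℂ[T;T⁻¹] ℂ[T;T⁻¹]).toLinearMap ∘ₗ
    TensorProduct.map ((TensorProduct.comm ℂ ℂ[T;T⁻¹] ℂ[T;T⁻¹]).toLinearMap ∘ₗ
      TensorProduct.map (HopfAlgebra.antipode ℂ) LinearMap.id) LinearMap.id ∘ₗ
    TensorProduct.map Coalgebra.comul LinearMap.id ∘ₗ Coalgebra.comul

/-- The projection `ω ↦ S(ω₋₁) ω₀` onto the left coinvariant forms. -/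
def piLam (q : ℂˣ) : FormsH q →ₗ[ℂ] FormsH q :=
  LinearMap.mul' ℂ (FormsH q) ∘ₗ
    TensorProduct.map ((inclH q).toLinearMap ∘ₗ HopfAlgebra.antipode ℂ) LinearMap.id ∘ₗ leftCoact q

/-! ## Vertical forms and connection one-forms -/

/-- The vertical forms `ver = A ⊗ Λ`. -/
abbrev Ver (q : ℂˣ) : Type := OqSL2 q ⊗[ℂ] leftCoinv q

/-- The right `H`-coaction on forms: the component of `Δ` with values in `Ω(A) ⊗ H`. -/
def rightCoact {q : ℂˣ} (Δ : FormsA q →ₐ[ℂ] gradeA q ᵍ⊗[ℂ] gradeH q) :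
    FormsA q →ₗ[ℂ] FormsA q ⊗[ℂ] ℂ[T;T⁻¹] :=
  TensorProduct.map LinearMap.id (SkewExt.coeff (dataH q) ∅) ∘ₗ
    (GradedTensorProduct.of ℂ (gradeA q) (gradeH q)).symm.toLinearMap ∘ₗ Δ.toLinearMap

/-- The vertical projection `π_v`: the component of `Δ` with values in `A ⊗ Ω(H)`, followed by the
projection onto `A ⊗ Λ ⊆ A ⊗ Ω(H)`. -/
def verProj {q : ℂˣ} (Δ : FormsA q →ₐ[ℂ] gradeA q ᵍ⊗[ℂ] gradeH q) :
    FormsA q →ₗ[ℂ] OqSL2 q ⊗[ℂ] FormsH q :=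
  TensorProduct.map (SkewExt.coeff (dataA q) ∅) (piLam q) ∘ₗ
    (GradedTensorProduct.of ℂ (gradeA q) (gradeH q)).symm.toLinearMap ∘ₗ Δ.toLinearMap

/-- `s : Λ¹ → Ω¹(A)` is a connection one-form: it is a morphism of right `H`-comodules, where `Λ¹`
carries the adjoint coaction `ϖ(h) ↦ ϖ(h₂) ⊗ S(h₁) h₃`, and `π_v (s θ) = 1 ⊗ θ`. -/
structure IsConnectionOneForm {q : ℂˣ} (Δ : FormsA q →ₐ[ℂ] gradeA q ᵍ⊗[ℂ] gradeH q)
    (s : lam q 1 →ₗ[ℂ] FormsA q) : Prop where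
  degree : ∀ θ, s θ ∈ gradeA q 1
  colinear : ∀ h, rightCoact Δ (s (maurerCartan q h)) =
    TensorProduct.map (s ∘ₗ maurerCartan q) LinearMap.id (adj h)
  splits : ∀ θ : lam q 1, verProj Δ (s θ) = 1 ⊗ₜ (θ : FormsH q)

end QHopf
end

/-!
Both calculi are skew exterior algebras, so everything is checked on coefficients and generators.
`SkewExt.lift` is their universal property, and `SkewExt.isDifferentialCalculus` reduces the
calculus axioms to the Leibniz rule, `d² = 0`, and the fact that each `eᵢ` is of the form `∑ a db`.
On `A` the Leibniz rule amounts to the compatibility of `d` with `eᵢ a = θᵢ(a) eᵢ` (`dFun_tw`). Both sides of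
that identity are twisted derivations in `a`, so it suffices to compare them on `α, β, γ, δ`; the
same argument gives `d² = 0`.

The coaction extends by `e⁺ ↦ e⁺ ⊗ t²`, `e⁻ ↦ e⁻ ⊗ t⁻²`, `e⁰ ↦ e⁰ ⊗ 1 + 1 ⊗ t⁻¹ dt`
(`coactForms`). A morphism of algebras on a calculus that commutes with `d` on `A` does so in all
degrees (`comm_d_of_degree_zero`), because forms `a⁰ da¹ ⋯ daᵏ` span. Any extension agrees with this
one on `A` and on `dA`, hence on the forms `e⁺, e⁻, e⁰`, hence everywhere, so the remaining claims
concern only `coactForms`.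

In coordinates (`coactForms_mon_eq`), `r e_S` goes to a term of weight `|r| + |e_S|` in `Ω(A) ⊗ H`
plus, if `e⁰` occurs in `e_S`, a term in which it is replaced by `t⁻¹ dt`. The counit recovers `r`
from the latter, so horizontal forms are those without `e⁰`, and base forms are
`B ⊕ A₋₂ e⁺ ⊕ A₂ e⁻ ⊕ B e⁺e⁻`, where `Aₙ` is the space of elements of weight `n`
(`mem_horForms`, `coeff_mem_weightSpace`). Since `1 = αδ - q⁻¹γβ = δα - qβγ`, the unit is a sum of
products from `A₂ A₋₂` and from `A₋₂ A₂`, and this yields `hor = A Ω(B) A`. It also reduces the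
generation of the base forms by `B` to forms `u w e⁺` and `u z e⁻` with generators `w`, `z`. These
are combinations of `b db'` by `incl_mul_ePlus` and `incl_mul_eMinus`, in which the unwanted
component cancels by a commutation relation. In degree two, `e⁺e⁻` is then a sum of products of such
one-forms.
-/

noncomputable section

namespace QHopf

open scoped TensorProduct LaurentPolynomial
open OqSL2

/-! ### Skew exterior algebras -/

namespace SkewExt
variable {R : Type} [Ring R] [Algebra ℂ R] {n : ℕ} (D : SkewData R n)

/-- The generator `eᵢ`. -/
def basisOne (i : Fin n) : SkewExt D := mon D {i} 1

theorem sum_mon_coeff (x : SkewExt D) : ∑ S, mon D S (coeff D S x) = x := by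
  ext S
  rw [map_sum, Finset.sum_eq_single S]
  · rw [coeff_mon, if_pos rfl]
  · intro T _ hT; rw [coeff_mon, if_neg (Ne.symm hT)]
  · simp

theorem mon_eq_incl_mul (S : Finset (Fin n)) (r : R) : mon D S r = incl D r * mon D S 1 := by
  rw [incl_mul_mon, mul_one]

theorem mon_mem_grade (S : Finset (Fin n)) (r : R) : mon D S r ∈ grade D S.card := fun T hT => by
  rw [coeff_mon, if_neg (by rintro rfl; exact hT rfl)]

theorem incl_mem_grade (r : R) : incl D r ∈ grade D 0 := mon_mem_grade D ∅ r

theorem basisOne_mem_grade (i : Fin n) : basisOne D i ∈ grade D 1 := by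
  exact mon_mem_grade D {i} 1

theorem grade_eq_bot {k : ℕ} (hk : n < k) : grade D k = ⊥ := by
  rw [eq_bot_iff]
  intro x hx
  rw [Submodule.mem_bot]
  ext S
  rw [map_zero]
  have := Finset.card_le_univ S
  rw [Fintype.card_fin] at this
  exact hx S (by omega)

theorem range_incl : LinearMap.range (incl D).toLinearMap = grade D 0 := by
  apply le_antisymm
  · rintro _ ⟨r, rfl⟩
    exact incl_mem_grade D r
  · intro x hx
    refine ⟨coeff D ∅ x, ?_⟩
    ext S
    change coeff D S (mon D ∅ _) = _
    rw [coeff_mon]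
    split_ifs with h
    · rw [h]
    · exact (hx S (by rwa [Ne, Finset.card_eq_zero])).symm

theorem incl_injective : Function.Injective (incl D) := fun r s h => by
  have := congrArg (coeff D ∅) h
  change coeff D ∅ (mon D ∅ r) = coeff D ∅ (mon D ∅ s) at this
  simpa [coeff_mon] using this

theorem basisOne_mul_mon (i : Fin n) (S : Finset (Fin n)) (r : R) : basisOne D i * mon D S r =
    if i ∈ S then 0 else D.sg {i} S • mon D (insert i S) (D.tw {i} r) := by
  rw [basisOne, mon_mul_mon, one_mul]
  simp only [Finset.disjoint_singleton_left, Finset.singleton_union, ite_not]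

theorem sg_singleton_eq_one {i : Fin n} {S : Finset (Fin n)} (h : ∀ j ∈ S, i < j) :
    D.sg {i} S = 1 := by
  rw [SkewData.sg, Finset.prod_singleton]
  exact Finset.prod_eq_one fun j hj => if_neg (h j hj).le.not_gt

theorem mon_insert {i : Fin n} {S : Finset (Fin n)} (h : ∀ j ∈ S, i < j) :
    mon D (insert i S) 1 = basisOne D i * mon D S 1 := by
  rw [basisOne_mul_mon, if_neg (fun hi => (h i hi).false), sg_singleton_eq_one D h, one_smul,
    map_one (D.tw {i})]

variable {D} in
/-- A skew exterior algebra is generated as an algebra by `R` and the `eᵢ`. -/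
theorem induction {P : SkewExt D → Prop} (incl : ∀ r, P (incl D r))
    (basisOne : ∀ i, P (basisOne D i)) (add : ∀ x y, P x → P y → P (x + y))
    (mul : ∀ x y, P x → P y → P (x * y)) (x : SkewExt D) : P x := by
  have h1 : ∀ S, P (mon D S 1) := fun S => by
    induction S using Finset.induction_on_min with
    | empty => exact incl 1
    | insert i S h ih => rw [mon_insert D h]; exact mul _ _ (basisOne i) ih
  rw [← sum_mon_coeff D x]
  refine Finset.sum_induction _ P add ?_ fun S _ => ?_
  · simpa using incl 0
  · rw [mon_eq_incl_mul]; exact mul _ _ (incl _) (h1 S)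

section Lift

variable {D} {T : Type} [Ring T]

/-- The increasing product of the elements `E i`, `i ∈ S`. -/
def wedge (E : Fin n → T) (S : Finset (Fin n)) : T := (S.sort.map E).prod

@[simp] theorem wedge_empty (E : Fin n → T) : wedge E ∅ = 1 := by simp [wedge]

@[simp] theorem wedge_singleton (E : Fin n → T) (i : Fin n) : wedge E {i} = E i := by
  simp [wedge]

theorem wedge_insert (E : Fin n → T) {i : Fin n} {S : Finset (Fin n)} (h : ∀ j ∈ S, i < j) :
    wedge E (insert i S) = E i * wedge E S := by
  rw [wedge, Finset.sort_insert (· ≤ ·) (fun j hj => (h j hj).le) (fun hi => (h i hi).false)]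
  simp [wedge]

variable [Algebra ℂ T]

theorem mul_wedge (E : Fin n → T) (hc : ∀ i j, j < i → E i * E j = D.c i j • (E j * E i))
    (hs : ∀ i, E i * E i = 0) (i : Fin n) (S : Finset (Fin n)) :
    E i * wedge E S = if i ∈ S then 0 else D.sg {i} S • wedge E (insert i S) := by
  induction S using Finset.induction_on_min with
  | empty => simp
  | insert m S h ih =>
    have hm : m ∉ S := fun hm => (h m hm).false
    rcases lt_trichotomy i m with him | rfl | hmi
    · have h' : ∀ j ∈ insert m S, i < j := fun j hj => by
        rcases Finset.mem_insert.1 hj with rfl | hj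
        · exact him
        · exact him.trans (h j hj)
      rw [if_neg (fun hi => (h' i hi).false), sg_singleton_eq_one D h', one_smul,
        wedge_insert E h']
    · rw [if_pos (Finset.mem_insert_self _ _), wedge_insert E h, ← mul_assoc, hs, zero_mul]
    · rw [wedge_insert E h, ← mul_assoc, hc i m hmi, smul_mul_assoc, mul_assoc, ih]
      by_cases hi : i ∈ S
      · rw [if_pos hi, if_pos (Finset.mem_insert_of_mem hi), mul_zero, smul_zero]
      · rw [if_neg hi, if_neg (by simp [hi, hmi.ne']), Finset.insert_comm,
          wedge_insert E (i := m) (S := insert i S), mul_smul_comm, smul_smul]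
        · congr 1
          simp [SkewData.sg, Finset.prod_insert hm, hmi]
        · intro j hj
          rcases Finset.mem_insert.1 hj with rfl | hj
          · exact hmi
          · exact h j hj

/-- The linear map `∑ r_S e_S ↦ ∑ φ(r_S) E_S`. -/
def liftLinear (φ : R →ₐ[ℂ] T) (E : Fin n → T) : SkewExt D →ₗ[ℂ] T :=
  ∑ S, LinearMap.mulRight ℂ (wedge E S) ∘ₗ φ.toLinearMap ∘ₗ coeff D S

theorem liftLinear_mon (φ : R →ₐ[ℂ] T) (E : Fin n → T) (S : Finset (Fin n)) (r : R) :
    liftLinear φ E (mon D S r) = φ r * wedge E S := by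
  simp only [liftLinear, LinearMap.sum_apply, LinearMap.comp_apply, coeff_mon]
  rw [Finset.sum_eq_single S]
  · simp
  · intro T _ hT; simp [hT]
  · simp

theorem liftLinear_mul (φ : R →ₐ[ℂ] T) (E : Fin n → T)
    (hφ : ∀ i r, E i * φ r = φ (D.tw {i} r) * E i)
    (hc : ∀ i j, j < i → E i * E j = D.c i j • (E j * E i)) (hs : ∀ i, E i * E i = 0)
    (x y : SkewExt D) : liftLinear φ E (x * y) = liftLinear φ E x * liftLinear φ E y := by
  induction x using induction generalizing y with
  | add x x' hx hx' => rw [add_mul, map_add, map_add, add_mul, hx, hx']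
  | mul x x' hx hx' => rw [mul_assoc, hx, hx', hx, mul_assoc]
  | incl r =>
    rw [← sum_mon_coeff D y]
    simp only [Finset.mul_sum, map_sum]
    refine Finset.sum_congr rfl fun S _ => ?_
    have : liftLinear φ E (SkewExt.incl D r) = φ r := (liftLinear_mon φ E ∅ r).trans (by simp)
    rw [incl_mul_mon, liftLinear_mon, liftLinear_mon, this, map_mul, mul_assoc]
  | basisOne i =>
    rw [← sum_mon_coeff D y]
    simp only [Finset.mul_sum, map_sum]
    refine Finset.sum_congr rfl fun S _ => ?_
    rw [SkewExt.basisOne, liftLinear_mon, ← SkewExt.basisOne, basisOne_mul_mon, liftLinear_mon,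
      map_one, one_mul, wedge_singleton, ← mul_assoc, hφ, mul_assoc, mul_wedge E hc hs]
    split_ifs
    · rw [map_zero, mul_zero]
    · rw [map_smul, liftLinear_mon, mul_smul_comm]

/-- The universal property of a skew exterior algebra: an algebra morphism `φ` on `R` and elements
`E i` satisfying the defining relations of the `eᵢ` determine a morphism of algebras. -/
def lift (φ : R →ₐ[ℂ] T) (E : Fin n → T)
    (hφ : ∀ i r, E i * φ r = φ (D.tw {i} r) * E i)
    (hc : ∀ i j, j < i → E i * E j = D.c i j • (E j * E i)) (hs : ∀ i, E i * E i = 0) :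
    SkewExt D →ₐ[ℂ] T :=
  AlgHom.ofLinearMap (liftLinear φ E) ((liftLinear_mon φ E ∅ 1).trans (by simp))
    (liftLinear_mul φ E hφ hc hs)

end Lift

end SkewExt

/-! ### Forms generated in degree zero -/

section FormSpan
variable {Ω : Type} [Ring Ω] [Algebra ℂ Ω] {d : Ω →ₗ[ℂ] Ω}

theorem formSpan_zero (X : Submodule ℂ Ω) : formSpan d (X : Set Ω) 0 = X := by
  apply le_antisymm
  · refine Submodule.span_le.2 ?_
    rintro _ ⟨a₀, h₀, a, -, rfl⟩
    simpa using h₀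
  · intro x hx
    exact Submodule.subset_span ⟨x, hx, Fin.elim0, fun i => i.elim0, by simp⟩

/-- The `k`-forms generated by `X` are the product `X (dX)ᵏ` of submodules. -/
theorem formSpan_eq_mul_pow (X : Submodule ℂ Ω) (k : ℕ) :
    formSpan d (X : Set Ω) k = X * X.map d ^ k := by
  have hX : X = Submodule.span ℂ (X : Set Ω) := (Submodule.span_eq X).symm
  have hd : X.map d = Submodule.span ℂ (d '' X) := by
    conv_lhs => rw [hX, Submodule.map_span]
  conv_rhs => rw [hd, Submodule.span_pow]; arg 1; rw [hX]
  rw [Submodule.span_mul_span, formSpan]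
  congr 1
  ext ω
  constructor
  · rintro ⟨a₀, h₀, a, ha, rfl⟩
    refine Set.mul_mem_mul h₀ (Set.mem_pow.2 ⟨fun i => ⟨d (a i), a i, ha i, rfl⟩, rfl⟩)
  · rintro ⟨a₀, h₀, y, hy, rfl⟩
    obtain ⟨f, rfl⟩ := Set.mem_pow.1 hy
    choose a ha hda using fun i => (f i).2
    exact ⟨a₀, h₀, a, ha, by simp [hda]⟩

/-- If `d` satisfies the Leibniz rule on the subalgebra `X`, the forms generated by `X` multiply:
every product `da b` can be rewritten as `d(ab) - a db`. -/
theorem formSpan_mul_le (X : Subalgebra ℂ Ω)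
    (hd : ∀ a ∈ X, ∀ b ∈ X, d (a * b) = d a * b + a * d b) (i j : ℕ) :
    formSpan d (X : Set Ω) i * formSpan d (X : Set Ω) j ≤ formSpan d (X : Set Ω) (i + j) := by
  set P := Subalgebra.toSubmodule X with hP
  have hX : (X : Set Ω) = (P : Set Ω) := rfl
  rw [hX, formSpan_eq_mul_pow, formSpan_eq_mul_pow, formSpan_eq_mul_pow]
  have hPP : P * P ≤ P := Submodule.mul_le.2 fun a ha b hb => X.mul_mem ha hb
  have h1 : P.map d * P ≤ P * P.map d := by
    refine Submodule.mul_le.2 ?_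
    rintro _ ⟨a, ha, rfl⟩ b hb
    rw [eq_sub_of_add_eq (hd a ha b hb).symm, ← one_mul (d (a * b))]
    exact sub_mem (Submodule.mul_mem_mul X.one_mem ⟨_, X.mul_mem ha hb, rfl⟩)
      (Submodule.mul_mem_mul ha ⟨_, hb, rfl⟩)
  have h2 : ∀ m, P.map d ^ m * P ≤ P * P.map d ^ m := fun m => by
    induction m with
    | zero => simp
    | succ m ih =>
      rw [pow_succ, mul_assoc]
      refine (mul_le_mul_right h1 _).trans ?_
      rw [← mul_assoc, ← mul_assoc]
      exact mul_le_mul_left ih _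
  rw [pow_add, mul_assoc, ← mul_assoc _ P]
  refine (mul_le_mul_right (mul_le_mul_left (h2 i) _) _).trans ?_
  rw [mul_assoc, ← mul_assoc]
  exact mul_le_mul_left hPP _

end FormSpan

/-! ### Differential calculi on skew exterior algebras -/

theorem IsDGA.formSpan_le {Ω : Type} [Ring Ω] [Algebra ℂ Ω] {𝒜 : ℕ → Submodule ℂ Ω}
    [GradedAlgebra 𝒜] {d : Ω →ₗ[ℂ] Ω} (h : IsDGA 𝒜 d) {X : Submodule ℂ Ω} (hX : X ≤ 𝒜 0) (k : ℕ) :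
    formSpan d (X : Set Ω) k ≤ 𝒜 k := by
  rw [formSpan_eq_mul_pow]
  have hd : X.map d ≤ 𝒜 1 := by
    rintro _ ⟨x, hx, rfl⟩
    exact h.degree 0 x (hX hx)
  have hp : ∀ m, X.map d ^ m ≤ 𝒜 m := fun m => by
    induction m with
    | zero => rw [pow_zero, Submodule.one_le]; exact SetLike.one_mem_graded 𝒜
    | succ m ih =>
      rw [pow_succ]
      exact Submodule.mul_le.2 fun x hx y hy => SetLike.mul_mem_graded (ih hx) (hd hy)
  refine Submodule.mul_le.2 fun x hx y hy => ?_
  have := SetLike.mul_mem_graded (hX hx) (hp k hy)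
  rwa [zero_add] at this

namespace SkewExt
variable {R : Type} [Ring R] [Algebra ℂ R] {n : ℕ} {D : SkewData R n}

theorem mem_of_mem_grade {p : Submodule ℂ (SkewExt D)} {k : ℕ}
    (h : ∀ S : Finset (Fin n), S.card = k → ∀ r, mon D S r ∈ p) {x : SkewExt D}
    (hx : x ∈ grade D k) : x ∈ p := by
  rw [← sum_mon_coeff D x]
  refine sum_mem fun S _ => ?_
  by_cases hS : S.card = k
  · exact h S hS _
  · rw [hx S hS, map_zero]; exact zero_mem _

/-- The graded Leibniz rule need only be checked for left multiplication by `R` and by the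
generators `eᵢ`. -/
theorem leibniz_of_basisOne {d : SkewExt D →ₗ[ℂ] SkewExt D}
    (h0 : ∀ r x, d (incl D r * x) = d (incl D r) * x + incl D r * d x)
    (h1 : ∀ i x, d (basisOne D i * x) = d (basisOne D i) * x - basisOne D i * d x)
    (k : ℕ) (ω : SkewExt D) (hω : ω ∈ grade D k) (η : SkewExt D) :
    d (ω * η) = d ω * η + (-1 : ℂ) ^ k • (ω * d η) := by
  have key : ∀ S : Finset (Fin n), ∀ y,
      d (mon D S 1 * y) = d (mon D S 1) * y + (-1 : ℂ) ^ S.card • (mon D S 1 * d y) := fun S => by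
    induction S using Finset.induction_on_min with
    | empty =>
      intro y
      simpa only [map_one, Finset.card_empty, pow_zero, one_smul] using! h0 1 y
    | insert i S h ih =>
      intro y
      rw [mon_insert D h, mul_assoc, h1, ih, h1,
        Finset.card_insert_of_notMem (fun hi => (h i hi).false), pow_succ]
      simp only [mul_add, sub_mul, mul_assoc, mul_smul_comm, mul_neg_one, neg_smul]
      abel
  refine mem_of_mem_grade (p := LinearMap.eqLocus (d ∘ₗ LinearMap.mulRight ℂ η)
    (LinearMap.mulRight ℂ η ∘ₗ d + (-1 : ℂ) ^ k • LinearMap.mulRight ℂ (d η))) ?_ hω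
  rintro S rfl r
  change d (mon D S r * η) = d (mon D S r) * η + (-1 : ℂ) ^ S.card • (mon D S r * d η)
  rw [mon_eq_incl_mul, mul_assoc, h0, h0, key]
  simp only [mul_add, add_mul, mul_assoc, mul_smul_comm]
  abel

/-- A differential on a skew exterior algebra over `R` makes it a calculus on `R` as soon as the
generators `eᵢ` are forms `∑ a db`. -/
theorem isDifferentialCalculus {d : SkewExt D →ₗ[ℂ] SkewExt D} (hd : IsDGA (grade D) d)
    (h : ∀ i, basisOne D i ∈ formSpan d (Set.range (incl D)) 1) :
    IsDifferentialCalculus (incl D) (grade D) d where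
  isDGA := hd
  injective := incl_injective D
  range_eq := range_incl D
  generated := fun k => by
    have hX : (Set.range (incl D)) = ((incl D).range : Set (SkewExt D)) := rfl
    have hle := formSpan_mul_le (d := d) (incl D).range (fun a ha b _ => by
      obtain ⟨r, rfl⟩ := ha
      simpa using hd.leibniz 0 _ (incl_mem_grade D r) b)
    have h0 : ∀ r, incl D r ∈ formSpan d (Set.range (incl D)) 0 := fun r => by
      have := formSpan_zero (d := d) (Subalgebra.toSubmodule (incl D).range)
      rw [hX, ← Subalgebra.coe_toSubmodule, this]
      exact ⟨r, rfl⟩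
    rw [hX] at h h0 ⊢
    apply le_antisymm
    · refine fun x hx => mem_of_mem_grade ?_ hx
      clear hx x
      rintro S rfl r
      have key : mon D S 1 ∈ formSpan d ((incl D).range : Set (SkewExt D)) S.card := by
        induction S using Finset.induction_on_min with
        | empty => exact h0 1
        | insert i S hS ih =>
          rw [mon_insert D hS, Finset.card_insert_of_notMem (fun hi => (hS i hi).false), add_comm]
          exact hle _ _ (Submodule.mul_mem_mul (h i) ih)
      rw [mon_eq_incl_mul, ← zero_add S.card]
      exact hle _ _ (Submodule.mul_mem_mul (h0 r) key)
    · refine hd.formSpan_le (X := Subalgebra.toSubmodule (incl D).range) ?_ k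
      rintro _ ⟨r, rfl⟩
      exact incl_mem_grade D r

theorem map_coeff_map_mon {M N : Type} [AddCommGroup M] [Module ℂ M] [AddCommGroup N] [Module ℂ N]
    (f : M →ₗ[ℂ] N) (S T : Finset (Fin n)) (x : M ⊗[ℂ] R) :
    TensorProduct.map LinearMap.id (coeff D S) (TensorProduct.map f (mon D T) x) =
      if S = T then TensorProduct.map f LinearMap.id x else 0 := by
  induction x using TensorProduct.induction_on with
  | zero => simp
  | add x y hx hy => rw [map_add, map_add, hx, hy]; split_ifs <;> simp
  | tmul m r =>
    rw [TensorProduct.map_tmul, TensorProduct.map_tmul, coeff_mon]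
    split_ifs <;> simp

end SkewExt

/-! ### The calculus on `O(U(1))` and its left coinvariant forms -/

section CalculusH
variable (q : ℂˣ)

theorem finset_fin_one (S : Finset (Fin 1)) : S = ∅ ∨ S = {0} := by
  revert S; decide

theorem sum_finset_fin_one {M : Type} [AddCommMonoid M] (f : Finset (Fin 1) → M) :
    ∑ S, f S = f ∅ + f {0} := by
  rw [show (Finset.univ : Finset (Finset (Fin 1))) = {∅, {0}} by decide,
    Finset.sum_pair (by decide)]

theorem tw_H (f : ℂ[T;T⁻¹]) : (dataH q).tw {0} f = scaleH q f := by
  simp [SkewData.tw, dataH]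

theorem qDeriv_mul (f g : ℂ[T;T⁻¹]) :
    qDeriv q (f * g) = qDeriv q f * scaleH q g + f * qDeriv q g := by
  simp only [qDeriv, LinearMap.smul_apply, LinearMap.comp_apply, LinearMap.sub_apply,
    AlgHom.toLinearMap_apply, LinearMap.id_apply, LinearMap.mulLeft_apply, map_mul, smul_mul_assoc,
    mul_smul_comm, ← smul_add]
  congr 1
  ring

theorem coeff_empty_mul {R : Type} [Ring R] [Algebra ℂ R] {n : ℕ} {D : SkewData R n}
    (x y : SkewExt D) :
    SkewExt.coeff D ∅ (x * y) = SkewExt.coeff D ∅ x * SkewExt.coeff D ∅ y := by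
  simp [SkewExt.coeff_mul]

theorem qDeriv_one : qDeriv q 1 = 0 := by simp [qDeriv]

theorem isDGA_H : IsDGA (gradeH q) (dH q) where
  degree := fun k ω hω => by
    by_cases hk : k = 0
    · subst hk
      exact SkewExt.mon_mem_grade (dataH q) {0} _
    · have : SkewExt.coeff (dataH q) ∅ ω = 0 := hω ∅ (Ne.symm hk)
      simp only [dH, LinearMap.comp_apply, this, map_zero]
      exact zero_mem _
  sq_zero := fun ω => by
    have h' : (∅ : Finset (Fin 1)) ≠ {0} := by decide
    simp [dH, SkewExt.coeff_mon, h']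
  leibniz := by
    refine SkewExt.leibniz_of_basisOne (fun r x => ?_) (fun i x => ?_)
    · have hr : SkewExt.coeff (dataH q) ∅ (inclH q r) = r :=
        (SkewExt.coeff_mon ∅ ∅ r).trans (if_pos rfl)
      have hx : x = inclH q (SkewExt.coeff (dataH q) ∅ x) +
          SkewExt.mon (dataH q) {0} (SkewExt.coeff (dataH q) {0} x) := by
        conv_lhs => rw [← SkewExt.sum_mon_coeff _ x, sum_finset_fin_one]
        rfl
      have hd : ∀ y, dH q y = SkewExt.mon (dataH q) {0} (qDeriv q (SkewExt.coeff (dataH q) ∅ y)) :=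
        fun y => rfl
      simp only [hd, coeff_empty_mul, hr, qDeriv_mul, map_add, SkewExt.incl_mul_mon]
      congr 1
      conv_rhs => rw [hx]
      rw [mul_add, SkewExt.mon_mul_incl, SkewExt.mon_mul_mon, tw_H]
      simp
    · have h' : ∀ i : Fin 1, (∅ : Finset (Fin 1)) ≠ {i} := by decide
      have h0 : SkewExt.coeff (dataH q) ∅ (SkewExt.basisOne (dataH q) i) = 0 := by
        rw [SkewExt.basisOne, SkewExt.coeff_mon, if_neg (h' i)]
      have hi : i = 0 := Subsingleton.elim _ _
      subst hi
      simp only [dH, LinearMap.comp_apply, coeff_empty_mul, h0, zero_mul, map_zero, zero_sub]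
      rw [SkewExt.basisOne, SkewExt.mon_mul_mon]
      simp

theorem isDifferentialCalculus_H (hq : (q : ℂ) ^ 2 ≠ 1) :
    IsDifferentialCalculus (inclH q) (gradeH q) (dH q) := by
  refine SkewExt.isDifferentialCalculus (isDGA_H q) fun i => ?_
  have hi : i = 0 := Subsingleton.elim _ _
  subst hi
  refine Submodule.subset_span ⟨1, ⟨1, map_one _⟩, fun _ => inclH q (LaurentPolynomial.T 1),
    fun _ => ⟨_, rfl⟩, ?_⟩
  simp [dH_T_one q hq, dt, SkewExt.basisOne]

/-- The coefficient of `tⁿ` in a Laurent polynomial. -/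
def lcoeff (n : ℤ) : ℂ[T;T⁻¹] →ₗ[ℂ] ℂ :=
  Finsupp.lapply n ∘ₗ (AddMonoidAlgebra.coeffLinearEquiv ℂ).toLinearMap

theorem lcoeff_T (m n : ℤ) : lcoeff m (LaurentPolynomial.T n) = if n = m then 1 else 0 :=
  LaurentPolynomial.T_apply m n

theorem laurent_linearMap_ext {M : Type} [AddCommGroup M] [Module ℂ M] {f g : ℂ[T;T⁻¹] →ₗ[ℂ] M}
    (h : ∀ n, f (LaurentPolynomial.T n) = g (LaurentPolynomial.T n)) : f = g := by
  refine LinearMap.ext fun p => ?_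
  induction p using LaurentPolynomial.induction_on' with
  | add p p' hp hp' => rw [map_add, map_add, hp, hp']
  | C_mul_T n a => rw [← LaurentPolynomial.smul_eq_C_mul, map_smul, map_smul, h]

theorem eq_smul_T_of_lcoeff {f : ℂ[T;T⁻¹]} {m : ℤ} (h : ∀ n, n ≠ m → lcoeff n f = 0) :
    f = lcoeff m f • LaurentPolynomial.T m := by
  apply LaurentPolynomial.ext
  intro n
  change lcoeff n f = lcoeff n (lcoeff m f • LaurentPolynomial.T m)
  rw [map_smul, lcoeff_T]
  split_ifs with hn
  · rw [hn, smul_eq_mul, mul_one]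
  · rw [h n (Ne.symm hn), smul_zero]

/-- If `∑ fₙ tⁿ⁺ᵏ ⊗ tⁿ = 1 ⊗ f` then `f` is a multiple of `t⁻ᵏ`. -/
theorem eq_smul_T_of_comul {f : ℂ[T;T⁻¹]} {k : ℤ}
    (h : TensorProduct.map (LinearMap.mulRight ℂ (LaurentPolynomial.T k)) LinearMap.id
      (Coalgebra.comul (R := ℂ) f) = 1 ⊗ₜ f) : f = lcoeff (-k) f • LaurentPolynomial.T (-k) := by
  refine eq_smul_T_of_lcoeff fun n hn => ?_
  let L := LinearMap.mul' ℂ ℂ ∘ₗ TensorProduct.map (lcoeff (n + k)) (lcoeff n)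
  have h1 : L ∘ₗ TensorProduct.map (LinearMap.mulRight ℂ (LaurentPolynomial.T k)) LinearMap.id ∘ₗ
      Coalgebra.comul (R := ℂ) = lcoeff n := laurent_linearMap_ext fun m => by
    simp only [L, LinearMap.comp_apply, LaurentPolynomial.comul_T, TensorProduct.map_tmul,
      LinearMap.mulRight_apply, ← LaurentPolynomial.T_add, lcoeff_T, LinearMap.id_apply,
      LinearMap.mul'_apply, add_left_inj]
    split_ifs <;> simp
  rw [← LinearMap.congr_fun h1 f]
  change L (TensorProduct.map _ _ (Coalgebra.comul f)) = 0
  rw [h]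
  simp only [L, LinearMap.comp_apply, TensorProduct.map_tmul, LinearMap.mul'_apply]
  rw [← LaurentPolynomial.T_zero, lcoeff_T, if_neg (by omega), zero_mul]

theorem coeff_one_H (S : Finset (Fin 1)) :
    SkewExt.coeff (dataH q) S 1 = if S = ∅ then 1 else 0 := SkewExt.coeff_mon ∅ S 1

theorem coeff_tinvdt (S : Finset (Fin 1)) : SkewExt.coeff (dataH q) S (tinvdt q) =
    if S = {0} then LaurentPolynomial.T (-1) else 0 := by
  rw [tinvdt_eq, SkewExt.coeff_mon]

/-- A left coinvariant form is a combination of `1` and `t⁻¹ dt`. -/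
theorem eq_of_mem_leftCoinv {θ : FormsH q} (h : θ ∈ leftCoinv q) :
    θ = lcoeff 0 (SkewExt.coeff (dataH q) ∅ θ) • 1 +
      lcoeff (-1) (SkewExt.coeff (dataH q) {0} θ) • tinvdt q := by
  have h' : (∅ : Finset (Fin 1)) ≠ {0} := by decide
  have h : leftCoact q θ = 1 ⊗ₜ θ := h
  have h0 := congrArg (TensorProduct.map LinearMap.id (SkewExt.coeff (dataH q) ∅)) h
  have h1 := congrArg (TensorProduct.map LinearMap.id (SkewExt.coeff (dataH q) {0})) h
  simp only [leftCoact, LinearMap.add_apply, LinearMap.comp_apply, map_add,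
    SkewExt.map_coeff_map_mon, if_neg h', if_neg h'.symm, if_true, add_zero, zero_add,
    TensorProduct.map_tmul, LinearMap.id_apply] at h0 h1
  have e0 := eq_smul_T_of_comul (k := 0) (f := SkewExt.coeff (dataH q) ∅ θ)
    (by simpa using! h0)
  have e1 := eq_smul_T_of_comul (k := 1) (f := SkewExt.coeff (dataH q) {0} θ)
    (by simpa using! h1)
  rw [neg_zero, LaurentPolynomial.T_zero] at e0
  refine SkewExt.ext' fun S => ?_
  rw [map_add, map_smul, map_smul, coeff_one_H, coeff_tinvdt]
  rcases finset_fin_one S with rfl | rfl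
  · rw [if_pos rfl, if_neg h', smul_zero, add_zero]; exact e0
  · rw [if_pos rfl, if_neg h'.symm, smul_zero, zero_add]; exact e1

theorem lam_zero : lam q 0 = Submodule.span ℂ {1} := by
  apply le_antisymm
  · rintro θ ⟨h, h'⟩
    have := eq_of_mem_leftCoinv q h
    rw [h' {0} (by decide), map_zero, zero_smul, add_zero] at this
    rw [this]
    exact Submodule.smul_mem _ _ (Submodule.mem_span_singleton_self _)
  · exact (Submodule.span_singleton_le_iff_mem _ _).2 (one_mem q)

theorem lam_one : lam q 1 = Submodule.span ℂ {tinvdt q} := by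
  apply le_antisymm
  · rintro θ ⟨h, h'⟩
    have := eq_of_mem_leftCoinv q h
    rw [h' ∅ (by decide), map_zero, zero_smul, zero_add] at this
    rw [this]
    exact Submodule.smul_mem _ _ (Submodule.mem_span_singleton_self _)
  · exact (Submodule.span_singleton_le_iff_mem _ _).2 (tinvdt_mem q)

theorem lam_eq_bot {k : ℕ} (hk : 2 ≤ k) : lam q k = ⊥ := by
  rw [lam, gradeH, SkewExt.grade_eq_bot _ hk, inf_bot_eq]

theorem isCompl_lam : IsCompl ((lam q 0).submoduleOf (leftCoinv q))
    ((lam q 1).submoduleOf (leftCoinv q)) := by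
  constructor
  · rw [Submodule.disjoint_def]
    rintro ⟨θ, h⟩ ⟨-, h0⟩ ⟨-, h1⟩
    refine Subtype.ext (SkewExt.ext' fun S => ?_)
    by_cases hS : S.card = 0
    · exact h1 S (by simp [hS])
    · exact h0 S hS
  · rw [codisjoint_iff, eq_top_iff]
    rintro ⟨θ, h⟩ -
    set a := lcoeff 0 (SkewExt.coeff (dataH q) ∅ θ)
    set b := lcoeff (-1) (SkewExt.coeff (dataH q) {0} θ)
    have e : (⟨θ, h⟩ : leftCoinv q) =
        a • ⟨1, (one_mem q).1⟩ + b • ⟨tinvdt q, (tinvdt_mem q).1⟩ :=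
      Subtype.ext (eq_of_mem_leftCoinv q h)
    rw [e]
    exact add_mem (Submodule.mem_sup_left (Submodule.smul_mem _ _ (one_mem q)))
      (Submodule.mem_sup_right (Submodule.smul_mem _ _ (tinvdt_mem q)))

/-- The vertical forms are free over `A` on `1 ⊗ 1` and `1 ⊗ t⁻¹ dt`. -/
theorem existsUnique_ver (v : Ver q) : ∃! p : OqSL2 q × OqSL2 q,
    v = p.1 ⊗ₜ ⟨1, (one_mem q).1⟩ + p.2 ⊗ₜ ⟨tinvdt q, (tinvdt_mem q).1⟩ := by
  have h' : (∅ : Finset (Fin 1)) ≠ {0} := by decide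
  have hex : ∃ p : OqSL2 q × OqSL2 q,
      v = p.1 ⊗ₜ ⟨1, (one_mem q).1⟩ + p.2 ⊗ₜ ⟨tinvdt q, (tinvdt_mem q).1⟩ := by
    induction v using TensorProduct.induction_on with
    | zero => exact ⟨0, by simp⟩
    | add v w hv hw =>
      obtain ⟨p, rfl⟩ := hv
      obtain ⟨p', rfl⟩ := hw
      exact ⟨p + p', by
        rw [Prod.fst_add, Prod.snd_add, TensorProduct.add_tmul, TensorProduct.add_tmul]; abel⟩
    | tmul a θ =>
      obtain ⟨θ, h⟩ := θ
      refine ⟨⟨lcoeff 0 (SkewExt.coeff (dataH q) ∅ θ) • a,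
        lcoeff (-1) (SkewExt.coeff (dataH q) {0} θ) • a⟩, ?_⟩
      rw [TensorProduct.smul_tmul, TensorProduct.smul_tmul, ← TensorProduct.tmul_add]
      exact congrArg _ (Subtype.ext (eq_of_mem_leftCoinv q h))
  refine existsUnique_of_exists_of_unique hex ?_
  rintro p p' rfl hp
  have e0 := congrArg ((TensorProduct.rid ℂ (OqSL2 q)).toLinearMap ∘ₗ TensorProduct.map LinearMap.id
    (lcoeff 0 ∘ₗ SkewExt.coeff (dataH q) ∅ ∘ₗ (leftCoinv q).subtype)) hp
  have e1 := congrArg ((TensorProduct.rid ℂ (OqSL2 q)).toLinearMap ∘ₗ TensorProduct.map LinearMap.id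
    (lcoeff (-1) ∘ₗ SkewExt.coeff (dataH q) {0} ∘ₗ (leftCoinv q).subtype)) hp
  have hT : lcoeff 0 (1 : ℂ[T;T⁻¹]) = 1 := by
    rw [← LaurentPolynomial.T_zero, lcoeff_T, if_pos rfl]
  simp only [map_add, LinearMap.comp_apply, TensorProduct.map_tmul, Submodule.subtype_apply,
    coeff_one_H, coeff_tinvdt, if_pos, if_neg h', if_neg h'.symm, map_zero,
    TensorProduct.tmul_zero, add_zero, zero_add, lcoeff_T, hT, LinearMap.id_apply,
    LinearEquiv.coe_coe, TensorProduct.rid_tmul, one_smul] at e0 e1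
  exact Prod.ext e0 e1

end CalculusH

/-! ### The 3D calculus on `O_q(SL₂)` -/

/-- `O_q(SL₂)` is generated as an algebra by `α, β, γ, δ`. -/
theorem OqSL2.induction {q : ℂˣ} {P : OqSL2 q → Prop} (smul_one : ∀ c : ℂ, P (algebraMap ℂ _ c))
    (gen : ∀ x, P (gen q x)) (add : ∀ a b, P a → P b → P (a + b))
    (mul : ∀ a b, P a → P b → P (a * b)) (a : OqSL2 q) : P a := by
  obtain ⟨y, rfl⟩ : ∃ y, proj q y = a := RingQuot.mkAlgHom_surjective ℂ (SLRel q) a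
  induction y using FreeAlgebra.induction with
  | grade0 r => rw [AlgHom.commutes]; exact smul_one r
  | grade1 x => exact gen x
  | mul a b ha hb => rw [map_mul]; exact mul _ _ ha hb
  | add a b ha hb => rw [map_add]; exact add _ _ ha hb

section CalculusA
variable (q : ℂˣ)

theorem fst_jetHom (a : OqSL2 q) : (jetHom q a).fst = inclA q a := by
  induction a using OqSL2.induction with
  | smul_one c => rw [AlgHom.commutes, AlgHom.commutes]; rfl
  | gen x => simp [jetHom, jet]
  | add a b ha hb => rw [map_add, map_add, TrivSqZeroExt.fst_add, ha, hb]
  | mul a b ha hb => rw [map_mul, map_mul, TrivSqZeroExt.fst_mul, ha, hb]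

theorem dFun_mul (a b : OqSL2 q) :
    dFun q (a * b) = dFun q a * inclA q b + inclA q a * dFun q b := by
  simp only [dFun, LinearMap.comp_apply, AlgHom.toLinearMap_apply, map_mul]
  change (jetHom q a * jetHom q b).snd = _
  rw [TrivSqZeroExt.snd_mul, fst_jetHom, fst_jetHom, add_comm]
  rfl

theorem dFun_algebraMap (c : ℂ) : dFun q (algebraMap ℂ _ c) = 0 := by
  simp only [dFun, LinearMap.comp_apply, AlgHom.toLinearMap_apply, AlgHom.commutes]
  rfl

theorem dA_mon (S : Finset (Fin 3)) (a : OqSL2 q) : dA q (SkewExt.mon (dataA q) S a) =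
    dFun q a * SkewExt.mon (dataA q) S 1 + inclA q a * dE q S := by
  simp only [dA, LinearMap.sum_apply, LinearMap.comp_apply, SkewExt.coeff_mon]
  rw [Finset.sum_eq_single S]
  · simp
  · intro T _ hT; simp [hT]
  · simp

theorem dA_mon_one (S : Finset (Fin 3)) : dA q (SkewExt.mon (dataA q) S 1) = dE q S := by
  rw [dA_mon, ← map_one (algebraMap ℂ (OqSL2 q)), dFun_algebraMap]
  simp

theorem dA_incl_mul (a : OqSL2 q) (x : FormsA q) :
    dA q (inclA q a * x) = dFun q a * x + inclA q a * dA q x := by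
  rw [← SkewExt.sum_mon_coeff _ x]
  simp only [Finset.mul_sum, map_sum, ← Finset.sum_add_distrib]
  refine Finset.sum_congr rfl fun S _ => ?_
  rw [SkewExt.incl_mul_mon, dA_mon, dA_mon, dFun_mul, SkewExt.mon_eq_incl_mul _ S
    (SkewExt.coeff (dataA q) S x), map_mul]
  noncomm_ring

theorem mon_mul_mon_A (i j : Fin 3) (a b : OqSL2 q) :
    SkewExt.mon (dataA q) {i} a * SkewExt.mon (dataA q) {j} b =
      if i = j then 0 else (if j < i then (dataA q).c i j else 1) •
        SkewExt.mon (dataA q) {i, j} (a * (dataA q).tw {i} b) := by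
  rw [SkewExt.mon_mul_mon]
  simp only [Finset.disjoint_singleton, SkewData.sg, Finset.prod_singleton, ite_not]
  rfl

theorem dE_card {S : Finset (Fin 3)} (h : S.card ≠ 1) : dE q S = 0 := by
  have : ∀ i : Fin 3, S ≠ {i} := by rintro i rfl; exact h rfl
  simp [dE, this]

theorem dE_mem (S : Finset (Fin 3)) : dE q S ∈ gradeA q (S.card + 1) := by
  have h : ∀ i : Fin 3, SkewExt.mon (dataA q) {i} 1 ∈ gradeA q 1 := SkewExt.basisOne_mem_grade _
  by_cases hS : S.card = 1
  · rw [hS]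
    simp only [dE, ePlus, eMinus, eZero]
    split_ifs
    all_goals first
      | exact Submodule.smul_mem _ _ (SetLike.mul_mem_graded (h _) (h _))
      | exact zero_mem _
  · rw [dE_card q hS]; exact zero_mem _

theorem dGen_mem (x : Gen) : dGen q x ∈ gradeA q 1 := by
  have h : ∀ (i : Fin 3) r, SkewExt.mon (dataA q) {i} r ∈ gradeA q 1 := fun i r =>
    SkewExt.mon_mem_grade _ {i} r
  cases x
  · rw [dGen_α]; exact add_mem (h _ _) (Submodule.smul_mem _ _ (h _ _))
  · rw [dGen_β]; exact sub_mem (h _ _) (Submodule.smul_mem _ _ (h _ _))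
  · rw [dGen_γ]; exact add_mem (h _ _) (Submodule.smul_mem _ _ (h _ _))
  · rw [dGen_δ]; exact sub_mem (h _ _) (Submodule.smul_mem _ _ (h _ _))

theorem dFun_mem (a : OqSL2 q) : dFun q a ∈ gradeA q 1 := by
  induction a using OqSL2.induction with
  | smul_one c => rw [dFun_algebraMap]; exact zero_mem _
  | gen x => rw [dFun_gen]; exact dGen_mem q x
  | add a b ha hb => rw [map_add]; exact add_mem ha hb
  | mul a b ha hb =>
    rw [dFun_mul]
    refine add_mem ?_ ?_
    · exact SetLike.mul_mem_graded (i := 1) (j := 0) ha (SkewExt.incl_mem_grade _ b)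
    · have := SetLike.mul_mem_graded (SkewExt.incl_mem_grade (dataA q) a) hb
      rwa [zero_add] at this

theorem dA_mem (k : ℕ) (ω : FormsA q) (hω : ω ∈ gradeA q k) : dA q ω ∈ gradeA q (k + 1) := by
  refine SkewExt.mem_of_mem_grade (p := (gradeA q (k + 1)).comap (dA q)) ?_ hω
  rintro S rfl r
  rw [Submodule.mem_comap, dA_mon]
  refine add_mem ?_ ?_
  · rw [add_comm]; exact SetLike.mul_mem_graded (dFun_mem q r) (SkewExt.mon_mem_grade _ S 1)
  · have := SetLike.mul_mem_graded (SkewExt.incl_mem_grade (dataA q) r) (dE_mem q S)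
    rwa [zero_add] at this

theorem tw_gen (i : Fin 3) (x : Gen) : (dataA q).tw {i} (gen q x) =
    ((q ^ deg x : ℂˣ) : ℂ) ^ (dataA q).w i • gen q x := by
  fin_cases i <;> simp [SkewData.tw, dataA, pow_two, smul_smul]

theorem dFun_tw_gen (i : Fin 3) (x : Gen) :
    dFun q ((dataA q).tw {i} (gen q x)) * SkewExt.basisOne (dataA q) i =
      dE q {i} * inclA q (gen q x) - inclA q ((dataA q).tw {i} (gen q x)) * dE q {i} -
        SkewExt.basisOne (dataA q) i * dFun q (gen q x) := by
  have hq := q.ne_zero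
  have e10 : ({1, 0} : Finset (Fin 3)) = {0, 1} := by decide
  have e20 : ({2, 0} : Finset (Fin 3)) = {0, 2} := by decide
  have e21 : ({2, 1} : Finset (Fin 3)) = {1, 2} := by decide
  have w0 : (dataA q).w 0 = 1 := rfl
  have w1 : (dataA q).w 1 = 1 := rfl
  have w2 : (dataA q).w 2 = 2 := rfl
  have c10 : (dataA q).c 1 0 = -(q : ℂ) ^ 2 := rfl
  have c20 : (dataA q).c 2 0 = -(q : ℂ) ^ 4 := rfl
  have c21 : (dataA q).c 2 1 = -((q : ℂ) ^ 4)⁻¹ := rfl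
  have t02 : ∀ y, (dataA q).tw {0, 2} y = (dataA q).tw {0} ((dataA q).tw {2} y) :=
    fun y => (dataA q).tw_union (S := {0}) (T := {2}) (by decide) y
  have t12 : ∀ y, (dataA q).tw {1, 2} y = (dataA q).tw {1} ((dataA q).tw {2} y) :=
    fun y => (dataA q).tw_union (S := {1}) (T := {2}) (by decide) y
  have t01 : ∀ y, (dataA q).tw {0, 1} y = (dataA q).tw {0} ((dataA q).tw {1} y) :=
    fun y => (dataA q).tw_union (S := {0}) (T := {1}) (by decide) y
  rw [tw_gen, map_smul, map_smul, dFun_gen]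
  fin_cases i <;> cases x <;>
  simp [SkewExt.basisOne, dGen_α, dGen_β, dGen_γ, dGen_δ, dE, ePlus, eMinus, eZero, mon_mul_mon_A,
    SkewExt.mon_mul_incl, SkewExt.incl_mul_mon, mul_add, add_mul, mul_sub, sub_mul, e10, e20, e21,
    w0, w1, w2, c10, c20, c21, t02, t12, t01, tw_gen, deg, smul_smul]
  all_goals match_scalars <;> field_simp <;> ring

/-- The Leibniz rule applied to both sides of `eᵢ a = θᵢ(a) eᵢ`. Both sides of this identity are
twisted derivations in `a`, so it extends from the generators to all of `A`. -/
theorem dFun_tw (i : Fin 3) (a : OqSL2 q) :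
    dFun q ((dataA q).tw {i} a) * SkewExt.basisOne (dataA q) i =
      dE q {i} * inclA q a - inclA q ((dataA q).tw {i} a) * dE q {i} -
        SkewExt.basisOne (dataA q) i * dFun q a := by
  have comm : ∀ b, SkewExt.basisOne (dataA q) i * inclA q b =
      inclA q ((dataA q).tw {i} b) * SkewExt.basisOne (dataA q) i := fun b => by
    rw [SkewExt.basisOne, SkewExt.mon_mul_incl, SkewExt.incl_mul_mon, one_mul, mul_one]
  induction a using OqSL2.induction with
  | smul_one c =>
    rw [AlgHom.commutes, AlgHom.commutes, dFun_algebraMap, Algebra.commutes]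
    simp
  | gen x => exact dFun_tw_gen q i x
  | add a b ha hb => simp only [map_add, add_mul, mul_add, ha, hb]; abel
  | mul a b ha hb =>
    simp only [map_mul, dFun_mul, add_mul, mul_assoc, hb]
    rw [← comm b, ← mul_assoc, ha]
    simp only [mul_add, mul_sub, sub_mul, mul_assoc]
    rw [← mul_assoc _ (inclA q a) (dFun q b), comm a]
    simp only [mul_assoc]
    abel

theorem dE_mul_basisOne (i j : Fin 3) : dE q {i} * SkewExt.basisOne (dataA q) j =
    SkewExt.basisOne (dataA q) i * dE q {j} := by
  have hq := q.ne_zero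
  have c10 : (dataA q).c 1 0 = -(q : ℂ) ^ 2 := rfl
  have c20 : (dataA q).c 2 0 = -(q : ℂ) ^ 4 := rfl
  have c21 : (dataA q).c 2 1 = -((q : ℂ) ^ 4)⁻¹ := rfl
  have e1 : ({1, 0, 2} : Finset (Fin 3)) = {0, 1, 2} := by decide
  have e2 : ({0, 2, 1} : Finset (Fin 3)) = {0, 1, 2} := by decide
  have e3 : ({1, 2, 0} : Finset (Fin 3)) = {0, 1, 2} := by decide
  fin_cases i <;> fin_cases j <;>
  simp [SkewExt.basisOne, dE, ePlus, eMinus, eZero, SkewExt.mon_mul_mon, SkewData.sg, c10, c20, c21,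
    Finset.union_insert, Finset.insert_union, e1, e2, e3, smul_smul]
  all_goals match_scalars <;> field_simp

theorem dA_basisOne_mul_mon_one (i : Fin 3) (S : Finset (Fin 3)) :
    dA q (SkewExt.basisOne (dataA q) i * SkewExt.mon (dataA q) S 1) =
      dE q {i} * SkewExt.mon (dataA q) S 1 - SkewExt.basisOne (dataA q) i * dE q S := by
  have hS := SkewExt.mon_mem_grade (dataA q) S 1
  have hi := SkewExt.basisOne_mem_grade (dataA q) i
  rcases Nat.lt_trichotomy S.card 1 with h | h | h
  · obtain rfl : S = ∅ := by simpa using h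
    have e : SkewExt.mon (dataA q) ∅ 1 = 1 := rfl
    rw [e, mul_one, mul_one, SkewExt.basisOne, dA_mon_one,
      dE_card q (by decide : (∅ : Finset (Fin 3)).card ≠ 1),
      mul_zero, sub_zero]
  · obtain ⟨j, rfl⟩ := Finset.card_eq_one.1 h
    have := dE_mul_basisOne q i j
    rw [SkewExt.basisOne] at this
    rw [this, SkewExt.basisOne, sub_self, mon_mul_mon_A]
    split_ifs with hij
    · rw [map_zero]
    all_goals rw [map_smul, map_one, mul_one, dA_mon_one, dE_card, smul_zero]
    all_goals rw [Finset.card_pair hij]; decide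
  · -- All three terms have degree at least four.
    have hbot : ∀ {x : FormsA q} {k : ℕ}, x ∈ gradeA q k → 3 < k → x = 0 := fun hx hk => by
      rwa [gradeA, SkewExt.grade_eq_bot _ hk, Submodule.mem_bot] at hx
    rw [dE_card q (by omega : S.card ≠ 1), mul_zero, sub_zero,
      hbot (dA_mem q _ _ (SetLike.mul_mem_graded hi hS)) (by omega),
      hbot (SetLike.mul_mem_graded (dE_mem q {i}) hS) (by simp; omega)]

theorem dA_basisOne_mul (i : Fin 3) (x : FormsA q) :
    dA q (SkewExt.basisOne (dataA q) i * x) =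
      dA q (SkewExt.basisOne (dataA q) i) * x - SkewExt.basisOne (dataA q) i * dA q x := by
  have comm : ∀ b, SkewExt.basisOne (dataA q) i * inclA q b =
      inclA q ((dataA q).tw {i} b) * SkewExt.basisOne (dataA q) i := fun b => by
    rw [SkewExt.basisOne, SkewExt.mon_mul_incl, SkewExt.incl_mul_mon, one_mul, mul_one]
  rw [← SkewExt.sum_mon_coeff _ x]
  simp only [Finset.mul_sum, map_sum, ← Finset.sum_sub_distrib]
  refine Finset.sum_congr rfl fun S _ => ?_
  have he : dA q (SkewExt.basisOne (dataA q) i) = dE q {i} := dA_mon_one q {i}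
  rw [SkewExt.mon_eq_incl_mul, ← mul_assoc, comm, mul_assoc, dA_incl_mul, dA_incl_mul, dA_mon_one,
    dA_basisOne_mul_mon_one, he, mul_add, ← mul_assoc, ← mul_assoc _ (inclA q _) (dE q S), comm,
    dFun_tw]
  noncomm_ring

theorem dA_leibniz : ∀ k, ∀ ω ∈ gradeA q k, ∀ η,
    dA q (ω * η) = dA q ω * η + (-1 : ℂ) ^ k • (ω * dA q η) :=
  SkewExt.leibniz_of_basisOne (fun r x => by rw [dA_incl_mul, dA_inclA]) (dA_basisOne_mul q)

theorem dA_dE (S : Finset (Fin 3)) : dA q (dE q S) = 0 := by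
  have h : ∀ i j, i ≠ j → dA q (SkewExt.mon (dataA q) {i} 1 * SkewExt.mon (dataA q) {j} 1) = 0 :=
    fun i j hij => by
      rw [mon_mul_mon_A, if_neg hij, map_smul, map_one, mul_one, dA_mon_one, dE_card, smul_zero]
      rw [Finset.card_pair hij]; decide
  simp only [dE, ePlus, eMinus, eZero]
  split_ifs
  · rw [map_smul, h 0 2 (by decide), smul_zero]
  · rw [map_smul, h 1 2 (by decide), smul_zero]
  · rw [map_smul, h 0 1 (by decide), smul_zero]
  · rw [map_zero]

theorem dA_dGen (x : Gen) : dA q (dGen q x) = 0 := by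
  have hq := q.ne_zero
  have e10 : ({1, 0} : Finset (Fin 3)) = {0, 1} := by decide
  have e20 : ({2, 0} : Finset (Fin 3)) = {0, 2} := by decide
  have e21 : ({2, 1} : Finset (Fin 3)) = {1, 2} := by decide
  have c10 : (dataA q).c 1 0 = -(q : ℂ) ^ 2 := rfl
  have c20 : (dataA q).c 2 0 = -(q : ℂ) ^ 4 := rfl
  have c21 : (dataA q).c 2 1 = -((q : ℂ) ^ 4)⁻¹ := rfl
  cases x <;>
  simp [dGen_α, dGen_β, dGen_γ, dGen_δ, dA_mon, dFun_gen, dE, ePlus, eMinus, eZero, mon_mul_mon_A,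
    SkewExt.incl_mul_mon, add_mul, sub_mul, e10, e20, e21, c10, c20, c21, smul_smul]
  all_goals match_scalars <;> field_simp <;> ring

theorem dA_dFun (a : OqSL2 q) : dA q (dFun q a) = 0 := by
  induction a using OqSL2.induction with
  | smul_one c => rw [dFun_algebraMap, map_zero]
  | gen x => rw [dFun_gen, dA_dGen]
  | add a b ha hb => rw [map_add, map_add, ha, hb, add_zero]
  | mul a b ha hb =>
    rw [dFun_mul, map_add, dA_incl_mul, dA_leibniz q 1 _ (dFun_mem q a), ha, hb, dA_inclA]
    simp

theorem dA_dA (ω : FormsA q) : dA q (dA q ω) = 0 := by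
  rw [← SkewExt.sum_mon_coeff _ ω]
  simp only [map_sum]
  refine Finset.sum_eq_zero fun S _ => ?_
  rw [SkewExt.mon_eq_incl_mul, dA_incl_mul, map_add, dA_incl_mul, dA_mon_one,
    dA_leibniz q 1 _ (dFun_mem q _), dA_dFun, dA_mon_one, dA_dE]
  simp

theorem isDGA_A : IsDGA (gradeA q) (dA q) where
  degree := dA_mem q
  sq_zero := dA_dA q
  leibniz := dA_leibniz q

theorem isDifferentialCalculus_A : IsDifferentialCalculus (inclA q) (gradeA q) (dA q) := by
  refine SkewExt.isDifferentialCalculus (isDGA_A q) fun i => ?_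
  have h : ∀ a b, inclA q a * dA q (inclA q b) ∈
      formSpan (dA q) (Set.range (inclA q)) 1 := fun a b =>
    Submodule.subset_span ⟨_, ⟨a, rfl⟩, fun _ => inclA q b, fun _ => ⟨b, rfl⟩, by simp⟩
  fin_cases i
  · change ePlus q ∈ _
    rw [ePlus_eq]
    exact sub_mem (Submodule.smul_mem _ _ (h _ _)) (Submodule.smul_mem _ _ (h _ _))
  · change eMinus q ∈ _
    rw [eMinus_eq]
    exact sub_mem (h _ _) (Submodule.smul_mem _ _ (h _ _))
  · change eZero q ∈ _
    rw [eZero_eq]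
    exact sub_mem (h _ _) (Submodule.smul_mem _ _ (h _ _))

end CalculusA

/-! ### Graded tensor products of differential graded algebras -/

section GradedTensor
variable {Ω Ω' : Type} [Ring Ω] [Algebra ℂ Ω] [Ring Ω'] [Algebra ℂ Ω']
  {𝒜 : ℕ → Submodule ℂ Ω} [GradedAlgebra 𝒜] {ℬ : ℕ → Submodule ℂ Ω'} [GradedAlgebra ℬ]

open GradedTensorProduct

theorem induction_homogeneous {p : Ω → Prop} (h : ∀ k, ∀ ω ∈ 𝒜 k, p ω)
    (hadd : ∀ x y, p x → p y → p (x + y)) (x : Ω) : p x :=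
  DirectSum.Decomposition.inductionOn 𝒜 (h 0 0 (zero_mem _)) (fun m => h _ _ m.2) hadd x

theorem tmul_mul_tmul {i j : ℕ} (x : Ω) {y : Ω'} {z : Ω} (w : Ω') (hy : y ∈ ℬ j) (hz : z ∈ 𝒜 i) :
    (x ᵍ⊗ₜ[ℂ] y * z ᵍ⊗ₜ[ℂ] w : 𝒜 ᵍ⊗[ℂ] ℬ) = (-1 : ℂ) ^ (j * i) • ((x * z) ᵍ⊗ₜ[ℂ] (y * w)) := by
  have h := tmul_coe_mul_coe_tmul (R := ℂ) 𝒜 ℬ x ⟨y, hy⟩ ⟨z, hz⟩ w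
  refine h.trans ?_
  rcases Nat.even_or_odd (j * i) with hp | hp
  · rw [hp.neg_one_pow, hp.neg_one_pow, one_smul, one_smul]
  · rw [hp.neg_one_pow, hp.neg_one_pow, neg_smul, one_smul, Units.neg_smul, one_smul]

/-- No sign appears when the inner left factor has degree zero. -/
theorem tmul_mul_tmul_of_mem_zero (x : Ω) {y : Ω'} (z : Ω) (w : Ω') (hy : y ∈ ℬ 0) :
    (x ᵍ⊗ₜ[ℂ] y * z ᵍ⊗ₜ[ℂ] w : 𝒜 ᵍ⊗[ℂ] ℬ) = (x * z) ᵍ⊗ₜ[ℂ] (y * w) := by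
  induction z using induction_homogeneous (𝒜 := 𝒜) with
  | h k z hz => rw [tmul_mul_tmul x w hy hz]; simp
  | hadd z z' hz hz' =>
    simp only [tmul, TensorProduct.add_tmul, map_add, mul_add] at hz hz' ⊢
    rw [hz, hz']

theorem signOp_apply {k : ℕ} {ω : Ω} (h : ω ∈ 𝒜 k) : signOp 𝒜 ω = (-1 : ℂ) ^ k • ω := by
  lift ω to 𝒜 k using h
  simp [signOp]

theorem tensorD_tmul (d : Ω →ₗ[ℂ] Ω) (d' : Ω' →ₗ[ℂ] Ω') (x : Ω) (y : Ω') :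
    tensorD 𝒜 ℬ d d' (x ᵍ⊗ₜ[ℂ] y) = d x ᵍ⊗ₜ[ℂ] y + signOp 𝒜 x ᵍ⊗ₜ[ℂ] d' y := rfl

theorem gradedTensor_induction {p : 𝒜 ᵍ⊗[ℂ] ℬ → Prop} (h : ∀ x y, p (x ᵍ⊗ₜ[ℂ] y))
    (hadd : ∀ x y, p x → p y → p (x + y)) (z : 𝒜 ᵍ⊗[ℂ] ℬ) : p z :=
  TensorProduct.induction_on (motive := fun z : Ω ⊗[ℂ] Ω' => p (of ℂ 𝒜 ℬ z)) z
    (by simpa [tmul] using h 0 0) h fun x y hx hy => by rw [map_add]; exact hadd _ _ hx hy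

theorem tensorD_tensorD {d : Ω →ₗ[ℂ] Ω} {d' : Ω' →ₗ[ℂ] Ω'} (hd : IsDGA 𝒜 d) (hd' : IsDGA ℬ d')
    (z : 𝒜 ᵍ⊗[ℂ] ℬ) : tensorD 𝒜 ℬ d d' (tensorD 𝒜 ℬ d d' z) = 0 := by
  induction z using gradedTensor_induction with
  | hadd x y hx hy => rw [map_add, map_add, hx, hy, add_zero]
  | h x y =>
    induction x using induction_homogeneous (𝒜 := 𝒜) with
    | hadd x x' hx hx' =>
      simp only [tmul, TensorProduct.add_tmul, map_add] at hx hx' ⊢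
      rw [hx, hx', add_zero]
    | h k x hx =>
      rw [tensorD_tmul, map_add, tensorD_tmul, tensorD_tmul, signOp_apply hx, map_smul, map_smul,
        signOp_apply hx, signOp_apply (hd.degree k x hx), hd.sq_zero, hd'.sq_zero, pow_succ]
      simp only [tmul, TensorProduct.zero_tmul, TensorProduct.tmul_zero, ← TensorProduct.smul_tmul',
        map_smul, map_zero]
      simp

theorem tensorD_tmul_mul {d : Ω →ₗ[ℂ] Ω} {d' : Ω' →ₗ[ℂ] Ω'} (hd : IsDGA 𝒜 d) (hd' : IsDGA ℬ d')
    {a : Ω} {h : Ω'} (ha : a ∈ 𝒜 0) (hh : h ∈ ℬ 0) (z : 𝒜 ᵍ⊗[ℂ] ℬ) :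
    tensorD 𝒜 ℬ d d' (a ᵍ⊗ₜ[ℂ] h * z) =
      tensorD 𝒜 ℬ d d' (a ᵍ⊗ₜ[ℂ] h) * z + a ᵍ⊗ₜ[ℂ] h * tensorD 𝒜 ℬ d d' z := by
  induction z using gradedTensor_induction with
  | hadd x y hx hy => simp only [map_add, mul_add, hx, hy]; abel
  | h x y =>
    induction x using induction_homogeneous (𝒜 := 𝒜) with
    | hadd x x' hx hx' =>
      simp only [tmul, TensorProduct.add_tmul, map_add, mul_add] at hx hx' ⊢
      rw [hx, hx']; abel
    | h k x hx =>
      have hax : a * x ∈ 𝒜 k := by simpa using SetLike.mul_mem_graded ha hx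
      rw [tmul_mul_tmul_of_mem_zero _ _ _ hh, tensorD_tmul, tensorD_tmul, tensorD_tmul,
        signOp_apply ha, signOp_apply hx, signOp_apply hax, hd.leibniz 0 a ha, hd'.leibniz 0 h hh,
        add_mul, mul_add, tmul_mul_tmul_of_mem_zero _ _ _ hh, tmul_mul_tmul_of_mem_zero _ _ _ hh,
        tmul_mul_tmul_of_mem_zero _ _ _ hh, tmul_mul_tmul _ _ (hd'.degree 0 h hh) hx]
      simp only [tmul, TensorProduct.add_tmul, TensorProduct.tmul_add, ← TensorProduct.smul_tmul',
        map_smul, map_add, pow_zero, one_smul, zero_add, one_mul, mul_smul_comm]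
      abel

theorem tmul_mem_tensorGrade {i j : ℕ} {x : Ω} {y : Ω'} (hx : x ∈ 𝒜 i) (hy : y ∈ ℬ j) :
    x ᵍ⊗ₜ[ℂ] y ∈ tensorGrade 𝒜 ℬ (i + j) := by
  refine Submodule.mem_iSup_of_mem (i, j) (Submodule.mem_iSup_of_mem (by simp) ?_)
  exact ⟨x ⊗ₜ y, ⟨(⟨x, hx⟩ : 𝒜 i) ⊗ₜ (⟨y, hy⟩ : ℬ j), rfl⟩, rfl⟩

variable {A H : Type} [Ring A] [Algebra ℂ A] [Ring H] [Algebra ℂ H]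

variable (𝒜 ℬ) in
/-- The inclusion of `A ⊗ H` as the elements of degree `(0, 0)` of the graded tensor product. -/
def inclTensor (ι : A →ₐ[ℂ] Ω) (ι' : H →ₐ[ℂ] Ω') (hι' : ∀ h, ι' h ∈ ℬ 0) :
    A ⊗[ℂ] H →ₐ[ℂ] 𝒜 ᵍ⊗[ℂ] ℬ :=
  Algebra.TensorProduct.algHomOfLinearMapTensorProduct
    ((of ℂ 𝒜 ℬ).toLinearMap ∘ₗ TensorProduct.map ι.toLinearMap ι'.toLinearMap)
    (fun a a' h h' => by
      have := tmul_mul_tmul_of_mem_zero (𝒜 := 𝒜) (ι a) (ι a') (ι' h') (hι' h)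
      rw [← map_mul ι, ← map_mul ι'] at this
      exact this.symm)
    (by
      change of ℂ 𝒜 ℬ (ι 1 ⊗ₜ ι' 1) = 1
      rw [map_one, map_one]
      rfl)

theorem inclTensor_mul_tmul (ι : A →ₐ[ℂ] Ω) (ι' : H →ₐ[ℂ] Ω') (hι' : ∀ h, ι' h ∈ ℬ 0)
    (z : A ⊗[ℂ] H) (x : Ω) (y : Ω') : inclTensor 𝒜 ℬ ι ι' hι' z * x ᵍ⊗ₜ[ℂ] y =
      of ℂ 𝒜 ℬ (TensorProduct.map (LinearMap.mulRight ℂ x ∘ₗ ι.toLinearMap)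
        (LinearMap.mulRight ℂ y ∘ₗ ι'.toLinearMap) z) := by
  induction z using TensorProduct.induction_on with
  | zero => simp
  | add z z' hz hz' => simp only [map_add, add_mul, hz, hz']
  | tmul a h => exact tmul_mul_tmul_of_mem_zero _ _ _ (hι' h)

theorem tensorD_inclTensor_mul {d : Ω →ₗ[ℂ] Ω} {d' : Ω' →ₗ[ℂ] Ω'} (hd : IsDGA 𝒜 d)
    (hd' : IsDGA ℬ d') (ι : A →ₐ[ℂ] Ω) (ι' : H →ₐ[ℂ] Ω') (hι : ∀ a, ι a ∈ 𝒜 0)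
    (hι' : ∀ h, ι' h ∈ ℬ 0) (z : A ⊗[ℂ] H) (y : 𝒜 ᵍ⊗[ℂ] ℬ) :
    tensorD 𝒜 ℬ d d' (inclTensor 𝒜 ℬ ι ι' hι' z * y) =
      tensorD 𝒜 ℬ d d' (inclTensor 𝒜 ℬ ι ι' hι' z) * y +
        inclTensor 𝒜 ℬ ι ι' hι' z * tensorD 𝒜 ℬ d d' y := by
  induction z using TensorProduct.induction_on with
  | zero => simp
  | add z z' hz hz' => simp only [map_add, add_mul, hz, hz']; abel
  | tmul a h => exact tensorD_tmul_mul hd hd' (hι a) (hι' h) y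

end GradedTensor

/-! ### Morphisms of differential calculi are determined in degree zero -/

section Generated
variable {A C Ω : Type} [Ring A] [Algebra ℂ A] [Ring C] [Algebra ℂ C] [Ring Ω] [Algebra ℂ Ω]

/-- If `D` squares to zero and satisfies the Leibniz rule in degree zero, products of exact forms
`D (f a)` are closed. -/
theorem closed_prod {D : C →ₗ[ℂ] C} (f : A →ₐ[ℂ] C) (hD : ∀ x, D (D x) = 0)
    (hL : ∀ a y, D (f a * y) = D (f a) * y + f a * D y) {k : ℕ} (a : Fin k → A) :
    D (List.ofFn fun i => D (f (a i))).prod = 0 := by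
  induction k with
  | zero =>
    have h := hL 1 1
    rw [map_one, one_mul, one_mul, mul_one] at h
    simpa using h
  | succ k ih =>
    rw [List.ofFn_succ, List.prod_cons, eq_sub_of_add_eq (hL (a 0) _).symm, ih]
    rw [mul_zero, sub_zero, hD]

/-- A morphism of algebras out of a differential calculus that commutes with the differentials in
degree zero commutes with them in all degrees. -/
theorem comm_d_of_degree_zero {ι : A →ₐ[ℂ] Ω} {𝒜 : ℕ → Submodule ℂ Ω} [GradedAlgebra 𝒜]
    {d : Ω →ₗ[ℂ] Ω} (hd : IsDifferentialCalculus ι 𝒜 d) (Δ : Ω →ₐ[ℂ] C) {D : C →ₗ[ℂ] C}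
    (hD : ∀ x, D (D x) = 0) (hL : ∀ a y, D (Δ (ι a) * y) = D (Δ (ι a)) * y + Δ (ι a) * D y)
    (h : ∀ a, Δ (d (ι a)) = D (Δ (ι a))) (ω : Ω) : Δ (d ω) = D (Δ ω) := by
  have hι : ∀ a, ι a ∈ 𝒜 0 := fun a => hd.range_eq ▸ ⟨a, rfl⟩
  have hL' : ∀ a y, d (ι a * y) = d (ι a) * y + ι a * d y := fun a y => by
    simpa using hd.isDGA.leibniz 0 _ (hι a) y
  induction ω using induction_homogeneous (𝒜 := 𝒜) with
  | hadd x y hx hy => simp only [map_add, hx, hy]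
  | h k ω hω =>
    rw [hd.generated] at hω
    induction hω using Submodule.span_induction with
    | zero => simp
    | add x y _ _ hx hy => simp only [map_add, hx, hy]
    | smul c x _ hx => simp only [map_smul, hx]
    | mem x hx =>
      obtain ⟨_, ⟨a₀, rfl⟩, b, hb, rfl⟩ := hx
      choose a ha using hb
      obtain rfl : b = fun i => ι (a i) := funext fun i => (ha i).symm
      have e1 := closed_prod ι hd.isDGA.sq_zero hL' a
      have e2 := closed_prod (Δ.comp ι) hD hL a
      have e3 : Δ (List.ofFn fun i => d (ι (a i))).prod =
          (List.ofFn fun i => D ((Δ.comp ι) (a i))).prod := by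
        rw [map_list_prod, List.map_ofFn]
        congr 2
        funext i
        exact h (a i)
      rw [hL', e1, map_mul, hL, mul_zero, add_zero, map_mul, h, e3, e2, mul_zero, add_zero]

end Generated

/-! ### The coaction on forms -/

section Coaction
variable (q : ℂˣ)

open GradedTensorProduct

theorem inclH_mem (f : ℂ[T;T⁻¹]) : inclH q f ∈ gradeH q 0 := SkewExt.incl_mem_grade _ f

theorem tinvdt_mem_grade : tinvdt q ∈ gradeH q 1 := (tinvdt_mem q).2

/-- The weights of `e⁺, e⁻, e⁰` under the coaction. -/
def wt : Fin 3 → ℤ := ![2, -2, 0]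

/-- The images of `e⁺, e⁻, e⁰` under the coaction on forms: `e⁺ ⊗ t²`, `e⁻ ⊗ t⁻²` and
`e⁰ ⊗ 1 + 1 ⊗ t⁻¹ dt`. -/
def coactBasis (i : Fin 3) : gradeA q ᵍ⊗[ℂ] gradeH q :=
  SkewExt.basisOne (dataA q) i ᵍ⊗ₜ[ℂ] inclH q (LaurentPolynomial.T (wt i)) +
    if i = 2 then 1 ᵍ⊗ₜ[ℂ] tinvdt q else 0

theorem coactBasis_zero : coactBasis q 0 = ePlus q ᵍ⊗ₜ[ℂ] inclH q (LaurentPolynomial.T 2) :=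
  add_zero _

theorem coactBasis_one : coactBasis q 1 = eMinus q ᵍ⊗ₜ[ℂ] inclH q (LaurentPolynomial.T (-2)) :=
  add_zero _

theorem coactBasis_two : coactBasis q 2 =
    eZero q ᵍ⊗ₜ[ℂ] inclH q (LaurentPolynomial.T 0) + 1 ᵍ⊗ₜ[ℂ] tinvdt q := rfl

/-- The coaction on `A` with values in the forms of degree `(0, 0)`. -/
def coactIncl : OqSL2 q →ₐ[ℂ] gradeA q ᵍ⊗[ℂ] gradeH q :=
  (inclTensor (gradeA q) (gradeH q) (inclA q) (inclH q) (inclH_mem q)).comp (coact q)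

theorem coactIncl_gen (x : Gen) : coactIncl q (gen q x) =
    inclA q (gen q x) ᵍ⊗ₜ[ℂ] inclH q (LaurentPolynomial.T (deg x)) := by
  rw [coactIncl, AlgHom.comp_apply, coact_gen]
  rfl

theorem tinvdt_mul (n : ℤ) : tinvdt q * inclH q (LaurentPolynomial.T n) =
    (((q ^ 2) ^ n : ℂˣ) : ℂ) • (inclH q (LaurentPolynomial.T n) * tinvdt q) := by
  rw [tinvdt_eq, SkewExt.mon_mul_incl, SkewExt.incl_mul_mon, tw_H, scaleH_T, mul_smul_comm,
    map_smul, mul_comm]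

theorem tinvdt_mul_self : tinvdt q * tinvdt q = 0 := by
  rw [tinvdt_eq, SkewExt.mon_mul_mon]; simp

theorem inclH_T_mul (m n : ℤ) :
    inclH q (LaurentPolynomial.T m) * inclH q (LaurentPolynomial.T n) =
      inclH q (LaurentPolynomial.T (m + n)) := by
  rw [← map_mul, LaurentPolynomial.T_add]

theorem inclH_T_zero : inclH q (LaurentPolynomial.T 0) = 1 := by
  rw [LaurentPolynomial.T_zero, map_one]

theorem coactBasis_mul_coactIncl (i : Fin 3) (r : OqSL2 q) :
    coactBasis q i * coactIncl q r = coactIncl q ((dataA q).tw {i} r) * coactBasis q i := by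
  induction r using OqSL2.induction with
  | smul_one c => simp only [AlgHom.commutes, Algebra.commutes]
  | add a b ha hb => simp only [map_add, mul_add, add_mul, ha, hb]
  | mul a b ha hb => simp only [map_mul, ← mul_assoc, ha]; simp only [mul_assoc, hb]
  | gen x =>
    have hx : inclA q (gen q x) ∈ gradeA q 0 := SkewExt.incl_mem_grade _ _
    have e1 : ∀ y : FormsA q, y ᵍ⊗ₜ[ℂ] inclH q (LaurentPolynomial.T (wt i)) *
        coactIncl q (gen q x) = (y * inclA q (gen q x)) ᵍ⊗ₜ[ℂ]
          inclH q (LaurentPolynomial.T (wt i + deg x)) := fun y => by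
      rw [coactIncl_gen, tmul_mul_tmul_of_mem_zero _ _ _ (inclH_mem q _), inclH_T_mul]
    have e2 : ∀ y : FormsA q, coactIncl q (gen q x) *
        y ᵍ⊗ₜ[ℂ] inclH q (LaurentPolynomial.T (wt i)) = (inclA q (gen q x) * y) ᵍ⊗ₜ[ℂ]
          inclH q (LaurentPolynomial.T (wt i + deg x)) := fun y => by
      rw [coactIncl_gen, tmul_mul_tmul_of_mem_zero _ _ _ (inclH_mem q _), inclH_T_mul, add_comm]
    have e3 : (1 ᵍ⊗ₜ[ℂ] tinvdt q : gradeA q ᵍ⊗[ℂ] gradeH q) * coactIncl q (gen q x) =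
        (((q ^ 2) ^ deg x : ℂˣ) : ℂ) • (coactIncl q (gen q x) * 1 ᵍ⊗ₜ[ℂ] tinvdt q) := by
      rw [coactIncl_gen, tmul_mul_tmul _ _ (tinvdt_mem_grade q) hx,
        tmul_mul_tmul_of_mem_zero _ _ _ (inclH_mem q _), tinvdt_mul, one_mul, mul_one]
      simp [tmul]
    have e4 : SkewExt.basisOne (dataA q) i * inclA q (gen q x) =
        ((q ^ deg x : ℂˣ) : ℂ) ^ (dataA q).w i •
          (inclA q (gen q x) * SkewExt.basisOne (dataA q) i) := by
      rw [SkewExt.basisOne, SkewExt.mon_mul_incl, SkewExt.incl_mul_mon, tw_gen, one_mul, mul_one,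
        map_smul]
    rw [tw_gen, map_smul, coactBasis, add_mul, mul_add, e1, smul_mul_assoc, smul_mul_assoc, e2, e4]
    refine congrArg₂ (· + ·) ?_ ?_
    · rw [tmul, ← TensorProduct.smul_tmul', map_smul]
    · split_ifs with hi
      · subst hi
        rw [e3]
        congr 1
        have : (dataA q).w 2 = 2 := rfl
        rw [this]
        push_cast
        rw [← zpow_natCast, ← zpow_natCast, ← zpow_mul, ← zpow_mul, mul_comm]
      · simp

theorem coactBasis_mul_coactBasis (i j : Fin 3) (hij : j < i) :
    coactBasis q i * coactBasis q j = (dataA q).c i j • (coactBasis q j * coactBasis q i) := by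
  have hp : ePlus q ∈ gradeA q 1 := SkewExt.basisOne_mem_grade (dataA q) 0
  have hm : eMinus q ∈ gradeA q 1 := SkewExt.basisOne_mem_grade (dataA q) 1
  have hτ := tinvdt_mem_grade q
  have c10 : (dataA q).c 1 0 = -(q : ℂ) ^ 2 := rfl
  have c20 : (dataA q).c 2 0 = -(q : ℂ) ^ 4 := rfl
  have c21 : (dataA q).c 2 1 = -((q : ℂ) ^ 4)⁻¹ := rfl
  have h2 : (((q ^ 2) ^ (2 : ℤ) : ℂˣ) : ℂ) = (q : ℂ) ^ 4 := by
    push_cast; rw [zpow_ofNat, ← pow_mul]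
  have h2' : (((q ^ 2) ^ (-2 : ℤ) : ℂˣ) : ℂ) = ((q : ℂ) ^ 4)⁻¹ := by
    rw [zpow_neg, Units.val_inv_eq_inv_val, h2]
  obtain ⟨rfl, rfl⟩ | ⟨rfl, rfl⟩ | ⟨rfl, rfl⟩ :
      (i = 1 ∧ j = 0) ∨ (i = 2 ∧ j = 0) ∨ (i = 2 ∧ j = 1) := by revert i j; decide
  all_goals
    simp only [coactBasis_zero, coactBasis_one, coactBasis_two, add_mul, mul_add,
      tmul_mul_tmul_of_mem_zero _ _ _ (inclH_mem q _), tmul_mul_tmul _ _ hτ hp,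
      tmul_mul_tmul _ _ hτ hm, inclH_T_mul, tinvdt_mul, wedge_mm, wedge_zp, wedge_zm, c10, c20, c21,
      h2, h2', tmul, ← TensorProduct.smul_tmul', TensorProduct.tmul_smul, map_smul, smul_add,
      smul_smul]
    norm_num

theorem coactBasis_mul_self (i : Fin 3) : coactBasis q i * coactBasis q i = 0 := by
  obtain ⟨hp, hm, hz⟩ := wedge_self q
  have h0 : eZero q ∈ gradeA q 1 := SkewExt.basisOne_mem_grade (dataA q) 2
  have h1 : (1 : FormsA q) ∈ gradeA q 0 := SetLike.one_mem_graded (gradeA q)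
  have hτ := tinvdt_mem_grade q
  obtain rfl | rfl | rfl : i = 0 ∨ i = 1 ∨ i = 2 := by revert i; decide
  · rw [coactBasis_zero, tmul_mul_tmul_of_mem_zero _ _ _ (inclH_mem q _), hp]
    simp [tmul]
  · rw [coactBasis_one, tmul_mul_tmul_of_mem_zero _ _ _ (inclH_mem q _), hm]
    simp [tmul]
  · rw [coactBasis_two, add_mul, mul_add, mul_add, tmul_mul_tmul_of_mem_zero _ _ _ (inclH_mem q _),
      tmul_mul_tmul_of_mem_zero _ _ _ (inclH_mem q _), tmul_mul_tmul _ _ hτ h0,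
      tmul_mul_tmul _ _ hτ h1, hz, tinvdt_mul_self, inclH_T_zero]
    simp [tmul]

/-- The coaction on forms. -/
def coactForms : FormsA q →ₐ[ℂ] gradeA q ᵍ⊗[ℂ] gradeH q :=
  SkewExt.lift (coactIncl q) (coactBasis q) (coactBasis_mul_coactIncl q)
    (coactBasis_mul_coactBasis q) (coactBasis_mul_self q)

theorem coactForms_mon (S : Finset (Fin 3)) (r : OqSL2 q) :
    coactForms q (SkewExt.mon (dataA q) S r) =
      coactIncl q r * SkewExt.wedge (coactBasis q) S := SkewExt.liftLinear_mon _ _ S r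

theorem wedge_coactBasis (S : Finset (Fin 3)) : SkewExt.wedge (coactBasis q) S =
    SkewExt.mon (dataA q) S 1 ᵍ⊗ₜ[ℂ] inclH q (LaurentPolynomial.T (∑ i ∈ S, wt i)) +
      if 2 ∈ S then SkewExt.mon (dataA q) (S.erase 2) 1 ᵍ⊗ₜ[ℂ]
        (inclH q (LaurentPolynomial.T (∑ i ∈ S, wt i)) * tinvdt q) else 0 := by
  induction S using Finset.induction_on_min with
  | empty =>
    simp only [SkewExt.wedge_empty, Finset.sum_empty, inclH_T_zero, Finset.notMem_empty, if_false,
      add_zero]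
    rfl
  | insert i S h ih =>
    have hi : i ∉ S := fun hi => (h i hi).false
    rw [SkewExt.wedge_insert _ h, ih, Finset.sum_insert hi, SkewExt.mon_insert _ h]
    by_cases h2 : i = 2
    · subst h2
      obtain rfl : S = ∅ := Finset.eq_empty_of_forall_notMem fun j hj => by
        have := h j hj; omega
      have e : SkewExt.mon (dataA q) ∅ 1 = 1 := rfl
      have w2 : wt 2 = 0 := rfl
      simp only [coactBasis, if_true, Finset.sum_empty, inclH_T_zero, e, mul_one, add_zero,
        Finset.notMem_empty, if_false, insert_empty_eq, Finset.mem_singleton, w2, one_mul,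
        Finset.erase_singleton]
      exact mul_one _
    · have h2' : (2 : Fin 3) ∈ insert i S ↔ 2 ∈ S := by simp [Ne.symm h2]
      simp only [h2']
      rw [coactBasis, if_neg h2, add_zero, mul_add, tmul_mul_tmul_of_mem_zero _ _ _ (inclH_mem q _),
        inclH_T_mul]
      congr 1
      split_ifs with hS
      · rw [tmul_mul_tmul_of_mem_zero _ _ _ (inclH_mem q _), ← mul_assoc, inclH_T_mul,
          Finset.erase_insert_of_ne h2, SkewExt.mon_insert _
            (fun j hj => h j (Finset.mem_of_mem_erase hj))]
      · rw [mul_zero]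

/-- The coaction on forms in coordinates: `e_S` has weight `∑ i ∈ S, wt i`, and a factor `e⁰`, which
comes last in `e_S`, contributes a second term in which it is replaced by `t⁻¹ dt`. -/
theorem coactForms_mon_eq (S : Finset (Fin 3)) (r : OqSL2 q) :
    coactForms q (SkewExt.mon (dataA q) S r) =
      of ℂ (gradeA q) (gradeH q) (TensorProduct.map (SkewExt.mon (dataA q) S)
        (SkewExt.mon (dataH q) ∅ ∘ₗ LinearMap.mulRight ℂ (LaurentPolynomial.T (∑ i ∈ S, wt i)))
          (coact q r)) +
      if 2 ∈ S then of ℂ (gradeA q) (gradeH q)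
        (TensorProduct.map (SkewExt.mon (dataA q) (S.erase 2)) (SkewExt.mon (dataH q) {0} ∘ₗ
          LinearMap.mulRight ℂ (LaurentPolynomial.T (∑ i ∈ S, wt i - 1))) (coact q r)) else 0 := by
  have hA : ∀ S : Finset (Fin 3), LinearMap.mulRight ℂ (SkewExt.mon (dataA q) S 1) ∘ₗ
      (inclA q).toLinearMap = SkewExt.mon (dataA q) S := fun S => by
    refine LinearMap.ext fun r => ?_
    simp [SkewExt.incl_mul_mon]
  have hH0 : ∀ n, LinearMap.mulRight ℂ (inclH q (LaurentPolynomial.T n)) ∘ₗ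
      (inclH q).toLinearMap =
        SkewExt.mon (dataH q) ∅ ∘ₗ LinearMap.mulRight ℂ (LaurentPolynomial.T n) := fun n => by
    refine LinearMap.ext fun r => ?_
    exact (map_mul (inclH q) _ _).symm
  have hH1 : ∀ n, LinearMap.mulRight ℂ (inclH q (LaurentPolynomial.T n) * tinvdt q) ∘ₗ
      (inclH q).toLinearMap =
        SkewExt.mon (dataH q) {0} ∘ₗ LinearMap.mulRight ℂ (LaurentPolynomial.T (n - 1)) :=
      fun n => by
    refine LinearMap.ext fun r => ?_
    simp only [LinearMap.comp_apply, LinearMap.mulRight_apply, AlgHom.toLinearMap_apply]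
    rw [tinvdt_eq, SkewExt.incl_mul_mon, SkewExt.incl_mul_mon, ← LaurentPolynomial.T_add]
    rfl
  rw [coactForms_mon, wedge_coactBasis, mul_add, coactIncl, AlgHom.comp_apply, inclTensor_mul_tmul,
    hA, hH0]
  congr 1
  split_ifs
  · rw [inclTensor_mul_tmul, hA, hH1]
  · rw [mul_zero]

theorem coactForms_incl (r : OqSL2 q) : coactForms q (inclA q r) = coactIncl q r :=
  (coactForms_mon q ∅ r).trans (by simp)

theorem coactForms_basisOne (i : Fin 3) :
    coactForms q (SkewExt.basisOne (dataA q) i) = coactBasis q i :=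
  (coactForms_mon q {i} 1).trans (by simp)

end Coaction

/-! ### Existence and uniqueness of the extension of the coaction -/

section Complete
variable (q : ℂˣ)

open GradedTensorProduct

/-- The differential of the tensor product `Ω(A) ⊗ Ω(H)`. -/
abbrev dAH : gradeA q ᵍ⊗[ℂ] gradeH q →ₗ[ℂ] gradeA q ᵍ⊗[ℂ] gradeH q :=
  tensorD (gradeA q) (gradeH q) (dA q) (dH q)

/-- The quantum integer `(q²ⁿ - 1) / (q² - 1)`, for which `d(tⁿ) = [n] tⁿ (t⁻¹ dt)`. -/
def qInt (n : ℤ) : ℂ := (((q : ℂ) ^ 2) ^ n - 1) / ((q : ℂ) ^ 2 - 1)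

theorem qInt_one (hq : (q : ℂ) ^ 2 ≠ 1) : qInt q 1 = 1 := by
  rw [qInt, zpow_one, div_self (sub_ne_zero.2 hq)]

theorem qInt_neg_one (hq : (q : ℂ) ^ 2 ≠ 1) : qInt q (-1) = -((q : ℂ) ^ 2)⁻¹ := by
  have h0 := q.ne_zero
  have := sub_ne_zero.2 hq
  rw [qInt, zpow_neg_one]
  field_simp
  ring

theorem dH_inclH_T (n : ℤ) : dH q (inclH q (LaurentPolynomial.T n)) =
    qInt q n • (inclH q (LaurentPolynomial.T n) * tinvdt q) := by
  rw [dH_inclH, qDeriv_T, tinvdt_eq, SkewExt.incl_mul_mon, ← LaurentPolynomial.T_add, map_smul]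
  rfl

theorem dAH_coactIncl_gen (x : Gen) : dAH q (coactIncl q (gen q x)) =
    dGen q x ᵍ⊗ₜ[ℂ] inclH q (LaurentPolynomial.T (deg x)) +
      qInt q (deg x) • (inclA q (gen q x) ᵍ⊗ₜ[ℂ]
        (inclH q (LaurentPolynomial.T (deg x)) * tinvdt q)) := by
  rw [coactIncl_gen, dAH, tensorD_tmul, dA_gen, signOp_apply (SkewExt.incl_mem_grade _ _),
    dH_inclH_T, pow_zero, one_smul, tmul, tmul, TensorProduct.tmul_smul, map_smul]

theorem dAH_dAH (z : gradeA q ᵍ⊗[ℂ] gradeH q) : dAH q (dAH q z) = 0 :=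
  tensorD_tensorD (isDGA_A q) (isDGA_H q) z

theorem dAH_coactIncl_mul (a : OqSL2 q) (y : gradeA q ᵍ⊗[ℂ] gradeH q) :
    dAH q (coactIncl q a * y) = dAH q (coactIncl q a) * y + coactIncl q a * dAH q y :=
  tensorD_inclTensor_mul (isDGA_A q) (isDGA_H q) (inclA q) (inclH q)
    (SkewExt.incl_mem_grade _) (inclH_mem q) (coact q a) y

theorem coactForms_dGen (hq : (q : ℂ) ^ 2 ≠ 1) (x : Gen) :
    coactForms q (dGen q x) = dAH q (coactIncl q (gen q x)) := by
  have e0 : coactForms q (ePlus q) = coactBasis q 0 := coactForms_basisOne q 0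
  have e1 : coactForms q (eMinus q) = coactBasis q 1 := coactForms_basisOne q 1
  have e2 : coactForms q (eZero q) = coactBasis q 2 := coactForms_basisOne q 2
  rw [dAH_coactIncl_gen]
  cases x <;>
  simp only [dGen, map_add, map_sub, map_smul, map_mul, coactForms_incl, e0, e1, e2, coactIncl_gen,
    coactBasis_zero, coactBasis_one, coactBasis_two, mul_add,
    tmul_mul_tmul_of_mem_zero _ _ _ (inclH_mem q _), inclH_T_mul, deg, qInt_one q hq,
    qInt_neg_one q hq, tmul, TensorProduct.add_tmul, TensorProduct.sub_tmul,
    ← TensorProduct.smul_tmul', mul_one] <;>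
  norm_num <;> module

theorem coactForms_dA (hq : (q : ℂ) ^ 2 ≠ 1) (ω : FormsA q) :
    coactForms q (dA q ω) = dAH q (coactForms q ω) := by
  refine comm_d_of_degree_zero (isDifferentialCalculus_A q) (coactForms q) (dAH_dAH q)
    (fun a y => by rw [coactForms_incl, dAH_coactIncl_mul]) (fun a => ?_) ω
  rw [coactForms_incl, dA_inclA]
  induction a using OqSL2.induction with
  | smul_one c =>
    have h := dAH_coactIncl_mul q 1 1
    rw [map_one, one_mul, one_mul, mul_one] at h
    rw [dFun_algebraMap, map_zero, AlgHom.commutes, Algebra.algebraMap_eq_smul_one, map_smul,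
      left_eq_add.1 h, smul_zero]
  | gen x => rw [dFun_gen, coactForms_dGen q hq]
  | add a b ha hb => simp only [map_add, ha, hb]
  | mul a b ha hb =>
    rw [dFun_mul, map_add, map_mul, map_mul, ha, hb, map_mul, dAH_coactIncl_mul, coactForms_incl,
      coactForms_incl]

theorem of_map_mem_tensorGrade {M N : Type} [AddCommGroup M] [Module ℂ M] [AddCommGroup N]
    [Module ℂ N] {f : M →ₗ[ℂ] FormsA q} {g : N →ₗ[ℂ] FormsH q} {i j : ℕ}
    (hf : ∀ m, f m ∈ gradeA q i) (hg : ∀ n, g n ∈ gradeH q j) (z : M ⊗[ℂ] N) :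
    of ℂ (gradeA q) (gradeH q) (TensorProduct.map f g z) ∈
      tensorGrade (gradeA q) (gradeH q) (i + j) := by
  induction z using TensorProduct.induction_on with
  | zero => simp
  | add z z' hz hz' => rw [map_add, map_add]; exact add_mem hz hz'
  | tmul m n => exact tmul_mem_tensorGrade (hf m) (hg n)

theorem isCoactionExtension_coactForms (hq : (q : ℂ) ^ 2 ≠ 1) :
    IsCoactionExtension (gradeA q) (gradeH q) (inclA q) (inclH q) (dA q) (dH q) (coact q)
      (coactForms q) where
  extend := coactForms_incl q
  comm_d := coactForms_dA q hq
  degree := fun k ω hω => by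
    refine SkewExt.mem_of_mem_grade
      (p := (tensorGrade (gradeA q) (gradeH q) k).comap (coactForms q).toLinearMap) ?_ hω
    rintro S rfl r
    rw [Submodule.mem_comap, AlgHom.toLinearMap_apply, coactForms_mon_eq]
    refine Submodule.add_mem _ ?_ ?_
    · have := of_map_mem_tensorGrade q (f := SkewExt.mon (dataA q) S)
        (g := SkewExt.mon (dataH q) ∅ ∘ₗ LinearMap.mulRight ℂ (LaurentPolynomial.T (∑ i ∈ S, wt i))) (j := 0)
        (SkewExt.mon_mem_grade _ S) (fun f => SkewExt.mon_mem_grade _ ∅ _) (coact q r)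
      rwa [add_zero] at this
    · split_ifs with h
      · have := of_map_mem_tensorGrade q (f := SkewExt.mon (dataA q) (S.erase 2))
          (g := SkewExt.mon (dataH q) {0} ∘ₗ
            LinearMap.mulRight ℂ (LaurentPolynomial.T (∑ i ∈ S, wt i - 1))) (j := 1)
          (SkewExt.mon_mem_grade _ _) (fun f => SkewExt.mon_mem_grade _ {0} _) (coact q r)
        rwa [Finset.card_erase_add_one h] at this
      · exact zero_mem _

variable {q} in
/-- The extension of the coaction to forms is unique. -/
theorem IsCoactionExtension.eq_coactForms (hq : (q : ℂ) ^ 2 ≠ 1)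
    {Δ : FormsA q →ₐ[ℂ] gradeA q ᵍ⊗[ℂ] gradeH q}
    (h : IsCoactionExtension (gradeA q) (gradeH q) (inclA q) (inclH q) (dA q) (dH q) (coact q) Δ) :
    Δ = coactForms q := by
  have hA : ∀ a, Δ (inclA q a) = coactForms q (inclA q a) := fun a =>
    (h.extend a).trans (coactForms_incl q a).symm
  have hd : ∀ a, Δ (dA q (inclA q a)) = coactForms q (dA q (inclA q a)) := fun a => by
    rw [h.comm_d, hA, coactForms_dA q hq]
  have hE : ∀ i, Δ (SkewExt.basisOne (dataA q) i) =
      coactForms q (SkewExt.basisOne (dataA q) i) := by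
    intro i
    fin_cases i
    · change Δ (ePlus q) = coactForms q (ePlus q)
      simp only [ePlus_eq, map_sub, map_smul, map_mul, hA, hd]
    · change Δ (eMinus q) = coactForms q (eMinus q)
      simp only [eMinus_eq, map_sub, map_smul, map_mul, hA, hd]
    · change Δ (eZero q) = coactForms q (eZero q)
      simp only [eZero_eq, map_sub, map_smul, map_mul, hA, hd]
  ext ω
  induction ω using SkewExt.induction with
  | incl r => exact hA r
  | basisOne i => exact hE i
  | add x y hx hy => rw [map_add, map_add, hx, hy]
  | mul x y hx hy => rw [map_mul, map_mul, hx, hy]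

end Complete

/-! ### Weight spaces of `O_q(SL₂)` -/

section Weight
variable (q : ℂˣ)

/-- The elements `a ∈ A` with `Δ_A(a) = a ⊗ tⁿ`. -/
def weightSpace (n : ℤ) : Submodule ℂ (OqSL2 q) :=
  LinearMap.eqLocus (coact q).toLinearMap
    ((TensorProduct.mk ℂ (OqSL2 q) ℂ[T;T⁻¹]).flip (LaurentPolynomial.T n))

variable {q}

theorem mem_weightSpace {n : ℤ} {a : OqSL2 q} :
    a ∈ weightSpace q n ↔ coact q a = a ⊗ₜ LaurentPolynomial.T n := Iff.rfl

theorem gen_mem (x : Gen) : gen q x ∈ weightSpace q (deg x) := coact_gen q x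

theorem gen_mem_of_deg {x : Gen} {n : ℤ} (h : deg x = n) : gen q x ∈ weightSpace q n :=
  h ▸ gen_mem x

theorem mul_mem_weightSpace {m n k : ℤ} {a b : OqSL2 q} (ha : a ∈ weightSpace q m)
    (hb : b ∈ weightSpace q n) (hk : m + n = k) : a * b ∈ weightSpace q k := by
  rw [mem_weightSpace] at *
  rw [map_mul, ha, hb, Algebra.TensorProduct.tmul_mul_tmul, ← LaurentPolynomial.T_add, hk]

theorem mem_podles {a : OqSL2 q} : a ∈ podles q ↔ a ∈ weightSpace q 0 := by
  rw [mem_weightSpace, LaurentPolynomial.T_zero]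
  rfl

variable (q) in
/-- The coaction is counital. -/
theorem rid_counit_coact (n : ℤ) (a : OqSL2 q) :
    TensorProduct.rid ℂ (OqSL2 q) (TensorProduct.map LinearMap.id
      (Coalgebra.counit ∘ₗ LinearMap.mulRight ℂ (LaurentPolynomial.T n)) (coact q a)) = a := by
  have hT : (Coalgebra.counit ∘ₗ LinearMap.mulRight ℂ (LaurentPolynomial.T n) :
      ℂ[T;T⁻¹] →ₗ[ℂ] ℂ) = (Bialgebra.counitAlgHom ℂ ℂ[T;T⁻¹]).toLinearMap :=
    laurent_linearMap_ext fun m => by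
      rw [LinearMap.comp_apply, LinearMap.mulRight_apply, ← LaurentPolynomial.T_add,
        AlgHom.toLinearMap_apply, Bialgebra.counitAlgHom_apply, LaurentPolynomial.counit_T,
        LaurentPolynomial.counit_T]
  rw [hT]
  let f : OqSL2 q →ₐ[ℂ] OqSL2 q := (Algebra.TensorProduct.rid ℂ ℂ (OqSL2 q)).toAlgHom.comp
    ((Algebra.TensorProduct.map (AlgHom.id ℂ _) (Bialgebra.counitAlgHom ℂ ℂ[T;T⁻¹])).comp (coact q))
  change f a = a
  induction a using OqSL2.induction with
  | smul_one c => exact f.commutes c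
  | gen x => simp [f]
  | add a b ha hb => rw [map_add, ha, hb]
  | mul a b ha hb => rw [map_mul, ha, hb]

/-- `1 = αδ - q⁻¹γβ`, inserted on the right. -/
theorem eq_mul_α_δ (r : OqSL2 q) :
    r = r * gen q .α * gen q .δ - (q : ℂ)⁻¹ • (r * gen q .γ * gen q .β) := by
  rw [mul_assoc, mul_assoc, rel_cb, rel_det, mul_add, mul_one, mul_smul_comm, add_sub_cancel_right]

/-- `1 = δα - qβγ`, inserted on the right. -/
theorem eq_mul_δ_α (r : OqSL2 q) :
    r = r * gen q .δ * gen q .α - (q : ℂ) • (r * gen q .β * gen q .γ) := by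
  rw [mul_assoc, mul_assoc, rel_da, mul_add, mul_one, mul_smul_comm, add_sub_cancel_right]

/-- `1` is a sum of products of elements of weights `2` and `-2`. -/
theorem eq_mul_neg_two (r : OqSL2 q) :
    ∃ x y : Fin 4 → OqSL2 q, (∀ i, x i ∈ weightSpace q 2) ∧ (∀ i, y i ∈ weightSpace q (-2)) ∧
      r = ∑ i, r * x i * y i := by
  refine ⟨![gen q .α * gen q .α, -(q : ℂ)⁻¹ • (gen q .α * gen q .γ),
      -(q : ℂ)⁻¹ • (gen q .γ * gen q .α), ((q : ℂ)⁻¹ * (q : ℂ)⁻¹) • (gen q .γ * gen q .γ)],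
    ![gen q .δ * gen q .δ, gen q .β * gen q .δ, gen q .δ * gen q .β, gen q .β * gen q .β],
    ?_, ?_, ?_⟩
  · have h : ∀ x y, deg x + deg y = 2 → gen q x * gen q y ∈ weightSpace q 2 := fun x y h =>
      mul_mem_weightSpace (gen_mem x) (gen_mem y) h
    intro i
    fin_cases i
    · exact h _ _ rfl
    all_goals exact Submodule.smul_mem _ _ (h _ _ rfl)
  · have h : ∀ x y, deg x + deg y = -2 → gen q x * gen q y ∈ weightSpace q (-2) := fun x y h =>
      mul_mem_weightSpace (gen_mem x) (gen_mem y) h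
    intro i
    fin_cases i <;> exact h _ _ rfl
  · conv_lhs => rw [eq_mul_α_δ r, eq_mul_α_δ (r * gen q .α), eq_mul_α_δ (r * gen q .γ)]
    simp [Fin.sum_univ_four, sub_mul, smul_sub, smul_smul, mul_assoc]
    abel

/-- `1` is a sum of products of elements of weights `-2` and `2`. -/
theorem eq_mul_two (r : OqSL2 q) :
    ∃ x y : Fin 4 → OqSL2 q, (∀ i, x i ∈ weightSpace q (-2)) ∧ (∀ i, y i ∈ weightSpace q 2) ∧
      r = ∑ i, r * x i * y i := by
  refine ⟨![gen q .δ * gen q .δ, -(q : ℂ) • (gen q .δ * gen q .β),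
      -(q : ℂ) • (gen q .β * gen q .δ), ((q : ℂ) * (q : ℂ)) • (gen q .β * gen q .β)],
    ![gen q .α * gen q .α, gen q .γ * gen q .α, gen q .α * gen q .γ, gen q .γ * gen q .γ],
    ?_, ?_, ?_⟩
  · have h : ∀ x y, deg x + deg y = -2 → gen q x * gen q y ∈ weightSpace q (-2) := fun x y h =>
      mul_mem_weightSpace (gen_mem x) (gen_mem y) h
    intro i
    fin_cases i
    · exact h _ _ rfl
    all_goals exact Submodule.smul_mem _ _ (h _ _ rfl)
  · have h : ∀ x y, deg x + deg y = 2 → gen q x * gen q y ∈ weightSpace q 2 := fun x y h =>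
      mul_mem_weightSpace (gen_mem x) (gen_mem y) h
    intro i
    fin_cases i <;> exact h _ _ rfl
  · conv_lhs => rw [eq_mul_δ_α r, eq_mul_δ_α (r * gen q .δ), eq_mul_δ_α (r * gen q .β)]
    simp [Fin.sum_univ_four, sub_mul, smul_sub, smul_smul, mul_assoc]
    abel

end Weight

/-! ### Horizontal forms and base forms -/

section Base
variable {q : ℂˣ}

open GradedTensorProduct

theorem subset_cases {S : Finset (Fin 3)} (h : 2 ∉ S) : S = ∅ ∨ S = {0} ∨ S = {1} ∨ S = {0, 1} := by
  revert S; decide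

variable (q) in
/-- Applying `coeff_S ⊗ ε ∘ coeff_dt` to `Δ ω` recovers the coefficient of `e_S ∧ e⁰` in `ω`. -/
theorem rid_coeff_coactForms {S : Finset (Fin 3)} (hS : 2 ∉ S) (ω : FormsA q) :
    TensorProduct.rid ℂ (OqSL2 q) (TensorProduct.map (SkewExt.coeff (dataA q) S)
      (Coalgebra.counit ∘ₗ SkewExt.coeff (dataH q) {0})
        ((of ℂ (gradeA q) (gradeH q)).symm (coactForms q ω))) =
      SkewExt.coeff (dataA q) (insert 2 S) ω := by
  have h' : ({0} : Finset (Fin 1)) ≠ ∅ := by decide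
  have hc : ∀ (T : Finset (Fin 3)) (U : Finset (Fin 1)) (n : ℤ) (z : OqSL2 q ⊗[ℂ] ℂ[T;T⁻¹]),
      TensorProduct.map (SkewExt.coeff (dataA q) S)
        (Coalgebra.counit ∘ₗ SkewExt.coeff (dataH q) {0}) (TensorProduct.map (SkewExt.mon (dataA q) T)
          (SkewExt.mon (dataH q) U ∘ₗ LinearMap.mulRight ℂ (LaurentPolynomial.T n)) z) =
      if S = T ∧ {0} = U then TensorProduct.map LinearMap.id
        (Coalgebra.counit ∘ₗ LinearMap.mulRight ℂ (LaurentPolynomial.T n)) z else 0 := by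
    intro T U n z
    induction z using TensorProduct.induction_on with
    | zero => simp
    | add z z' hz hz' => simp only [map_add, hz, hz']; split_ifs <;> simp
    | tmul a f =>
      simp only [TensorProduct.map_tmul, LinearMap.comp_apply, SkewExt.coeff_mon]
      by_cases h1 : S = T <;> by_cases h2 : {0} = U <;> simp [h1, h2]
  conv_lhs => rw [← SkewExt.sum_mon_coeff _ ω]
  simp only [map_sum]
  rw [Finset.sum_eq_single (insert 2 S)]
  · rw [coactForms_mon_eq, if_pos (Finset.mem_insert_self _ _), map_add, of_symm_of, of_symm_of,
      map_add, hc, hc, if_neg (fun h => h' h.2), if_pos ⟨(Finset.erase_insert hS).symm, rfl⟩,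
      zero_add, rid_counit_coact]
  · intro T _ hT
    rw [coactForms_mon_eq, map_add, of_symm_of, map_add, hc, if_neg (fun h => h' h.2), zero_add]
    split_ifs with h2
    · rw [of_symm_of, hc, if_neg, map_zero]
      rintro ⟨rfl, -⟩
      exact hT (Finset.insert_erase h2).symm
    · simp
  · simp

theorem coactForms_mon_of_notMem {S : Finset (Fin 3)} (hS : 2 ∉ S) (r : OqSL2 q) :
    coactForms q (SkewExt.mon (dataA q) S r) =
      of ℂ (gradeA q) (gradeH q) (TensorProduct.map (SkewExt.mon (dataA q) S)
        (SkewExt.mon (dataH q) ∅ ∘ₗ LinearMap.mulRight ℂ (LaurentPolynomial.T (∑ i ∈ S, wt i)))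
          (coact q r)) := by
  rw [coactForms_mon_eq, if_neg hS, add_zero]

/-- A form is horizontal exactly when it does not involve `e⁰`. -/
theorem mem_horForms {ω : FormsA q} : ω ∈ horForms (inclH q) (coactForms q) ↔
    ∀ S : Finset (Fin 3), 2 ∈ S → SkewExt.coeff (dataA q) S ω = 0 := by
  constructor
  · rintro ⟨z, hz⟩ S hS
    rw [← Finset.insert_erase hS, ← rid_coeff_coactForms q (Finset.notMem_erase 2 S)]
    have hz' : (of ℂ (gradeA q) (gradeH q)).symm (coactForms q ω) =
      TensorProduct.map LinearMap.id (inclH q).toLinearMap z := hz.symm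
    have hc : SkewExt.coeff (dataH q) {0} ∘ₗ (inclH q).toLinearMap = 0 := by
      refine LinearMap.ext fun f => ?_
      exact (SkewExt.coeff_mon (D := dataH q) ∅ {0} f).trans (if_neg (by decide))
    rw [hz', ← LinearMap.comp_apply (f := TensorProduct.map _ _), ← TensorProduct.map_comp,
      LinearMap.comp_assoc, hc]
    simp
  · intro h
    rw [← SkewExt.sum_mon_coeff _ ω]
    refine sum_mem fun S _ => ?_
    by_cases hS : 2 ∈ S
    · rw [h S hS, map_zero]; exact zero_mem _
    · refine ⟨TensorProduct.map (SkewExt.mon (dataA q) S)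
        (LinearMap.mulRight ℂ (LaurentPolynomial.T (∑ i ∈ S, wt i)))
          (coact q (SkewExt.coeff (dataA q) S ω)), ?_⟩
      rw [LinearMap.comp_apply, AlgHom.toLinearMap_apply, coactForms_mon_of_notMem hS,
        ← LinearMap.comp_apply, ← TensorProduct.map_comp]
      rfl

theorem mem_baseForms_iff {ω : FormsA q} :
    ω ∈ baseForms (coactForms q) ↔ coactForms q ω = ω ᵍ⊗ₜ[ℂ] 1 := Iff.rfl

theorem mon_mem_baseForms {S : Finset (Fin 3)} (hS : 2 ∉ S) {r : OqSL2 q}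
    (hr : r ∈ weightSpace q (-∑ i ∈ S, wt i)) :
    SkewExt.mon (dataA q) S r ∈ baseForms (coactForms q) := by
  rw [mem_baseForms_iff, coactForms_mon_of_notMem hS, mem_weightSpace.1 hr, TensorProduct.map_tmul,
    LinearMap.comp_apply, LinearMap.mulRight_apply, ← LaurentPolynomial.T_add, neg_add_cancel,
    LaurentPolynomial.T_zero]
  rfl

theorem baseForms_le_horForms : baseForms (coactForms q) ≤ horForms (inclH q) (coactForms q) := by
  intro ω hω
  refine ⟨ω ⊗ₜ 1, ?_⟩
  rw [LinearMap.comp_apply, AlgHom.toLinearMap_apply, mem_baseForms_iff.1 hω,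
    TensorProduct.map_tmul, AlgHom.toLinearMap_apply, map_one]
  rfl

/-- In a base form the coefficient of `e_S` has the weight opposite to that of `e_S`. -/
theorem coeff_mem_weightSpace {ω : FormsA q} (hω : ω ∈ baseForms (coactForms q))
    (S : Finset (Fin 3)) : SkewExt.coeff (dataA q) S ω ∈ weightSpace q (-∑ i ∈ S, wt i) := by
  have hhor := mem_horForms.1 (baseForms_le_horForms hω)
  by_cases hS : 2 ∈ S
  · rw [hhor S hS]; exact zero_mem _
  have hc : ∀ (T : Finset (Fin 3)) (n : ℤ) (z : OqSL2 q ⊗[ℂ] ℂ[T;T⁻¹]),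
      TensorProduct.map (SkewExt.coeff (dataA q) S) (SkewExt.coeff (dataH q) ∅)
        (TensorProduct.map (SkewExt.mon (dataA q) T)
          (SkewExt.mon (dataH q) ∅ ∘ₗ LinearMap.mulRight ℂ (LaurentPolynomial.T n)) z) =
      if S = T then TensorProduct.map LinearMap.id
        (LinearMap.mulRight ℂ (LaurentPolynomial.T n)) z else 0 := by
    intro T n z
    induction z using TensorProduct.induction_on with
    | zero => simp
    | add z z' hz hz' => simp only [map_add, hz, hz']; split_ifs <;> simp
    | tmul a f =>
      simp only [TensorProduct.map_tmul, LinearMap.comp_apply, SkewExt.coeff_mon]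
      by_cases h1 : S = T <;> simp [h1]
  set r := SkewExt.coeff (dataA q) S ω with hr
  set n := ∑ i ∈ S, wt i with hn
  have h1 : TensorProduct.map (SkewExt.coeff (dataA q) S) (SkewExt.coeff (dataH q) ∅)
      ((of ℂ (gradeA q) (gradeH q)).symm (coactForms q ω)) = TensorProduct.map LinearMap.id
        (LinearMap.mulRight ℂ (LaurentPolynomial.T n)) (coact q r) := by
    conv_lhs => rw [← SkewExt.sum_mon_coeff _ ω]
    simp only [map_sum]
    rw [Finset.sum_eq_single S]
    · rw [coactForms_mon_of_notMem hS, of_symm_of, hc, if_pos rfl]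
    · intro T _ hT
      by_cases h2 : 2 ∈ T
      · rw [hhor T h2]; simp
      · rw [coactForms_mon_of_notMem h2, of_symm_of, hc, if_neg (Ne.symm hT)]
    · simp
  rw [mem_baseForms_iff.1 hω, of_symm_of, TensorProduct.map_tmul, coeff_one_H, if_pos rfl] at h1
  -- Multiplication by `t⁻ⁿ` in the second factor undoes multiplication by `tⁿ`.
  have h2 := congrArg (TensorProduct.map (LinearMap.id : OqSL2 q →ₗ[ℂ] OqSL2 q)
    (LinearMap.mulRight ℂ (LaurentPolynomial.T (-n)))) h1
  have hinv : LinearMap.mulRight ℂ (LaurentPolynomial.T (-n)) ∘ₗ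
      LinearMap.mulRight ℂ (LaurentPolynomial.T n) = (LinearMap.id : ℂ[T;T⁻¹] →ₗ[ℂ] _) := by
    refine LinearMap.ext fun f => ?_
    rw [LinearMap.comp_apply, LinearMap.mulRight_apply, LinearMap.mulRight_apply, mul_assoc,
      ← LaurentPolynomial.T_add, add_neg_cancel, LaurentPolynomial.T_zero, mul_one]
    rfl
  rw [← LinearMap.comp_apply (f := TensorProduct.map _ _), ← TensorProduct.map_comp, hinv,
    LinearMap.id_comp, TensorProduct.map_id, TensorProduct.map_tmul] at h2
  rw [mem_weightSpace]
  simpa using! h2.symm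

/-- The horizontal forms are the `A`-bimodule generated by the base forms. -/
theorem horForms_eq :
    horForms (inclH q) (coactForms q) = bimoduleSpan (inclA q) (baseForms (coactForms q)) := by
  have hmem : ∀ (a : OqSL2 q) (ω), ω ∈ baseForms (coactForms q) →
      inclA q a * ω ∈ bimoduleSpan (inclA q) (baseForms (coactForms q)) := fun a ω hω =>
    Submodule.subset_span ⟨a, 1, ω, hω, by rw [map_one, mul_one]⟩
  apply le_antisymm
  · intro ω hω
    rw [mem_horForms] at hω
    rw [← SkewExt.sum_mon_coeff _ ω]
    refine sum_mem fun S _ => ?_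
    by_cases hS : 2 ∈ S
    · rw [hω S hS, map_zero]; exact zero_mem _
    generalize SkewExt.coeff (dataA q) S ω = r
    -- In each case `r e_S` is a left `A`-combination of base forms `y e_S`.
    have key : (∃ x y : Fin 4 → OqSL2 q, (∀ i, y i ∈ weightSpace q (-∑ i ∈ S, wt i)) ∧
        r = ∑ i, x i * y i) → SkewExt.mon (dataA q) S r ∈
          bimoduleSpan (inclA q) (baseForms (coactForms q)) := by
      rintro ⟨x, y, hy, rfl⟩
      rw [map_sum]
      refine sum_mem fun i _ => ?_
      rw [← SkewExt.incl_mul_mon]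
      exact hmem _ _ (mon_mem_baseForms hS (hy i))
    have hone : (∑ i ∈ S, wt i = 0) → SkewExt.mon (dataA q) S r ∈
          bimoduleSpan (inclA q) (baseForms (coactForms q)) := fun h => by
      rw [SkewExt.mon_eq_incl_mul]
      refine hmem _ _ (mon_mem_baseForms hS ?_)
      rw [h, neg_zero, ← mem_podles]
      exact (podles q).one_mem
    rcases subset_cases hS with rfl | rfl | rfl | rfl
    · exact hone rfl
    · obtain ⟨x, y, -, hy, h⟩ := eq_mul_neg_two r
      exact key ⟨fun i => r * x i, y, hy, h⟩
    · obtain ⟨x, y, -, hy, h⟩ := eq_mul_two r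
      exact key ⟨fun i => r * x i, y, hy, h⟩
    · exact hone rfl
  · refine Submodule.span_le.2 ?_
    rintro _ ⟨a, a', ω, hω, rfl⟩
    have := mem_horForms.1 (baseForms_le_horForms hω)
    refine mem_horForms.2 fun S hS => ?_
    have e1 := SkewExt.mul_mon_empty a' (inclA q a * ω) S
    have e2 := SkewExt.mon_empty_mul a ω S
    refine e1.trans ?_
    rw [show SkewExt.coeff (dataA q) S (inclA q a * ω) = _ from e2, this S hS, mul_zero, zero_mul]

end Base

/-! ### Base forms are generated by the Podleś sphere -/

section Podles
variable (q : ℂˣ)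

open GradedTensorProduct

/-- The `k`-forms generated by the Podleś sphere. -/
abbrev podlesForms (k : ℕ) : Submodule ℂ (FormsA q) :=
  formSpan (dA q) (inclA q '' podles q) k

theorem podlesForms_mul_le (i j : ℕ) :
    podlesForms q i * podlesForms q j ≤ podlesForms q (i + j) :=
  formSpan_mul_le ((podles q).map (inclA q)) (by
    rintro _ ⟨a, -, rfl⟩ b -
    simpa using! dA_leibniz q 0 _ (SkewExt.incl_mem_grade _ a) b) i j

variable {q}

theorem incl_mem_podlesForms {b : OqSL2 q} (hb : b ∈ weightSpace q 0) :
    inclA q b ∈ podlesForms q 0 := by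
  have h := formSpan_zero (d := dA q) (Subalgebra.toSubmodule ((podles q).map (inclA q)))
  refine (le_of_eq h.symm : _) ?_
  exact ⟨b, mem_podles.2 hb, rfl⟩

theorem incl_mul_dA_mem {b b' : OqSL2 q} (hb : b ∈ weightSpace q 0) (hb' : b' ∈ weightSpace q 0) :
    inclA q b * dA q (inclA q b') ∈ podlesForms q 1 :=
  Submodule.subset_span ⟨_, ⟨b, mem_podles.2 hb, rfl⟩, fun _ => inclA q b',
    fun _ => ⟨b', mem_podles.2 hb', rfl⟩, by simp⟩

/-- The forms `u w e⁺` are combinations of `uα d(γw)` and `uγ d(αw)`: in the combination below the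
terms with `dw` cancel by `γα = q αγ` and the others give `e⁺ = q⁻¹ α dγ - q⁻² γ dα`. -/
theorem incl_mul_ePlus (u : OqSL2 q) {x : Gen} (hx : deg x = -1) :
    inclA q (u * gen q x) * ePlus q =
      inclA q (u * gen q .α) * dA q (inclA q (gen q .γ * gen q x)) -
        (q : ℂ)⁻¹ • (inclA q (u * gen q .γ) * dA q (inclA q (gen q .α * gen q x))) := by
  have hq := q.ne_zero
  have h1 : inclA q (gen q .α) * dA q (inclA q (gen q .γ)) -
      (q : ℂ)⁻¹ • (inclA q (gen q .γ) * dA q (inclA q (gen q .α))) = (q : ℂ) • ePlus q := by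
    rw [ePlus_eq, smul_sub, smul_smul, smul_smul, mul_inv_cancel₀ hq, one_smul]
    congr 2
    field_simp
  have h2 : inclA q (gen q .γ) * inclA q (gen q .α) =
      (q : ℂ) • (inclA q (gen q .α) * inclA q (gen q .γ)) := by
    rw [← map_mul, rel_ca, map_smul, map_mul]
  have h3 : ePlus q * inclA q (gen q x) = (q : ℂ)⁻¹ • (inclA q (gen q x) * ePlus q) := by
    rw [ePlus_mul_gen, hx]; simp
  have hd : ∀ a b : OqSL2 q, dA q (inclA q (a * b)) =
      dA q (inclA q a) * inclA q b + inclA q a * dA q (inclA q b) := fun a b => by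
    rw [map_mul, dA_incl_mul, dA_inclA q a]
  calc inclA q (u * gen q x) * ePlus q
      = inclA q u * ((q : ℂ) • ePlus q * inclA q (gen q x)) := by
        rw [smul_mul_assoc, h3, smul_smul, mul_inv_cancel₀ hq, one_smul, map_mul, mul_assoc]
    _ = _ := by
        rw [← h1, hd, hd]
        simp only [map_mul, sub_mul, mul_sub, mul_add, smul_add, smul_mul_assoc, mul_smul_comm,
          mul_assoc]
        rw [← mul_assoc (inclA q (gen q .γ)) (inclA q (gen q .α)), h2, smul_mul_assoc,
          mul_smul_comm, smul_smul, inv_mul_cancel₀ hq, one_smul, mul_assoc]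
        abel

/-- The analogue of `incl_mul_ePlus` for `e⁻ = δ dβ - qβ dδ`. -/
theorem incl_mul_eMinus (u : OqSL2 q) {x : Gen} (hx : deg x = 1) :
    (q : ℂ) • (inclA q (u * gen q x) * eMinus q) =
      inclA q (u * gen q .δ) * dA q (inclA q (gen q .β * gen q x)) -
        (q : ℂ) • (inclA q (u * gen q .β) * dA q (inclA q (gen q .δ * gen q x))) := by
  have h2 : inclA q (gen q .δ) * inclA q (gen q .β) =
      (q : ℂ) • (inclA q (gen q .β) * inclA q (gen q .δ)) := by
    rw [← map_mul, rel_db, map_smul, map_mul]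
  have h3 : eMinus q * inclA q (gen q x) = (q : ℂ) • (inclA q (gen q x) * eMinus q) := by
    rw [eMinus_mul_gen, hx]; simp
  have hd : ∀ a b : OqSL2 q, dA q (inclA q (a * b)) =
      dA q (inclA q a) * inclA q b + inclA q a * dA q (inclA q b) := fun a b => by
    rw [map_mul, dA_incl_mul, dA_inclA q a]
  calc (q : ℂ) • (inclA q (u * gen q x) * eMinus q)
      = inclA q u * (eMinus q * inclA q (gen q x)) := by
        rw [h3, mul_smul_comm, map_mul, mul_assoc]
    _ = _ := by
        rw [eMinus_eq, hd, hd]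
        simp only [map_mul, sub_mul, mul_sub, mul_add, smul_add, smul_mul_assoc, mul_smul_comm,
          mul_assoc]
        rw [← mul_assoc (inclA q (gen q .δ)) (inclA q (gen q .β)), h2, smul_mul_assoc,
          mul_smul_comm, mul_assoc]
        abel

theorem mon_zero_mem_podlesForms {r : OqSL2 q} (hr : r ∈ weightSpace q (-2)) :
    SkewExt.mon (dataA q) {0} r ∈ podlesForms q 1 := by
  have key : ∀ u ∈ weightSpace q (-1), ∀ x, deg x = -1 →
      inclA q (u * gen q x) * ePlus q ∈ podlesForms q 1 := fun u hu x hx => by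
    have hα : gen q .α ∈ weightSpace q 1 := gen_mem_of_deg rfl
    have hγ : gen q .γ ∈ weightSpace q 1 := gen_mem_of_deg rfl
    have hx' : gen q x ∈ weightSpace q (-1) := gen_mem_of_deg hx
    rw [incl_mul_ePlus u hx]
    exact sub_mem
      (incl_mul_dA_mem (mul_mem_weightSpace hu hα rfl) (mul_mem_weightSpace hγ hx' rfl))
      (Submodule.smul_mem _ _
        (incl_mul_dA_mem (mul_mem_weightSpace hu hγ rfl) (mul_mem_weightSpace hα hx' rfl)))
  have hrα : r * gen q .α ∈ weightSpace q (-1) := mul_mem_weightSpace hr (gen_mem .α) rfl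
  have hrγ : r * gen q .γ ∈ weightSpace q (-1) := mul_mem_weightSpace hr (gen_mem .γ) rfl
  rw [SkewExt.mon_eq_incl_mul, eq_mul_α_δ r, map_sub, map_smul, sub_mul, smul_mul_assoc]
  exact sub_mem (key _ hrα .δ rfl) (Submodule.smul_mem _ _ (key _ hrγ .β rfl))

theorem mon_one_mem_podlesForms {r : OqSL2 q} (hr : r ∈ weightSpace q 2) :
    SkewExt.mon (dataA q) {1} r ∈ podlesForms q 1 := by
  have key : ∀ u ∈ weightSpace q 1, ∀ x, deg x = 1 →
      inclA q (u * gen q x) * eMinus q ∈ podlesForms q 1 := fun u hu x hx => by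
    have hδ : gen q .δ ∈ weightSpace q (-1) := gen_mem_of_deg rfl
    have hβ : gen q .β ∈ weightSpace q (-1) := gen_mem_of_deg rfl
    have hx' : gen q x ∈ weightSpace q 1 := gen_mem_of_deg hx
    rw [← Submodule.smul_mem_iff _ q.ne_zero, incl_mul_eMinus u hx]
    exact sub_mem
      (incl_mul_dA_mem (mul_mem_weightSpace hu hδ rfl) (mul_mem_weightSpace hβ hx' rfl))
      (Submodule.smul_mem _ _
        (incl_mul_dA_mem (mul_mem_weightSpace hu hβ rfl) (mul_mem_weightSpace hδ hx' rfl)))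
  have hrδ : r * gen q .δ ∈ weightSpace q 1 := mul_mem_weightSpace hr (gen_mem .δ) rfl
  have hrβ : r * gen q .β ∈ weightSpace q 1 := mul_mem_weightSpace hr (gen_mem .β) rfl
  rw [SkewExt.mon_eq_incl_mul, eq_mul_δ_α r, map_sub, map_smul, sub_mul, smul_mul_assoc]
  exact sub_mem (key _ hrδ .α rfl) (Submodule.smul_mem _ _ (key _ hrβ .γ rfl))

theorem tw_zero_of_mem_weightSpace {n : ℤ} {a : OqSL2 q} (ha : a ∈ weightSpace q n) :
    (dataA q).tw {0} a = ((q ^ n : ℂˣ) : ℂ) • a := by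
  -- The twist is the coaction followed by evaluation at `t = q`.
  let ev : ℂ[T;T⁻¹] →ₐ[ℂ] ℂ :=
    AddMonoidAlgebra.lift ℂ ℂ ℤ ((Units.coeHom ℂ).comp (zpowersHom ℂˣ q))
  have hev : ∀ m : ℤ, ev (LaurentPolynomial.T m) = ((q ^ m : ℂˣ) : ℂ) := fun m => by
    refine (AddMonoidAlgebra.lift_single _ _ _).trans ?_
    exact one_smul _ _
  let f : OqSL2 q →ₐ[ℂ] OqSL2 q := (Algebra.TensorProduct.rid ℂ ℂ (OqSL2 q)).toAlgHom.comp
    ((Algebra.TensorProduct.map (AlgHom.id ℂ _) ev).comp (coact q))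
  have hf : ∀ a, (dataA q).tw {0} a = f a := fun a => by
    induction a using OqSL2.induction with
    | smul_one c => rw [AlgHom.commutes, AlgHom.commutes]
    | gen x =>
      have hw : (dataA q).w 0 = 1 := rfl
      simp [f, hev, tw_gen, hw]
    | add a b ha hb => rw [map_add, map_add, ha, hb]
    | mul a b ha hb => rw [map_mul, map_mul, ha, hb]
  rw [hf]
  simp [f, mem_weightSpace.1 ha, hev]

theorem mon_zero_one_mem_podlesForms {r : OqSL2 q} (hr : r ∈ weightSpace q 0) :
    SkewExt.mon (dataA q) {0, 1} r ∈ podlesForms q 2 := by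
  obtain ⟨x, y, hx, hy, h⟩ := eq_mul_two r
  rw [h, map_sum]
  refine sum_mem fun i _ => ?_
  have h1 := podlesForms_mul_le q 1 1 (Submodule.mul_mem_mul
    (mon_zero_mem_podlesForms (mul_mem_weightSpace hr (hx i) rfl))
    (mon_one_mem_podlesForms (hy i)))
  rw [mon_mul_mon_A, if_neg (by decide), if_neg (by decide), one_smul,
    tw_zero_of_mem_weightSpace (hy i), mul_smul_comm, map_smul] at h1
  exact (Submodule.smul_mem_iff _ (Units.ne_zero _)).1 h1

theorem mon_mem_podlesForms {S : Finset (Fin 3)} (hS : 2 ∉ S) {r : OqSL2 q}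
    (hr : r ∈ weightSpace q (-∑ i ∈ S, wt i)) :
    SkewExt.mon (dataA q) S r ∈ podlesForms q S.card := by
  rcases subset_cases hS with rfl | rfl | rfl | rfl
  · exact incl_mem_podlesForms hr
  · exact mon_zero_mem_podlesForms hr
  · exact mon_one_mem_podlesForms hr
  · exact mon_zero_one_mem_podlesForms hr

theorem podlesForms_le_grade (k : ℕ) : podlesForms q k ≤ gradeA q k := by
  refine (isDGA_A q).formSpan_le (X := Subalgebra.toSubmodule ((podles q).map (inclA q))) ?_ k
  rintro _ ⟨b, -, rfl⟩
  exact SkewExt.incl_mem_grade _ b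

theorem podlesForms_le_baseForms (hq : (q : ℂ) ^ 2 ≠ 1) (k : ℕ) :
    podlesForms q k ≤ baseForms (coactForms q) := by
  let 𝓑 : Subalgebra ℂ (FormsA q) :=
    AlgHom.equalizer (coactForms q) (includeLeft (gradeA q) (gradeH q))
  have h0 : ∀ b ∈ podles q, inclA q b ∈ 𝓑 := fun b hb =>
    mon_mem_baseForms (S := ∅) (by simp) (mem_podles.1 hb)
  have hd1 : dH q 1 = 0 := by simp [dH, coeff_one_H, qDeriv_one]
  have hd : ∀ ω ∈ 𝓑, dA q ω ∈ 𝓑 := fun ω hω => by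
    have hω' : coactForms q ω = ω ᵍ⊗ₜ[ℂ] 1 := hω
    change coactForms q (dA q ω) = dA q ω ᵍ⊗ₜ[ℂ] 1
    rw [coactForms_dA q hq, hω', dAH, tensorD_tmul, hd1]
    simp [tmul]
  refine Submodule.span_le.2 ?_
  rintro _ ⟨_, ⟨b, hb, rfl⟩, a, ha, rfl⟩
  refine 𝓑.mul_mem (h0 b hb) (Subalgebra.list_prod_mem _ fun y hy => ?_)
  obtain ⟨i, rfl⟩ := (List.mem_ofFn' _ _).1 hy
  obtain ⟨b', hb', h'⟩ := ha i
  exact hd _ (h' ▸ h0 b' hb')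

theorem baseForms_inf_grade (hq : (q : ℂ) ^ 2 ≠ 1) (k : ℕ) :
    baseForms (coactForms q) ⊓ gradeA q k = podlesForms q k := by
  apply le_antisymm
  · rintro ω ⟨hω, hk⟩
    rw [← SkewExt.sum_mon_coeff _ ω]
    refine sum_mem fun S _ => ?_
    by_cases hS : S.card = k
    · by_cases h2 : 2 ∈ S
      · rw [mem_horForms.1 (baseForms_le_horForms hω) S h2, map_zero]; exact zero_mem _
      · exact hS ▸ mon_mem_podlesForms h2 (coeff_mem_weightSpace hω S)
    · rw [hk S hS, map_zero]; exact zero_mem _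
  · exact le_inf (podlesForms_le_baseForms hq k) (podlesForms_le_grade k)

theorem baseForms_eq_iSup (hq : (q : ℂ) ^ 2 ≠ 1) :
    baseForms (coactForms q) = ⨆ k, podlesForms q k := by
  apply le_antisymm
  · intro ω hω
    rw [← SkewExt.sum_mon_coeff _ ω]
    refine sum_mem fun S _ => ?_
    by_cases h2 : 2 ∈ S
    · rw [mem_horForms.1 (baseForms_le_horForms hω) S h2, map_zero]; exact zero_mem _
    · exact Submodule.mem_iSup_of_mem S.card (mon_mem_podlesForms h2 (coeff_mem_weightSpace hω S))
  · exact iSup_le (podlesForms_le_baseForms hq)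

end Podles

/-! ### The connection one-form -/

section Connection
variable (q : ℂˣ)

open GradedTensorProduct

/-- The connection one-form `t⁻¹ dt ↦ e⁰`. -/
def connection : lam q 1 →ₗ[ℂ] FormsA q :=
  (lcoeff (-1) ∘ₗ SkewExt.coeff (dataH q) {0} ∘ₗ (lam q 1).subtype).smulRight (eZero q)

theorem connection_tinvdt : connection q ⟨tinvdt q, tinvdt_mem q⟩ = eZero q := by
  simp [connection, coeff_tinvdt, lcoeff_T]

theorem maurerCartan_T (n : ℤ) : maurerCartan q (LaurentPolynomial.T n) =
    qInt q n • ⟨tinvdt q, tinvdt_mem q⟩ :=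
  Subtype.ext (maurerCartanAux_T q n)

theorem adj_T (n : ℤ) : adj (LaurentPolynomial.T n) = LaurentPolynomial.T n ⊗ₜ 1 := by
  simp only [adj, LinearMap.comp_apply, LaurentPolynomial.comul_T, TensorProduct.map_tmul,
    LaurentPolynomial.antipode_T, LinearEquiv.coe_coe, TensorProduct.comm_tmul,
    TensorProduct.assoc_tmul, LinearMap.mul'_apply, LinearMap.id_apply, ← LaurentPolynomial.T_add,
    neg_add_cancel, LaurentPolynomial.T_zero]

theorem coactForms_eZero :
    coactForms q (eZero q) = eZero q ᵍ⊗ₜ[ℂ] 1 + 1 ᵍ⊗ₜ[ℂ] tinvdt q := by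
  rw [← inclH_T_zero, ← coactBasis_two, ← coactForms_basisOne]
  rfl

theorem rightCoact_eZero : rightCoact (coactForms q) (eZero q) = eZero q ⊗ₜ 1 := by
  have h : (∅ : Finset (Fin 1)) ≠ {0} := by decide
  simp only [rightCoact, LinearMap.comp_apply, AlgHom.toLinearMap_apply, coactForms_eZero, map_add,
    LinearEquiv.coe_coe, of_symm_of, TensorProduct.map_tmul, coeff_one_H, coeff_tinvdt, if_neg h,
    if_true, LinearMap.id_apply, TensorProduct.tmul_zero, add_zero]

theorem piLam_tinvdt : piLam q (tinvdt q) = tinvdt q := by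
  have h : leftCoact q (tinvdt q) = 1 ⊗ₜ tinvdt q := (tinvdt_mem q).1
  simp [piLam, h]

theorem verProj_eZero : verProj (coactForms q) (eZero q) = 1 ⊗ₜ tinvdt q := by
  have h1 : SkewExt.coeff (dataA q) ∅ (eZero q) = 0 :=
    (SkewExt.coeff_mon {2} ∅ (1 : OqSL2 q)).trans (if_neg (by decide))
  have h2 : SkewExt.coeff (dataA q) ∅ 1 = 1 :=
    (SkewExt.coeff_mon ∅ ∅ (1 : OqSL2 q)).trans (if_pos rfl)
  simp only [verProj, LinearMap.comp_apply, AlgHom.toLinearMap_apply, coactForms_eZero, map_add,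
    LinearEquiv.coe_coe, of_symm_of, TensorProduct.map_tmul, h1, h2, piLam_tinvdt,
    TensorProduct.zero_tmul, zero_add]

theorem exists_smul_tinvdt (θ : lam q 1) : ∃ c : ℂ, c • ⟨tinvdt q, tinvdt_mem q⟩ = θ := by
  obtain ⟨θ, h⟩ := θ
  obtain ⟨c, hc⟩ := Submodule.mem_span_singleton.1 (lam_one q ▸ h)
  exact ⟨c, Subtype.ext hc⟩

theorem isConnectionOneForm : IsConnectionOneForm (coactForms q) (connection q) where
  degree := fun θ => Submodule.smul_mem _ _ (SkewExt.basisOne_mem_grade (dataA q) 2)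
  colinear := fun h => by
    refine LinearMap.congr_fun (f := rightCoact (coactForms q) ∘ₗ connection q ∘ₗ maurerCartan q)
      (g := TensorProduct.map (connection q ∘ₗ maurerCartan q) LinearMap.id ∘ₗ adj)
      (laurent_linearMap_ext fun n => ?_) h
    simp only [LinearMap.comp_apply, adj_T, TensorProduct.map_tmul, maurerCartan_T, map_smul,
      connection_tinvdt, rightCoact_eZero, LinearMap.id_apply, TensorProduct.smul_tmul']
  splits := fun θ => by
    obtain ⟨c, rfl⟩ := exists_smul_tinvdt q θ
    rw [map_smul, map_smul, connection_tinvdt, verProj_eZero, ← TensorProduct.tmul_smul]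
    rfl

end Connection

end QHopf

end

theorem theorem6p2 (q : ℂˣ) (hq : ∀ n : ℕ, 0 < n → (q : ℂ) ^ n ≠ 1) :
    QHopf.IsDifferentialCalculus (QHopf.inclH q) (QHopf.gradeH q) (QHopf.dH q) ∧
    QHopf.IsDifferentialCalculus (QHopf.inclA q) (QHopf.gradeA q) (QHopf.dA q) ∧
    QHopf.IsComplete (QHopf.gradeA q) (QHopf.gradeH q) (QHopf.inclA q) (QHopf.inclH q)
      (QHopf.dA q) (QHopf.dH q) (QHopf.OqSL2.coact q) ∧
    (QHopf.lam q 0 = Submodule.span ℂ {1} ∧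
      QHopf.lam q 1 = Submodule.span ℂ {QHopf.tinvdt q} ∧
      (∀ k, 2 ≤ k → QHopf.lam q k = ⊥) ∧
      IsCompl ((QHopf.lam q 0).submoduleOf (QHopf.leftCoinv q))
        ((QHopf.lam q 1).submoduleOf (QHopf.leftCoinv q)) ∧
      (∀ v : QHopf.Ver q, ∃! p : QHopf.OqSL2 q × QHopf.OqSL2 q,
        v = TensorProduct.tmul ℂ p.1 ⟨1, (QHopf.one_mem q).1⟩ +
          TensorProduct.tmul ℂ p.2 ⟨QHopf.tinvdt q, (QHopf.tinvdt_mem q).1⟩)) ∧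
    ∀ Δ, QHopf.IsCoactionExtension (QHopf.gradeA q) (QHopf.gradeH q) (QHopf.inclA q)
        (QHopf.inclH q) (QHopf.dA q) (QHopf.dH q) (QHopf.OqSL2.coact q) Δ →
      ((∀ k, QHopf.baseForms Δ ⊓ QHopf.gradeA q k =
          QHopf.formSpan (QHopf.dA q) (QHopf.inclA q '' QHopf.OqSL2.podles q) k) ∧
        QHopf.baseForms Δ =
          ⨆ k, QHopf.formSpan (QHopf.dA q) (QHopf.inclA q '' QHopf.OqSL2.podles q) k) ∧
      QHopf.horForms (QHopf.inclH q) Δ =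
        QHopf.bimoduleSpan (QHopf.inclA q) (QHopf.baseForms Δ) ∧
      ∃ s : QHopf.lam q 1 →ₗ[ℂ] QHopf.FormsA q,
        s ⟨QHopf.tinvdt q, QHopf.tinvdt_mem q⟩ = QHopf.eZero q ∧
        QHopf.IsConnectionOneForm Δ s := by
  have hq2 : (q : ℂ) ^ 2 ≠ 1 := hq 2 two_pos
  refine ⟨QHopf.isDifferentialCalculus_H q hq2, QHopf.isDifferentialCalculus_A q,
    ⟨QHopf.coactForms q, QHopf.isCoactionExtension_coactForms q hq2⟩,
    ⟨QHopf.lam_zero q, QHopf.lam_one q, fun _ => QHopf.lam_eq_bot q, QHopf.isCompl_lam q,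
      QHopf.existsUnique_ver q⟩, fun Δ hΔ => ?_⟩
  obtain rfl := hΔ.eq_coactForms hq2
  exact ⟨⟨QHopf.baseForms_inf_grade hq2, QHopf.baseForms_eq_iSup hq2⟩, QHopf.horForms_eq,
    QHopf.connection q, QHopf.connection_tinvdt q, QHopf.isConnectionOneForm q⟩
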